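/- Let $F$ be $\mathbb{R}$ or $\mathbb{C}$. A *tensor rank decomposition* of $T \in F^{n_1}\otimes F^{n_2}\otimes F^{n_3}$ is an expression of $T$ as a sum of the least possible number (the *tensor rank* of $T$) of product tensors $x\otimes y\otimes w$; it is *unique* if every other one arises from it by permuting the summands. Computations are performed on a random access machine over $F$, at unit cost per field operation, zero test, integer addition, (truncated) subtraction or comparison, and array access, with an oracle that diagonalizes diagonalizable matrices over $F$; a call on a $k\times k$ matrix costs $k^2+k+1$ steps. There are one algorithm and one constant $C$ such that, for all positive integers $n_1,n_2,n_3$, the following hold. 1. On every input $T \in F^{n_1}\otimes F^{n_2}\otimes F^{n_3}$ the algorithm halts after at most $C\,(n_1n_2)^{C}\, n_3$ steps and at most $C$ oracle calls. It outputs either "Fail" or vectors $x_a\in F^{n_1}$, $y_a\in F^{n_2}$, $w_a\in F^{n_3}$ ($a = 1,\dots,R'$), and in the latter case its output is correct: $T=\sum_a x_a\otimes y_a\otimes w_a$ is the unique tensor rank decomposition of $T$. Moreover, this output satisfies the following certificate: the matrices $v_a = x_a\otimes y_a$ are linearly independent, so are the $w_a$, and $$S^2(U)\cap I_2^{\perp}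 = \operatorname{span}\{v_a\otimes v_a : a=1,\dots,R'\},$$ where $U\subseteq V = F^{n_1}\otimes F^{n_2}$ is the span of the slices $T(\cdot,\cdot,k)$, $I_2\subseteq S^2(V^*)$ is the span of the $2\times 2$ minors, and $I_2^\perp\subseteq S^2(V)$ is its annihilator. 2. Let $R\ge 0$ be an integer with $$R\le \min\Big\{\tfrac14 (n_1-1)(n_2-1),\; n_3\Big\},$$ and let $X_1=\{x\otimes y\}\subseteq F^{n_1}\otimes F^{n_2}$ be the variety of matrices of rank at most one. There is a Zariski open dense subset $A$ of $X_1^{R}\times (F^{n_3})^{R}$ such that, for all $(v_1,\dots,v_R,w_1,\dots,w_R)\in A$, the tensor $T=\sum_{a=1}^R v_a\otimes w_a$ has tensor rank $R$, this is its unique tensor rank decomposition, and on input $T$ the algorithm does not output "Fail" but outputs this decomposition (up to the order of the summands), for every choice of the oracle's answers. -/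

import Mathlib

namespace TensorDecomp

noncomputable section

/-! ## Tensors, tensor rank, and unique rank decompositions -/

/-- The space `F^n₁ ⊗ F^n₂`, in coordinates. -/
abbrev Mat (F : Type*) (n₁ n₂ : ℕ) := Fin n₁ × Fin n₂ → F

/-- The space `F^n₁ ⊗ F^n₂ ⊗ F^n₃`, in coordinates. -/
abbrev Tensor (F : Type*) (n₁ n₂ n₃ : ℕ) := Fin n₁ → Fin n₂ → Fin n₃ → F

variable {F : Type*} [Field F] {n₁ n₂ n₃ : ℕ}

/-- The matrix `x ⊗ y`. -/
def tmul₂ (x : Fin n₁ → F) (y : Fin n₂ → F) : Mat F n₁ n₂ := fun q => x q.1 * y q.2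

/-- The tensor `v ⊗ w` of a matrix `v` and a vector `w`. -/
def tmulMat (v : Mat F n₁ n₂) (w : Fin n₃ → F) : Tensor F n₁ n₂ n₃ :=
  fun i j k => v (i, j) * w k

/-- The product tensor `x ⊗ y ⊗ w`. -/
def tmul₃ (x : Fin n₁ → F) (y : Fin n₂ → F) (w : Fin n₃ → F) : Tensor F n₁ n₂ n₃ :=
  fun i j k => x i * y j * w k

/-- `t` is a decomposition of `T` into `R` product tensors. -/
def IsDecomposition (T : Tensor F n₁ n₂ n₃) {R : ℕ} (t : Fin R → Tensor F n₁ n₂ n₃) : Prop :=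
  (∀ a, ∃ x y w, t a = tmul₃ x y w) ∧ T = ∑ a, t a

/-- The tensor rank: the least length of a decomposition into product tensors (a decomposition of
length `n₁ n₂ n₃` always exists). -/
def tensorRank (T : Tensor F n₁ n₂ n₃) : ℕ :=
  sInf {R | ∃ t : Fin R → Tensor F n₁ n₂ n₃, IsDecomposition T t}

/-- A tensor rank decomposition: a decomposition of the least possible length. -/
def IsRankDecomposition (T : Tensor F n₁ n₂ n₃) {R : ℕ} (t : Fin R → Tensor F n₁ n₂ n₃) : Prop :=
  IsDecomposition T t ∧ R = tensorRank T

/-- `t` is the unique tensor rank decomposition of `T`: it is a rank decomposition, and every rank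
decomposition arises from it by permuting the summands. -/
def IsUniqueRankDecomposition (T : Tensor F n₁ n₂ n₃) {R : ℕ}
    (t : Fin R → Tensor F n₁ n₂ n₃) : Prop :=
  IsRankDecomposition T t ∧
    ∀ t' : Fin R → Tensor F n₁ n₂ n₃, IsRankDecomposition T t' →
      ∃ σ : Equiv.Perm (Fin R), ∀ a, t' a = t (σ a)

/-! ## The degree-two certificate of uniqueness

For the linear space `U = T(W*)` of matrices spanned by the slices of `T`, the certificate compares
`S²(U)` with the annihilator in `S²(V)` of the span `I₂` of the `2 × 2` minors. -/

/-- The image `T(W*)` of `T`, viewed as a linear map from the dual of `W = F^n₃` to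
`V = F^n₁ ⊗ F^n₂`: the span of the slices `T(·, ·, k)`. -/
def sliceSpan (T : Tensor F n₁ n₂ n₃) : Submodule F (Mat F n₁ n₂) :=
  Submodule.span F (Set.range fun k : Fin n₃ => fun q : Fin n₁ × Fin n₂ => T q.1 q.2 k)

/-- The space `V ⊗ V` for `V = F^n₁ ⊗ F^n₂`, in coordinates. -/
abbrev MatSq (F : Type*) (n₁ n₂ : ℕ) := Fin n₁ × Fin n₂ → Fin n₁ × Fin n₂ → F

/-- `S²(U)`, as the space of symmetric tensors spanned by the symmetrizations of `u ⊗ u'` with `u`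
and `u'` in `U`. -/
def symSq (U : Submodule F (Mat F n₁ n₂)) : Submodule F (MatSq F n₁ n₂) :=
  Submodule.span F
    {M | ∃ u ∈ U, ∃ u' ∈ U, M = fun α β => u α * u' β + u' α * u β}

/-- The annihilator `I₂^⊥` in `S²(V)` of the span of the `2 × 2` minors: the minor
`x_{ij} x_{i'j'} - x_{ij'} x_{i'j}` pairs with the symmetric tensor `M` to
`M_{(i,j),(i',j')} - M_{(i,j'),(i',j)}`. -/
def minorsAnnihilator (F : Type*) [Field F] (n₁ n₂ : ℕ) : Submodule F (MatSq F n₁ n₂) where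
  carrier := {M | (∀ α β, M α β = M β α) ∧
    ∀ i i' j j', M (i, j) (i', j') - M (i, j') (i', j) = 0}
  zero_mem' := by constructor <;> intros <;> simp
  add_mem' := by
    rintro M N ⟨hM, hM'⟩ ⟨hN, hN'⟩
    refine ⟨fun α β => ?_, fun i i' j j' => ?_⟩
    · simp only [Pi.add_apply, hM α β, hN α β]
    · have h₁ := hM' i i' j j'
      have h₂ := hN' i i' j j'
      simp only [Pi.add_apply]
      linear_combination h₁ + h₂
  smul_mem' := by
    rintro c M ⟨hM, hM'⟩
    refine ⟨fun α β => ?_, fun i i' j j' => ?_⟩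
    · simp only [Pi.smul_apply, hM α β]
    · have h₁ := hM' i i' j j'
      simp only [Pi.smul_apply, smul_eq_mul]
      linear_combination c * h₁

/-- The certificate that `∑ a, v a ⊗ w a` is the unique rank decomposition of `T`: the `v a` are
linearly independent, so are the `w a`, and the squares `v a ⊗ v a` span `S²(T(W*)) ∩ I₂^⊥`. -/
def IsCertified (T : Tensor F n₁ n₂ n₃) {R : ℕ} (v : Fin R → Mat F n₁ n₂)
    (w : Fin R → Fin n₃ → F) : Prop :=
  T = ∑ a, tmulMat (v a) (w a) ∧
  LinearIndependent F v ∧ LinearIndependent F w ∧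
  symSq (sliceSpan T) ⊓ minorsAnnihilator F n₁ n₂ =
    Submodule.span F (Set.range fun a : Fin R => fun α β => v a α * v a β)

/-! ## Genericity -/

/-- Zariski closed subsets of affine space: the common zero sets of polynomials. -/
def IsZariskiClosed {ι : Type*} (Z : Set (ι → F)) : Prop :=
  ∃ S : Set (MvPolynomial ι F), Z = {p | ∀ f ∈ S, MvPolynomial.eval p f = 0}

/-- `A` is a Zariski open dense subset of `Y`, in the topology induced on `Y`. -/
def IsZariskiOpenDenseIn {ι : Type*} (Y A : Set (ι → F)) : Prop :=
  (∃ Z, IsZariskiClosed Z ∧ A = Y \ Z) ∧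
  ∀ Z, IsZariskiClosed Z → A ⊆ Z → Y ⊆ Z

/-- The affine space `V^R × W^R` with `V = F^n₁ ⊗ F^n₂` and `W = F^n₃`. -/
abbrev Params (F : Type*) (n₁ n₂ n₃ R : ℕ) := Fin R × (Fin n₁ × Fin n₂ ⊕ Fin n₃) → F

/-- The component `v_a` of a point of `V^R × W^R`. -/
def Params.v {R : ℕ} (p : Params F n₁ n₂ n₃ R) (a : Fin R) : Mat F n₁ n₂ :=
  fun q => p (a, Sum.inl q)

/-- The component `w_a` of a point of `V^R × W^R`. -/
def Params.w {R : ℕ} (p : Params F n₁ n₂ n₃ R) (a : Fin R) : Fin n₃ → F :=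
  fun k => p (a, Sum.inr k)

/-- The variety `X₁ = {x ⊗ y}` of matrices of rank at most one. -/
def rankOneVariety (F : Type*) [Field F] (n₁ n₂ : ℕ) : Set (Mat F n₁ n₂) :=
  {v | ∃ x y, v = tmul₂ x y}

/-- The variety `X₁^R × W^R`. -/
def paramVariety (F : Type*) [Field F] (n₁ n₂ n₃ R : ℕ) : Set (Params F n₁ n₂ n₃ R) :=
  {p | ∀ a, p.v a ∈ rankOneVariety F n₁ n₂}

/-- The tensor `∑ a, v_a ⊗ w_a` of a point of `V^R × W^R`. -/
def Params.tensor {R : ℕ} (p : Params F n₁ n₂ n₃ R) : Tensor F n₁ n₂ n₃ :=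
  ∑ a, tmulMat (p.v a) (p.w a)

/-! ## The model of computation

A random access machine over the field `F`, at unit cost per instruction, with an oracle that
diagonalizes matrices. There are integer variables, integer arrays and arrays of field elements;
arrays have three indices, which are read from variables. The programs are built from the
instructions by sequencing, branching and counted loops, so that every program halts. A program is
a finite text that contains no field constants except natural numbers: one program serves all
dimensions. -/

/-- An oracle takes a square matrix and returns a matrix and a vector. -/
def DiagOracle (F : Type*) :=
  (k : ℕ) → Matrix (Fin k) (Fin k) F → Matrix (Fin k) (Fin k) F × (Fin k → F)

/-- The oracle diagonalizes each diagonalizable matrix `A`: it returns an invertible matrix of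
eigenvectors, with their eigenvalues. Nothing is assumed about its answer on other matrices. -/
def DiagOracle.IsValid (O : DiagOracle F) : Prop :=
  ∀ (k : ℕ) (A : Matrix (Fin k) (Fin k) F),
    (∃ (P : Matrix (Fin k) (Fin k) F) (d : Fin k → F),
      IsUnit P.det ∧ A * P = P * Matrix.diagonal d) →
    IsUnit (O k A).1.det ∧ A * (O k A).1 = (O k A).1 * Matrix.diagonal (O k A).2

/-- The state of the machine, with the number `time` of steps made and the number `calls` of oracle
calls made so far. -/
structure State (F : Type*) where
  var : ℕ → ℕ
  nat : ℕ → ℕ → ℕ → ℕ → ℕ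
  fld : ℕ → ℕ → ℕ → ℕ → F
  time : ℕ
  calls : ℕ

/-- An array cell: the name of an array and the names of the three variables that hold the
indices. -/
structure Loc where
  arr : ℕ
  i : ℕ
  j : ℕ
  k : ℕ

inductive FieldOp
  | add | sub | mul | div

/-- Programs. -/
inductive Program
  /-- do nothing -/
  | skip
  /-- `x := c` -/
  | const (x c : ℕ)
  /-- `x := y + z` -/
  | add (x y z : ℕ)
  /-- `x := y - z`, truncated at zero -/
  | sub (x y z : ℕ)
  /-- `x := ` the content of an integer cell -/
  | load (x : ℕ) (l : Loc)
  /-- write the variable `x` to an integer cell -/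
  | store (l : Loc) (x : ℕ)
  /-- write the natural number `c` to a field cell -/
  | fconst (l : Loc) (c : ℕ)
  /-- copy the field cell `l₁` to `l` -/
  | fcopy (l l₁ : Loc)
  /-- write the result of the field operation on `l₁` and `l₂` to `l` -/
  | farith (op : FieldOp) (l l₁ l₂ : Loc)
  /-- let `k` be the value of `x`: call the oracle on the `k × k` matrix in array `A`, write the
  matrix that it returns to array `P` and the vector to array `D` -/
  | diagonalize (x A P D : ℕ)
  /-- first `c`, then `c'` -/
  | seq (c c' : Program)
  /-- if `x < y` then `c` else `c'` -/
  | ifLt (x y : ℕ) (c c' : Program)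
  /-- if the field cell `l` is zero then `c` else `c'` -/
  | ifZero (l : Loc) (c c' : Program)
  /-- let `m` be the value of `y` on entry: for `x` from `0` to `m - 1` do `c` -/
  | loop (x y : ℕ) (c : Program)

namespace State

/-- The content of a field cell. -/
def get (s : State F) (l : Loc) : F := s.fld l.arr (s.var l.i) (s.var l.j) (s.var l.k)

/-- The content of an integer cell. -/
def getNat (s : State F) (l : Loc) : ℕ := s.nat l.arr (s.var l.i) (s.var l.j) (s.var l.k)

/-- Let `t` time steps pass. -/
def tick (t : ℕ) (s : State F) : State F := { s with time := s.time + t }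

def setVar (x m : ℕ) (s : State F) : State F :=
  { s with var := fun x' => if x' = x then m else s.var x' }

def set (l : Loc) (c : F) (s : State F) : State F :=
  { s with fld := fun a i j k =>
      if a = l.arr ∧ i = s.var l.i ∧ j = s.var l.j ∧ k = s.var l.k then c else s.fld a i j k }

def setNat (l : Loc) (m : ℕ) (s : State F) : State F :=
  { s with nat := fun a i j k =>
      if a = l.arr ∧ i = s.var l.i ∧ j = s.var l.j ∧ k = s.var l.k then m else s.nat a i j k }

/-- The `m × m` matrix in the cells `(i, j, 0)` of array `A`. -/
def readMatrix (s : State F) (A m : ℕ) : Matrix (Fin m) (Fin m) F :=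
  Matrix.of fun i j => s.fld A i j 0

/-- Write a matrix to the cells `(i, j, 0)` of array `A`. -/
def writeMatrix (A : ℕ) {m : ℕ} (M : Matrix (Fin m) (Fin m) F) (s : State F) : State F :=
  { s with fld := fun a i j k =>
      if h : a = A ∧ i < m ∧ j < m ∧ k = 0 then M ⟨i, h.2.1⟩ ⟨j, h.2.2.1⟩ else s.fld a i j k }

/-- Write a vector to the cells `(i, 0, 0)` of array `A`. -/
def writeVector (A : ℕ) {m : ℕ} (d : Fin m → F) (s : State F) : State F :=
  { s with fld := fun a i j k =>
      if h : a = A ∧ i < m ∧ j = 0 ∧ k = 0 then d ⟨i, h.2.1⟩ else s.fld a i j k }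

/-- An oracle call on an `m × m` matrix takes `m² + m + 1` steps. -/
def callOracle (O : DiagOracle F) (m A P D : ℕ) (s : State F) : State F :=
  let ans := O m (s.readMatrix A m)
  let s' := writeVector D ans.2 (writeMatrix P ans.1 s)
  { s' with time := s.time + (m ^ 2 + m + 1), calls := s.calls + 1 }

end State

/-- The result of a field operation (with the convention `c / 0 = 0`). -/
def FieldOp.apply : FieldOp → F → F → F
  | add, c, c' => c + c'
  | sub, c, c' => c - c'
  | mul, c, c' => c * c'
  | div, c, c' => c / c'

/-- Perform `f 0`, …, `f (m - 1)`, in this order. -/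
def iterate {α : Type*} (f : ℕ → α → α) : ℕ → α → α
  | 0, s => s
  | m + 1, s => f m (iterate f m s)

open Classical in
/-- The state after running a program. Every instruction, every test and every round of a loop takes
one step (and so does setting up a loop); for the oracle see `State.callOracle`. -/
def Program.run (O : DiagOracle F) : Program → State F → State F
  | skip, s => s.tick 1
  | const x c, s => (s.setVar x c).tick 1
  | add x y z, s => (s.setVar x (s.var y + s.var z)).tick 1
  | sub x y z, s => (s.setVar x (s.var y - s.var z)).tick 1
  | load x l, s => (s.setVar x (s.getNat l)).tick 1
  | store l x, s => (s.setNat l (s.var x)).tick 1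
  | fconst l c, s => (s.set l (c : F)).tick 1
  | fcopy l l₁, s => (s.set l (s.get l₁)).tick 1
  | farith op l l₁ l₂, s => (s.set l (op.apply (s.get l₁) (s.get l₂))).tick 1
  | diagonalize x A P D, s => s.callOracle O (s.var x) A P D
  | seq c c', s => c'.run O (c.run O s)
  | ifLt x y c c', s =>
      if s.var x < s.var y then c.run O (s.tick 1) else c'.run O (s.tick 1)
  | ifZero l c c', s => if s.get l = 0 then c.run O (s.tick 1) else c'.run O (s.tick 1)
  | loop x y c, s =>
      iterate (fun m s' => c.run O ((s'.setVar x m).tick 1)) (s.var y) (s.tick 1)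

/-- The initial state on input `T`: the dimensions are in the variables `0, 1, 2`, the entries of
`T` are in the array `0`, and everything else is zero. -/
def inputState (T : Tensor F n₁ n₂ n₃) : State F where
  var x := if x = 0 then n₁ else if x = 1 then n₂ else if x = 2 then n₃ else 0
  nat _ _ _ _ := 0
  fld a i j k :=
    if h : a = 0 ∧ i < n₁ ∧ j < n₂ ∧ k < n₃ then T ⟨i, h.2.1⟩ ⟨j, h.2.2.1⟩ ⟨k, h.2.2.2⟩ else 0
  time := 0
  calls := 0

/-- The final state of a program on input `T`. -/
def Program.result (c : Program) (O : DiagOracle F) (T : Tensor F n₁ n₂ n₃) : State F :=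
  c.run O (inputState T)

namespace State

/-- The output is "Fail" if the variable `0` is zero at the end. -/
def IsFail (s : State F) : Prop := s.var 0 = 0

/-- The length of the decomposition that is output: the variable `1`. -/
def outLength (s : State F) : ℕ := s.var 1

/-- The vectors `x_a` of the output: the cells `(a, i, 0)` of array `1`. -/
def outX (n₁ : ℕ) (s : State F) (a : Fin s.outLength) : Fin n₁ → F := fun i => s.fld 1 a i 0

/-- The vectors `y_a` of the output: the cells `(a, j, 0)` of array `2`. -/
def outY (n₂ : ℕ) (s : State F) (a : Fin s.outLength) : Fin n₂ → F := fun j => s.fld 2 a j 0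

/-- The vectors `w_a` of the output: the cells `(a, k, 0)` of array `3`. -/
def outW (n₃ : ℕ) (s : State F) (a : Fin s.outLength) : Fin n₃ → F := fun k => s.fld 3 a k 0

/-- The summands `x_a ⊗ y_a ⊗ w_a` of the decomposition that is output. -/
def outSummand (n₁ n₂ n₃ : ℕ) (s : State F) (a : Fin s.outLength) : Tensor F n₁ n₂ n₃ :=
  tmul₃ (s.outX n₁ a) (s.outY n₂ a) (s.outW n₃ a)

end State

end

end TensorDecomp

open TensorDecomp

/-! Let `U` be the span of the slices and `R` its dimension. A decomposition of length `R` is the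
same as a basis `v a` of `U` by rank-one matrices, and no decomposition is shorter. The minors
vanish on the squares `v a ⊗ v a`. If they are independent on the mixed products of `v a` and `v b`,
`a < b` (`MinorIndependent`), then the squares span all of `S²(U) ∩ I₂^⊥`
(`symSq_inf_minorsAnnihilator`). The square of another rank-one matrix in `U` is then a combination
of these squares, which forces it to be a multiple of some `v a` (`IsCertified.unique`).
Independence of the minors depends only on their rank on `U` (`minorIndependent_iff`), so it can be
tested without knowing the decomposition.

To find the `v a`, take a basis `u = A v` of `U` among the slices and let `P` satisfy `Aᵀ * P = 1`,
so that the columns of `P` are the coordinates of the `v a`. The symmetrized solutions of the minor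
equations are the matrices `P D Pᵀ` with `D` diagonal, and the matrices `M` for which all `M P D Pᵀ`
are symmetric are the `P μ Aᵀ` with `μ` diagonal (`algebra_ker`). This commutative algebra comes
from linear equations alone, and its common eigenvectors are the columns of `P`. A member with
distinct eigenvalues is found without randomness: the trial matrices are projections of vectors of
powers of `t = 0, 1, …`, and the bad `t` are roots of a polynomial of known degree (`exists_good`);
Krylov vectors detect success. One oracle call gives the columns of `P` up to order and scale
(`eigenvectors_eq`), and a linear system gives the `w a` (`solve_eq`). The result is checked at the
end, so soundness needs nothing from the oracle (`Algo.sound`); validity of the oracle enters only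
in `Algo.complete`.

For genericity, the parameter variety is the image of an affine space, so the locus where certain
minors do not all vanish is dense as soon as it has a point (`isZariskiOpenDenseIn_of_range`). A
point is built from matrices in disjoint `2 × 2` blocks (`minorIndependent_gridMat`); there are
`⌊n₁/2⌋ ⌊n₂/2⌋ ≥ (n₁ - 1)(n₂ - 1)/4` blocks.

On the machine side, the algorithm is written in a small language whose denotation is a map of
states; compilation is proved correct once (`Cmd.compile_spec`). The cost follows from the syntactic
check `Program.tame`: loops over the polynomially bounded sizes may be nested, loops over `n₃` may
not, which makes the cost linear in `n₃` (`Program.tame_time`). -/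

namespace TensorDecomp

noncomputable section

set_option linter.unusedSectionVars false

variable {F : Type*} [Field F]

/-! ## A high-level language

Expressions with bounded sums and products, and commands which fill a block of an array with the
values of an expression. The commands use the integer variables below `100` and the arrays of field
elements below `100`; the variables `100 + ℓ` are bound by the sums, and the rest is scratch. -/

/-- Integer expressions. -/
inductive NExpr
  | var (x : ℕ)
  | const (c : ℕ)
  | add (e e' : NExpr)
  | load (a : ℕ) (e : NExpr)

/-- The `ℓ`-th bound variable. -/
abbrev lv (ℓ : ℕ) : ℕ := 100 + ℓ

namespace NExpr

def eval (s : State F) : NExpr → ℕ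
  | var x => s.var x
  | const c => c
  | add e e' => e.eval s + e'.eval s
  | load a e => s.nat a (e.eval s) (e.eval s) (e.eval s)

/-- The depth `d` acts as a stack pointer: the value ends in the variable `150 + d`, and pending
operands sit below it. A copy is an addition to zero. Lists are kept on the diagonal `(m, m, m)` of
a three-index array, so that no variable known to be zero is needed. -/
def compile : ℕ → NExpr → Program
  | d, var x => .seq (.const (150 + d) 0) (.add (150 + d) (150 + d) x)
  | d, const c => .const (150 + d) c
  | d, add e e' =>
    .seq (.seq (e.compile d) (e'.compile (d + 1))) (.add (150 + d) (150 + d) (150 + (d + 1)))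
  | d, load a e => .seq (e.compile d) (.load (150 + d) ⟨a, 150 + d, 150 + d, 150 + d⟩)

/-- The expression only uses variables that are in scope at level `ℓ`. -/
def wf (ℓ : ℕ) : NExpr → Bool
  | var x => decide (x < 100 + ℓ)
  | const _ => true
  | add e e' => e.wf ℓ && e'.wf ℓ
  | load _ e => e.wf ℓ

end NExpr

/-- Field expressions. -/
inductive FExpr
  | const (c : ℕ)
  | cell (a : ℕ) (i j k : NExpr)
  | op (o : FieldOp) (e e' : FExpr)
  /-- `1` if the integers are equal, else `0` -/
  | eq (e e' : NExpr)
  | sum (y : ℕ) (e : FExpr)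
  | prod (y : ℕ) (e : FExpr)

namespace FExpr

/-- The first argument counts the enclosing binders: a sum or product at level `ℓ` binds the
variable `lv ℓ`. -/
def eval : ℕ → State F → FExpr → F
  | _, _, const c => (c : F)
  | _, s, cell a i j k => s.fld a (i.eval s) (j.eval s) (k.eval s)
  | ℓ, s, op o e e' => o.apply (e.eval ℓ s) (e'.eval ℓ s)
  | _, s, eq e e' => if e.eval s = e'.eval s then 1 else 0
  | ℓ, s, sum y e => ∑ m ∈ Finset.range (s.var y), e.eval (ℓ + 1) (s.setVar (lv ℓ) m)
  | ℓ, s, prod y e => ∏ m ∈ Finset.range (s.var y), e.eval (ℓ + 1) (s.setVar (lv ℓ) m)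

/-- The scratch cell at depth `d`. -/
abbrev tmp (d : ℕ) : Loc := ⟨100 + d, 0, 0, 0⟩

def compile : ℕ → ℕ → FExpr → Program
  | _, d, const c => .fconst (tmp d) c
  | _, d, cell a i j k =>
    .seq (.seq (i.compile 0) (.seq (j.compile 1) (k.compile 2))) (.fcopy (tmp d) ⟨a, 150, 151, 152⟩)
  | ℓ, d, op o e e' =>
    .seq (.seq (e.compile ℓ d) (e'.compile ℓ (d + 1))) (.farith o (tmp d) (tmp d) (tmp (d + 1)))
  | _, d, eq e e' =>
    .seq (.seq (e.compile 0) (e'.compile 1))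
      (.ifLt 150 151 (.fconst (tmp d) 0) (.ifLt 151 150 (.fconst (tmp d) 0) (.fconst (tmp d) 1)))
  | ℓ, d, sum y e =>
    .seq (.fconst (tmp d) 0) (.loop (lv ℓ) y
      (.seq (e.compile (ℓ + 1) (d + 1)) (.farith .add (tmp d) (tmp d) (tmp (d + 1)))))
  | ℓ, d, prod y e =>
    .seq (.fconst (tmp d) 1) (.loop (lv ℓ) y
      (.seq (e.compile (ℓ + 1) (d + 1)) (.farith .mul (tmp d) (tmp d) (tmp (d + 1)))))

/-- The bound on `ℓ` keeps the bound variables `100 + ℓ` below `150`, where the integer scratch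
begins; the arrays that are read lie below `100`, where the field scratch begins. -/
def wf : ℕ → FExpr → Bool
  | _, const _ => true
  | ℓ, cell a i j k => decide (a < 100) && i.wf ℓ && j.wf ℓ && k.wf ℓ
  | ℓ, op _ e e' => e.wf ℓ && e'.wf ℓ
  | ℓ, eq e e' => e.wf ℓ && e'.wf ℓ
  | ℓ, sum y e => decide (ℓ < 49) && decide (y < 100 + ℓ) && e.wf (ℓ + 1)
  | ℓ, prod y e => decide (ℓ < 49) && decide (y < 100 + ℓ) && e.wf (ℓ + 1)

/-- The expression does not read the array `a`. -/
def avoids (a : ℕ) : FExpr → Bool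
  | const _ => true
  | cell a' _ _ _ => decide (a' ≠ a)
  | op _ e e' => e.avoids a && e'.avoids a
  | eq _ _ => true
  | sum _ e => e.avoids a
  | prod _ e => e.avoids a

end FExpr

/-- Equality of states up to bound variables of level at least `ℓ` and scratch. -/
structure Agree (ℓ d : ℕ) (s s' : State F) : Prop where
  var : ∀ x < 100 + ℓ, s.var x = s'.var x
  nat : s.nat = s'.nat
  fld : ∀ a < 100 + d, s.fld a = s'.fld a

theorem Agree.refl (ℓ d : ℕ) (s : State F) : Agree ℓ d s s := ⟨fun _ _ => rfl, rfl, fun _ _ => rfl⟩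

theorem Agree.trans {ℓ d : ℕ} {s s' s'' : State F} (h : Agree ℓ d s s') (h' : Agree ℓ d s' s'') :
    Agree ℓ d s s'' :=
  ⟨fun x hx => (h.var x hx).trans (h'.var x hx), h.nat.trans h'.nat,
    fun a ha => (h.fld a ha).trans (h'.fld a ha)⟩

theorem Agree.mono {ℓ d ℓ' d' : ℕ} {s s' : State F} (h : Agree ℓ d s s') (hl : ℓ' ≤ ℓ)
    (hd : d' ≤ d) : Agree ℓ' d' s s' :=
  ⟨fun x hx => h.var x (by omega), h.nat, fun a ha => h.fld a (by omega)⟩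

theorem Agree.setVar {ℓ d : ℕ} {s s' : State F} (h : Agree ℓ d s s') (x m : ℕ) :
    Agree ℓ d (s.setVar x m) (s'.setVar x m) := by
  refine ⟨fun x' hx => ?_, h.nat, h.fld⟩
  simp only [State.setVar]
  split_ifs
  · rfl
  · exact h.var x' hx

theorem Agree.setVar_level {ℓ d : ℕ} {s s' : State F} (h : Agree ℓ d s s') (m : ℕ) :
    Agree (ℓ + 1) d (s.setVar (lv ℓ) m) (s'.setVar (lv ℓ) m) := by
  refine ⟨fun x' hx => ?_, h.nat, h.fld⟩
  simp only [State.setVar]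
  split_ifs with h1
  · rfl
  · exact h.var x' (by simp only [lv] at h1; omega)

/-! ### Expressions: dependence on the state and correctness of their compilation. -/

theorem NExpr.eval_congr {ℓ d : ℕ} {s s' : State F} (h : Agree ℓ d s s') (e : NExpr)
    (he : e.wf ℓ = true) : e.eval s = e.eval s' := by
  induction e with
  | var x => exact h.var x (by simpa [wf] using he)
  | const c => rfl
  | add e e' ih ih' =>
    simp only [wf, Bool.and_eq_true] at he
    simp only [eval, ih he.1, ih' he.2]
  | load a e ih => simp only [eval, ih he, h.nat]

theorem FExpr.eval_congr {s s' : State F} (e : FExpr) {ℓ : ℕ} (h : Agree ℓ 0 s s')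
    (he : e.wf ℓ = true) : e.eval ℓ s = e.eval ℓ s' := by
  induction e generalizing ℓ s s' with
  | const c => rfl
  | cell a i j k =>
    simp only [wf, Bool.and_eq_true, decide_eq_true_eq] at he
    obtain ⟨⟨⟨ha, hi⟩, hj⟩, hk⟩ := he
    simp only [eval, h.fld a ha, NExpr.eval_congr h _ hi, NExpr.eval_congr h _ hj,
      NExpr.eval_congr h _ hk]
  | op o e e' ih ih' =>
    simp only [wf, Bool.and_eq_true] at he
    simp only [eval, ih h he.1, ih' h he.2]
  | eq e e' =>
    simp only [wf, Bool.and_eq_true] at he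
    simp only [eval, NExpr.eval_congr h _ he.1, NExpr.eval_congr h _ he.2]
  | sum y e ih =>
    simp only [wf, Bool.and_eq_true, decide_eq_true_eq] at he
    simp only [eval, h.var y he.1.2]
    exact Finset.sum_congr rfl fun m _ => ih (h.setVar_level m) he.2
  | prod y e ih =>
    simp only [wf, Bool.and_eq_true, decide_eq_true_eq] at he
    simp only [eval, h.var y he.1.2]
    exact Finset.prod_congr rfl fun m _ => ih (h.setVar_level m) he.2

theorem NExpr.eval_eq {s s' : State F} (e : NExpr) (hv : s.var = s'.var) (hn : s.nat = s'.nat) :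
    e.eval s = e.eval s' := by
  induction e with
  | var x => simp only [eval, hv]
  | const c => rfl
  | add e e' ih ih' => simp only [eval, ih, ih']
  | load a e ih => simp only [eval, ih, hn]

/-- The value of an expression does not depend on the arrays that it avoids. -/
theorem FExpr.eval_avoids {s s' : State F} (e : FExpr) {ℓ b : ℕ} (hv : s.var = s'.var)
    (hn : s.nat = s'.nat) (hf : ∀ a, a ≠ b → s.fld a = s'.fld a) (he : e.avoids b = true) :
    e.eval ℓ s = e.eval ℓ s' := by
  have hv' : ∀ m, (s.setVar (lv ℓ) m).var = (s'.setVar (lv ℓ) m).var := by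
    simp only [State.setVar, hv, implies_true]
  induction e generalizing ℓ s s' with
  | const c => rfl
  | cell a i j k =>
    simp only [eval, NExpr.eval_eq _ hv hn, hf a (by simpa [avoids] using he)]
  | op o e e' ih ih' =>
    simp only [avoids, Bool.and_eq_true] at he
    simp only [eval, ih hv hn hf he.1 hv', ih' hv hn hf he.2 hv']
  | eq e e' => simp only [eval, NExpr.eval_eq _ hv hn]
  | sum y e ih =>
    simp only [eval, hv]
    exact Finset.sum_congr rfl fun m _ => ih (hv' m) hn hf he fun m' => by
      simp only [State.setVar, hv]
  | prod y e ih =>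
    simp only [eval, hv]
    exact Finset.prod_congr rfl fun m _ => ih (hv' m) hn hf he fun m' => by
      simp only [State.setVar, hv]

/-- By `ℓ ≤ 50` all variables in scope are below `150`, so evaluating the first operand does not
disturb the second, and evaluating the second at depth `d + 1` keeps the value of the first. -/
theorem NExpr.compile_spec (O : DiagOracle F) (e : NExpr) {ℓ : ℕ} (hℓ : ℓ ≤ 50) (d : ℕ)
    (he : e.wf ℓ = true) (s : State F) :
    (∀ x < 150 + d, ((e.compile d).run O s).var x = s.var x) ∧
    ((e.compile d).run O s).nat = s.nat ∧ ((e.compile d).run O s).fld = s.fld ∧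
    ((e.compile d).run O s).var (150 + d) = e.eval s := by
  induction e generalizing d s with
  | var x =>
    have hx : x < 100 + ℓ := by simpa [wf] using he
    refine ⟨fun x' hx' => ?_, rfl, rfl, ?_⟩
    · have h1 : x' ≠ 150 + d := by omega
      simp [compile, Program.run, State.setVar, State.tick, h1]
    · have h1 : x ≠ 150 + d := by omega
      simp [compile, Program.run, State.setVar, State.tick, h1, eval]
  | const c =>
    refine ⟨fun x' hx' => ?_, rfl, rfl, ?_⟩
    · have h1 : x' ≠ 150 + d := by omega
      simp [compile, Program.run, State.setVar, State.tick, h1]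
    · simp [compile, Program.run, State.setVar, State.tick, eval]
  | add e e' ih ih' =>
    simp only [wf, Bool.and_eq_true] at he
    obtain ⟨a1, a2, a3, a4⟩ := ih d he.1 s
    obtain ⟨b1, b2, b3, b4⟩ := ih' (d + 1) he.2 ((e.compile d).run O s)
    have hA : Agree ℓ 0 ((e.compile d).run O s) s :=
      ⟨fun x hx => a1 x (by omega), a2, fun a _ => by rw [a3]⟩
    refine ⟨fun x' hx' => ?_, ?_, ?_, ?_⟩
    · have h1 : x' ≠ 150 + d := by omega
      simp only [compile, Program.run, State.setVar, State.tick, h1, if_false]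
      rw [b1 x' (by omega), a1 x' hx']
    · simp only [compile, Program.run, State.setVar, State.tick]
      rw [b2, a2]
    · simp only [compile, Program.run, State.setVar, State.tick]
      rw [b3, a3]
    · simp only [compile, Program.run, State.setVar, State.tick, if_true, eval]
      rw [b1 (150 + d) (by omega), a4, b4, eval_congr hA e' he.2]
  | load a e ih =>
    obtain ⟨a1, a2, a3, a4⟩ := ih d he s
    refine ⟨fun x' hx' => ?_, ?_, ?_, ?_⟩
    · have h1 : x' ≠ 150 + d := by omega
      simp only [compile, Program.run, State.setVar, State.tick, h1, if_false]
      rw [a1 x' hx']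
    · simp only [compile, Program.run, State.setVar, State.tick]
      rw [a2]
    · simp only [compile, Program.run, State.setVar, State.tick]
      rw [a3]
    · simp only [compile, Program.run, State.setVar, State.tick, if_true, eval, State.getNat]
      rw [a4, a2]

theorem iterate_induction {α : Type*} {f : ℕ → α → α} (I : ℕ → α → Prop) (n : ℕ) {s : α}
    (h0 : I 0 s) (hs : ∀ m < n, ∀ s, I m s → I (m + 1) (f m s)) : I n (iterate f n s) := by
  induction n with
  | zero => exact h0
  | succ n ih =>
    exact hs n (Nat.lt_succ_self n) _ (ih fun m hm => hs m (Nat.lt_succ_of_lt hm))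

/-- The running time plays no role for the values. -/
theorem Agree.tick {ℓ d : ℕ} (t : ℕ) (s : State F) : Agree ℓ d (s.tick t) s :=
  ⟨fun _ _ => rfl, rfl, fun _ _ => rfl⟩

theorem agree_set_tmp {ℓ d : ℕ} (c : F) (s : State F) : Agree ℓ d (s.set (FExpr.tmp d) c) s := by
  refine ⟨fun _ _ => rfl, rfl, fun a ha => ?_⟩
  funext i j k
  have : a ≠ 100 + d := by omega
  simp [State.set, this]

/-- The same stack discipline with the arrays `100 + d` as the stack: work at depth `d + 1` leaves
the partial result at depth `d` intact. -/
theorem FExpr.compile_spec (O : DiagOracle F) (e : FExpr) {ℓ : ℕ} (hℓ : ℓ < 50) (d : ℕ)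
    (he : e.wf ℓ = true) (s : State F) :
    Agree ℓ d ((e.compile ℓ d).run O s) s ∧
    ((e.compile ℓ d).run O s).get (tmp d) = e.eval ℓ s := by
  induction e generalizing d s ℓ with
  | const c =>
    refine ⟨(Agree.tick _ _).trans (agree_set_tmp _ _), ?_⟩
    simp [compile, Program.run, State.get, State.set, State.tick, eval]
  | cell a i j k =>
    simp only [wf, Bool.and_eq_true, decide_eq_true_eq] at he
    obtain ⟨⟨⟨ha, hi⟩, hj⟩, hk⟩ := he
    obtain ⟨a1, a2, a3, a4⟩ := NExpr.compile_spec O i hℓ.le 0 hi s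
    set s1 := (i.compile 0).run O s with hs1
    obtain ⟨b1, b2, b3, b4⟩ := NExpr.compile_spec O j hℓ.le 1 hj s1
    set s2 := (j.compile 1).run O s1 with hs2
    obtain ⟨c1, c2, c3, c4⟩ := NExpr.compile_spec O k hℓ.le 2 hk s2
    set s3 := (k.compile 2).run O s2 with hs3
    have h1 : Agree ℓ d s1 s := ⟨fun x hx => a1 x (by omega), a2, fun a _ => by rw [a3]⟩
    have h2 : Agree ℓ d s2 s1 := ⟨fun x hx => b1 x (by omega), b2, fun a _ => by rw [b3]⟩
    have h3 : Agree ℓ d s3 s2 := ⟨fun x hx => c1 x (by omega), c2, fun a _ => by rw [c3]⟩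
    refine ⟨(Agree.tick _ _).trans ((agree_set_tmp _ _).trans (h3.trans (h2.trans h1))), ?_⟩
    have e1 : s3.var 150 = i.eval s := by
      rw [c1 150 (by omega), b1 150 (by omega)]; exact a4
    have e2 : s3.var 151 = j.eval s := by
      rw [c1 151 (by omega), ← NExpr.eval_congr h1 j hj]; exact b4
    have e3 : s3.var 152 = k.eval s := by
      rw [← NExpr.eval_congr (h2.trans h1) k hk]; exact c4
    have e4 : s3.fld = s.fld := by rw [c3, b3, a3]
    simp only [compile, Program.run, ← hs1, ← hs2, ← hs3, State.get, State.set, State.tick, eval,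
      and_self, if_true, e1, e2, e3, e4]
  | op o e e' ih ih' =>
    simp only [wf, Bool.and_eq_true] at he
    obtain ⟨a1, a2⟩ := ih hℓ d he.1 s
    set s1 := (e.compile ℓ d).run O s with hs1
    obtain ⟨b1, b2⟩ := ih' hℓ (d + 1) he.2 s1
    set s2 := (e'.compile ℓ (d + 1)).run O s1 with hs2
    have h12 : Agree ℓ d s2 s1 := b1.mono le_rfl (by omega)
    refine ⟨(Agree.tick _ _).trans ((agree_set_tmp _ _).trans (h12.trans a1)), ?_⟩
    have e1 : s2.get (tmp d) = e.eval ℓ s := by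
      rw [← a2]
      simp only [State.get]
      -- The address of a scratch cell is read from the variable `0`, which evaluation does not
      -- change.
      rw [b1.fld (100 + d) (by omega), b1.var 0 (by omega)]
    rw [eval_congr e' (a1.mono le_rfl (Nat.zero_le d)) he.2] at b2
    simp only [compile, Program.run, ← hs1, ← hs2, e1, b2, eval]
    simp [State.get, State.set, State.tick]
  | eq e e' =>
    simp only [wf, Bool.and_eq_true] at he
    obtain ⟨a1, a2, a3, a4⟩ := NExpr.compile_spec O e hℓ.le 0 he.1 s
    set s1 := (e.compile 0).run O s with hs1
    obtain ⟨b1, b2, b3, b4⟩ := NExpr.compile_spec O e' hℓ.le 1 he.2 s1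
    set s2 := (e'.compile 1).run O s1 with hs2
    have h1 : Agree ℓ d s1 s := ⟨fun x hx => a1 x (by omega), a2, fun a _ => by rw [a3]⟩
    have h2 : Agree ℓ d s2 s1 := ⟨fun x hx => b1 x (by omega), b2, fun a _ => by rw [b3]⟩
    have e1 : s2.var 150 = e.eval s := by rw [b1 150 (by omega)]; exact a4
    have e2 : s2.var 151 = e'.eval s := by rw [← NExpr.eval_congr h1 e' he.2]; exact b4
    have e3 : (s2.tick 1).var = s2.var := rfl
    have h12 := h2.trans h1
    simp only [compile, Program.run, ← hs1, ← hs2, e1, e2, e3, eval]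
    split_ifs with g1 g2 g3 g4 g5
    · omega
    · refine ⟨(Agree.tick _ _).trans ((agree_set_tmp _ _).trans ((Agree.tick _ _).trans h12)), ?_⟩
      simp [State.get, State.set, State.tick]
    · omega
    · refine ⟨(Agree.tick _ _).trans ((agree_set_tmp _ _).trans ((Agree.tick _ _).trans
        ((Agree.tick _ _).trans h12))), ?_⟩
      simp [State.get, State.set, State.tick]
    · refine ⟨(Agree.tick _ _).trans ((agree_set_tmp _ _).trans ((Agree.tick _ _).trans
        ((Agree.tick _ _).trans h12))), ?_⟩
      simp [State.get, State.set, State.tick]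
    · omega
  | sum y e ih =>
    simp only [wf, Bool.and_eq_true, decide_eq_true_eq] at he
    obtain ⟨⟨hl, hy⟩, he⟩ := he
    simp only [compile, Program.run, eval]
    set s0 := (State.set (tmp d) ((0 : ℕ) : F) s).tick 1 with hs0
    have hA0 : Agree ℓ d s0 s := (Agree.tick _ _).trans (agree_set_tmp _ _)
    have hy0 : s0.var y = s.var y := rfl
    rw [hy0]
    -- The scratch cell holds the partial sum; all else that is in scope is as at the start, so each
    -- term may be evaluated in the initial state.
    refine iterate_induction (fun m s' => Agree ℓ d s' s ∧ s'.get (tmp d) =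
      ∑ m ∈ Finset.range m, e.eval (ℓ + 1) (s.setVar (lv ℓ) m)) (s.var y) ?_ ?_
    · refine ⟨(Agree.tick _ _).trans hA0, ?_⟩
      simp [hs0, State.get, State.set, State.tick]
    · rintro m hm s' ⟨hA, hg⟩
      obtain ⟨a1, a2⟩ := ih (ℓ := ℓ + 1) (by omega) (d + 1) he ((s'.setVar (lv ℓ) m).tick 1)
      have hv : Agree ℓ d ((s'.setVar (lv ℓ) m).tick 1) s' := by
        refine ⟨fun x hx => ?_, rfl, fun _ _ => rfl⟩
        have : x ≠ lv ℓ := by simp only [lv]; omega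
        simp [State.setVar, State.tick, this]
      set s2 := (e.compile (ℓ + 1) (d + 1)).run O ((s'.setVar (lv ℓ) m).tick 1) with hs2
      refine ⟨(Agree.tick _ _).trans ((agree_set_tmp _ _).trans
        ((a1.mono (by omega) (by omega)).trans (hv.trans hA))), ?_⟩
      have e1 : s2.get (tmp d) = s'.get (tmp d) := by
        simp only [State.get]
        rw [a1.fld (100 + d) (by omega), a1.var 0 (by omega), hv.var 0 (by omega)]
        rfl
      have hA' : Agree (ℓ + 1) 0 ((s'.setVar (lv ℓ) m).tick 1) (s.setVar (lv ℓ) m) :=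
        ((Agree.tick _ _).trans (hA.setVar_level m)).mono le_rfl (Nat.zero_le d)
      rw [eval_congr e hA' he] at a2
      rw [Finset.sum_range_succ, ← hg, ← e1, ← a2]
      simp [State.get, State.set, State.tick, FieldOp.apply]
  | prod y e ih =>
    simp only [wf, Bool.and_eq_true, decide_eq_true_eq] at he
    obtain ⟨⟨hl, hy⟩, he⟩ := he
    simp only [compile, Program.run, eval]
    set s0 := (State.set (tmp d) ((1 : ℕ) : F) s).tick 1 with hs0
    have hA0 : Agree ℓ d s0 s := (Agree.tick _ _).trans (agree_set_tmp _ _)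
    have hy0 : s0.var y = s.var y := rfl
    rw [hy0]
    refine iterate_induction (fun m s' => Agree ℓ d s' s ∧ s'.get (tmp d) =
      ∏ m ∈ Finset.range m, e.eval (ℓ + 1) (s.setVar (lv ℓ) m)) (s.var y) ?_ ?_
    · refine ⟨(Agree.tick _ _).trans hA0, ?_⟩
      simp [hs0, State.get, State.set, State.tick]
    · rintro m hm s' ⟨hA, hg⟩
      obtain ⟨a1, a2⟩ := ih (ℓ := ℓ + 1) (by omega) (d + 1) he ((s'.setVar (lv ℓ) m).tick 1)
      have hv : Agree ℓ d ((s'.setVar (lv ℓ) m).tick 1) s' := by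
        refine ⟨fun x hx => ?_, rfl, fun _ _ => rfl⟩
        have : x ≠ lv ℓ := by simp only [lv]; omega
        simp [State.setVar, State.tick, this]
      set s2 := (e.compile (ℓ + 1) (d + 1)).run O ((s'.setVar (lv ℓ) m).tick 1) with hs2
      refine ⟨(Agree.tick _ _).trans ((agree_set_tmp _ _).trans
        ((a1.mono (by omega) (by omega)).trans (hv.trans hA))), ?_⟩
      have e1 : s2.get (tmp d) = s'.get (tmp d) := by
        simp only [State.get]
        rw [a1.fld (100 + d) (by omega), a1.var 0 (by omega), hv.var 0 (by omega)]
        rfl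
      have hA' : Agree (ℓ + 1) 0 ((s'.setVar (lv ℓ) m).tick 1) (s.setVar (lv ℓ) m) :=
        ((Agree.tick _ _).trans (hA.setVar_level m)).mono le_rfl (Nat.zero_le d)
      rw [eval_congr e hA' he] at a2
      rw [Finset.prod_range_succ, ← hg, ← e1, ← a2]
      simp [State.get, State.set, State.tick, FieldOp.apply]

/-- Commands. -/
inductive Cmd
  | skip
  | nset (x : ℕ) (e : NExpr)
  /-- write to the integer cell `(e, e, e)` -/
  | nstore (a : ℕ) (e e' : NExpr)
  /-- fill the block `(i, j, k)`, `i < y₁`, `j < y₂`, `k < y₃` of an array with the values of an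
  expression, or add them to the old values if `acc` is set -/
  | map (acc : Bool) (a y₁ y₂ y₃ : ℕ) (e : FExpr)
  | seq (c c' : Cmd)
  | ifLt (x y : ℕ) (c c' : Cmd)
  | ifZero (e : FExpr) (c c' : Cmd)
  | loop (x y : ℕ) (c : Cmd)
  | diag (x A P D : ℕ)

namespace State

/-- Fill a block of the array `a`. -/
def fill (acc : Bool) (a m₁ m₂ m₃ : ℕ) (f : ℕ → ℕ → ℕ → F) (s : State F) : State F :=
  { s with fld := fun b i j k =>
      if b = a ∧ i < m₁ ∧ j < m₂ ∧ k < m₃ then (if acc then s.fld b i j k else 0) + f i j k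
      else s.fld b i j k }

/-- Bind the first three bound variables. -/
def bind₃ (s : State F) (i j k : ℕ) : State F :=
  ((s.setVar (lv 0) i).setVar (lv 1) j).setVar (lv 2) k

def setNat₁ (a i m : ℕ) (s : State F) : State F :=
  { s with nat := fun b i' j' k' => if b = a ∧ i' = i ∧ j' = i ∧ k' = i then m else s.nat b i' j' k' }

end State

namespace Cmd

open Classical in
/-- The effect of a command. -/
def den (O : DiagOracle F) : Cmd → State F → State F
  | skip, s => s
  | nset x e, s => s.setVar x (e.eval s)
  | nstore a e e', s => s.setNat₁ a (e.eval s) (e'.eval s)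
  | map acc a y₁ y₂ y₃ e, s =>
      s.fill acc a (s.var y₁) (s.var y₂) (s.var y₃) fun i j k => e.eval 3 (s.bind₃ i j k)
  | seq c c', s => c'.den O (c.den O s)
  | ifLt x y c c', s => if s.var x < s.var y then c.den O s else c'.den O s
  | ifZero e c c', s => if e.eval 0 s = 0 then c.den O s else c'.den O s
  | loop x y c, s => iterate (fun m s' => c.den O (s'.setVar x m)) (s.var y) s
  | diag x A P D, s => s.callOracle O (s.var x) A P D

def compile : Cmd → Program
  | skip => .skip
  | nset x e => .seq (e.compile 0) (.seq (.const x 0) (.add x x 150))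
  | nstore a e e' =>
    .seq (.seq (e.compile 0) (e'.compile 1)) (.store ⟨a, 150, 150, 150⟩ 151)
  | map acc a y₁ y₂ y₃ e =>
    .loop (lv 0) y₁ (.loop (lv 1) y₂ (.loop (lv 2) y₃ (.seq (e.compile 3 0)
      (bif acc then .farith .add ⟨a, lv 0, lv 1, lv 2⟩ ⟨a, lv 0, lv 1, lv 2⟩ (FExpr.tmp 0)
       else .fcopy ⟨a, lv 0, lv 1, lv 2⟩ (FExpr.tmp 0)))))
  | seq c c' => .seq c.compile c'.compile
  | ifLt x y c c' => .ifLt x y c.compile c'.compile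
  | ifZero e c c' => .seq (e.compile 0 0) (.ifZero (FExpr.tmp 0) c.compile c'.compile)
  | loop x y c => .loop x y c.compile
  | diag x A P D => .diagonalize x A P D

/-- The condition `e.avoids a` in `map` makes filling a block cell by cell equivalent to evaluating
all entries in the initial state, which is the meaning given by `den`. -/
def wf : Cmd → Bool
  | skip => true
  | nset x e => decide (x < 100) && e.wf 0
  | nstore _ e e' => e.wf 0 && e'.wf 0
  | map _ a y₁ y₂ y₃ e => decide (a < 100) && decide (y₁ < 100) && decide (y₂ < 100) &&
      decide (y₃ < 100) && e.wf 3 && e.avoids a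
  | seq c c' => c.wf && c'.wf
  | ifLt x y c c' => decide (x < 100) && decide (y < 100) && c.wf && c'.wf
  | ifZero e c c' => e.wf 0 && c.wf && c'.wf
  | loop x y c => decide (x < 100) && decide (y < 100) && c.wf
  | diag x A P D => decide (x < 100) && decide (A < 100) && decide (P < 100) && decide (D < 100)

end Cmd

/-! ### Correctness of the compilation of commands. -/

/-- The state obtained from `s` by writing the values of `f` to the cells `(i, j, k)` of the array
`a` that satisfy `D`. -/
def State.fillOn (acc : Bool) (a : ℕ) (D : ℕ → ℕ → ℕ → Prop) [∀ i j k, Decidable (D i j k)]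
    (f : ℕ → ℕ → ℕ → F) (s : State F) : State F :=
  { s with fld := fun b i j k =>
      if b = a ∧ D i j k then (if acc then s.fld b i j k else 0) + f i j k else s.fld b i j k }

theorem agree_fillOn_congr {acc : Bool} {a : ℕ} {D D' : ℕ → ℕ → ℕ → Prop}
    [∀ i j k, Decidable (D i j k)] [∀ i j k, Decidable (D' i j k)] {f : ℕ → ℕ → ℕ → F}
    {s s' : State F} (h : Agree 0 0 s' (s.fillOn acc a D f)) (hD : ∀ i j k, D i j k ↔ D' i j k) :
    Agree 0 0 s' (s.fillOn acc a D' f) := by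
  refine ⟨h.var, h.nat, fun b hb => ?_⟩
  rw [h.fld b hb]
  funext i j k
  simp only [State.fillOn, hD]

/-- `D` is the set of cells already written. The new cell must lie outside `D`, since with `acc` set
a second visit would add its value twice. Cells already written do not influence the value of `e`,
which avoids the array. -/
theorem map_body (O : DiagOracle F) {acc : Bool} {a : ℕ} {e : FExpr} (ha : a < 100)
    (he : e.wf 3 = true) (hea : e.avoids a = true) (s h : State F) (i j k : ℕ)
    {D : ℕ → ℕ → ℕ → Prop} [∀ i j k, Decidable (D i j k)] (hD : ¬ D i j k)
    (hs : Agree 0 0 s (h.fillOn acc a D fun i j k => e.eval 3 (h.bind₃ i j k)))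
    (h0 : s.var (lv 0) = i) (h1 : s.var (lv 1) = j) (h2 : s.var (lv 2) = k) :
    let s' := Program.run O (.seq (e.compile 3 0)
      (bif acc then .farith .add ⟨a, lv 0, lv 1, lv 2⟩ ⟨a, lv 0, lv 1, lv 2⟩ (FExpr.tmp 0)
       else .fcopy ⟨a, lv 0, lv 1, lv 2⟩ (FExpr.tmp 0))) s
    Agree 0 0 s' (h.fillOn acc a (fun i' j' k' => D i' j' k' ∨ (i' = i ∧ j' = j ∧ k' = k))
      fun i j k => e.eval 3 (h.bind₃ i j k)) ∧ s'.var (lv 0) = i ∧ s'.var (lv 1) = j := by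
  intro s'
  obtain ⟨a1, a2⟩ := FExpr.compile_spec O e (by norm_num : 3 < 50) 0 he s
  set s1 := (e.compile 3 0).run O s with hs1
  have ev : e.eval 3 s = e.eval 3 (h.bind₃ i j k) := by
    rw [FExpr.eval_congr (s' := (h.fillOn acc a D fun i j k => e.eval 3 (h.bind₃ i j k)).bind₃ i j k)
      e ?_ he]
    · refine FExpr.eval_avoids (b := a) e rfl rfl (fun b hb => ?_) hea
      funext i' j' k'
      simp [State.bind₃, State.setVar, State.fillOn, hb]
    · refine ⟨fun x hx => ?_, hs.nat, hs.fld⟩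
      simp only [State.bind₃, State.setVar]
      split_ifs with g1 g2 g3
      · rw [g1, h2]
      · rw [g2, h1]
      · rw [g3, h0]
      · exact hs.var x (by simp only [lv] at *; omega)
  rw [ev] at a2
  have e0 : s1.var (lv 0) = i := by rw [a1.var _ (by simp [lv]), h0]
  have e1 : s1.var (lv 1) = j := by rw [a1.var _ (by simp [lv]), h1]
  have e2 : s1.var (lv 2) = k := by rw [a1.var _ (by simp [lv]), h2]
  have hA : Agree 0 0 s1 (h.fillOn acc a D fun i j k => e.eval 3 (h.bind₃ i j k)) :=
    (a1.mono (by omega) le_rfl).trans hs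
  have key : s'.var = s1.var ∧ s'.nat = s1.nat ∧ s'.fld = fun b i' j' k' =>
      if b = a ∧ i' = i ∧ j' = j ∧ k' = k then
        (if acc then s1.fld b i' j' k' else 0) + e.eval 3 (h.bind₃ i j k)
      else s1.fld b i' j' k' := by
    cases acc
    · simp only [s', Program.run, ← hs1, cond_false, State.set, State.tick, a2, e0, e1, e2]
      refine ⟨trivial, trivial, ?_⟩
      funext b i' j' k'
      simp
    · simp only [s', Program.run, ← hs1, cond_true, State.set, State.tick, FieldOp.apply, a2, e0, e1,
        e2, if_true]
      refine ⟨trivial, trivial, ?_⟩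
      funext b i' j' k'
      split_ifs with g
      · obtain ⟨rfl, rfl, rfl, rfl⟩ := g
        simp only [State.get, e0, e1, e2]
      · rfl
  obtain ⟨k1, k2, k3⟩ := key
  refine ⟨⟨fun x hx => by rw [k1, hA.var x hx]; rfl, by rw [k2, hA.nat]; rfl, fun b hb => ?_⟩,
    by rw [k1, e0], by rw [k1, e1]⟩
  rw [k3]
  funext i' j' k'
  simp only [hA.fld b hb, State.fillOn]
  by_cases hb : b = a
  · by_cases hc : i' = i ∧ j' = j ∧ k' = k
    · obtain ⟨rfl, rfl, rfl⟩ := hc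
      simp [hb, hD]
    · simp [hb, hc]
  · simp [hb]

/-- The cells written so far form an initial segment of the block in lexicographic order; each of
the three nested invariants describes it at its own level. -/
theorem map_compile (O : DiagOracle F) {acc : Bool} {a y₁ y₂ y₃ : ℕ} {e : FExpr}
    (hw : (Cmd.map acc a y₁ y₂ y₃ e).wf = true) {s h : State F} (hs : Agree 0 0 s h) :
    Agree 0 0 ((Cmd.map acc a y₁ y₂ y₃ e).compile.run O s)
      ((Cmd.map acc a y₁ y₂ y₃ e).den O h) := by
  simp only [Cmd.wf, Bool.and_eq_true, decide_eq_true_eq] at hw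
  obtain ⟨⟨⟨⟨⟨ha, hy₁⟩, hy₂⟩, hy₃⟩, he⟩, hea⟩ := hw
  set f : ℕ → ℕ → ℕ → F := fun i j k => e.eval 3 (h.bind₃ i j k) with hf
  have setA : ∀ {t : State F} {D : ℕ → ℕ → ℕ → Prop} [∀ i j k, Decidable (D i j k)] (ℓ m : ℕ),
      Agree 0 0 t (h.fillOn acc a D f) →
      Agree 0 0 ((t.setVar (lv ℓ) m).tick 1) (h.fillOn acc a D f) := by
    intro t D _ ℓ m ht
    refine ⟨fun x hx => ?_, ht.nat, ht.fld⟩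
    have : x ≠ lv ℓ := by simp only [lv]; omega
    simp only [State.tick, State.setVar, this, if_false]
    exact ht.var x hx
  have hvar : ∀ {t : State F} {D : ℕ → ℕ → ℕ → Prop} [∀ i j k, Decidable (D i j k)] {y : ℕ},
      y < 100 → Agree 0 0 t (h.fillOn acc a D f) → t.var y = h.var y := by
    intro t D _ y hy ht
    exact ht.var y hy
  have main : Agree 0 0 ((Cmd.map acc a y₁ y₂ y₃ e).compile.run O s) (h.fillOn acc a
      (fun i j k => i < h.var y₁ ∧ j < h.var y₂ ∧ k < h.var y₃) f) := by
    simp only [Cmd.compile, Program.run]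
    rw [hs.var y₁ hy₁]
    refine iterate_induction (fun m t => Agree 0 0 t (h.fillOn acc a
      (fun i j k => i < m ∧ j < h.var y₂ ∧ k < h.var y₃) f)) _ ?_ ?_
    · refine ⟨hs.var, hs.nat, fun b hb => ?_⟩
      simp only [State.tick, hs.fld b hb]
      funext i j k
      simp [State.fillOn]
    intro i hi t ht
    set t1 := (t.setVar (lv 0) i).tick 1 with ht1
    have hA1 : Agree 0 0 t1 _ := setA 0 i ht
    have e1 : t1.var y₂ = h.var y₂ := hvar hy₂ hA1
    have i1 : t1.var (lv 0) = i := by simp [ht1, State.setVar, State.tick]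
    rw [e1]
    have := iterate_induction (fun m t => Agree 0 0 t (h.fillOn acc a
      (fun i' j k => (i' < i ∧ j < h.var y₂ ∧ k < h.var y₃) ∨ (i' = i ∧ j < m ∧ k < h.var y₃)) f) ∧
      t.var (lv 0) = i)
      (f := fun m s' => iterate (fun m s' => Program.run O (.seq (e.compile 3 0)
      (bif acc then .farith .add ⟨a, lv 0, lv 1, lv 2⟩ ⟨a, lv 0, lv 1, lv 2⟩ (FExpr.tmp 0)
       else .fcopy ⟨a, lv 0, lv 1, lv 2⟩ (FExpr.tmp 0))) ((s'.setVar (lv 2) m).tick 1))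
       (((s'.setVar (lv 1) m).tick 1).var y₃) (((s'.setVar (lv 1) m).tick 1).tick 1)) (h.var y₂)
       (s := t1.tick 1) ?_ ?_
    · exact agree_fillOn_congr this.1 fun i' j k => by omega
    · refine ⟨agree_fillOn_congr ((Agree.tick _ _).trans hA1) fun i' j k => by simp, i1⟩
    · rintro j hj t ⟨hA, i2⟩
      set t2 := (t.setVar (lv 1) j).tick 1 with ht2
      have hA2 : Agree 0 0 t2 _ := setA 1 j hA
      have e2 : t2.var y₃ = h.var y₃ := hvar hy₃ hA2
      have i3 : t2.var (lv 0) = i := by simpa [ht2, State.setVar, State.tick] using i2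
      have j3 : t2.var (lv 1) = j := by simp [ht2, State.setVar, State.tick]
      rw [e2]
      have := iterate_induction (fun m t => Agree 0 0 t (h.fillOn acc a
        (fun i' j' k => ((i' < i ∧ j' < h.var y₂ ∧ k < h.var y₃) ∨
          (i' = i ∧ j' < j ∧ k < h.var y₃)) ∨ (i' = i ∧ j' = j ∧ k < m)) f) ∧
        t.var (lv 0) = i ∧ t.var (lv 1) = j)
        (f := fun m s' => Program.run O (.seq (e.compile 3 0)
          (bif acc then .farith .add ⟨a, lv 0, lv 1, lv 2⟩ ⟨a, lv 0, lv 1, lv 2⟩ (FExpr.tmp 0)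
          else .fcopy ⟨a, lv 0, lv 1, lv 2⟩ (FExpr.tmp 0))) ((s'.setVar (lv 2) m).tick 1))
        (h.var y₃) (s := t2.tick 1) ?_ ?_
      · exact ⟨agree_fillOn_congr this.1 fun i' j' k => by omega, this.2.1⟩
      · refine ⟨agree_fillOn_congr ((Agree.tick _ _).trans hA2) fun i' j k => by simp, i3, j3⟩
      · rintro k hk t ⟨hA, i4, j4⟩
        set t3 := (t.setVar (lv 2) k).tick 1 with ht3
        have hA3 : Agree 0 0 t3 _ := setA 2 k hA
        have i5 : t3.var (lv 0) = i := by simpa [ht3, State.setVar, State.tick] using i4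
        have j5 : t3.var (lv 1) = j := by simpa [ht3, State.setVar, State.tick] using j4
        have k5 : t3.var (lv 2) = k := by simp [ht3, State.setVar, State.tick]
        obtain ⟨b1, b2, b3⟩ := map_body O ha he hea t3 h i j k (by simp) hA3 i5 j5 k5
        exact ⟨agree_fillOn_congr b1 fun i' j' k' => by omega, b2, b3⟩
  refine ⟨main.var, main.nat, fun b hb => ?_⟩
  rw [main.fld b hb]
  rfl

theorem agree_iterate {f g : ℕ → State F → State F} (n : ℕ) {s h : State F} (hs : Agree 0 0 s h)
    (H : ∀ m s h, Agree 0 0 s h → Agree 0 0 (f m s) (g m h)) :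
    Agree 0 0 (iterate f n s) (iterate g n h) := by
  induction n with
  | zero => exact hs
  | succ n ih => exact H n _ _ ih

/-- The compiled program does what the command says. -/
theorem Cmd.compile_spec (O : DiagOracle F) (c : Cmd) (hw : c.wf = true) {s h : State F}
    (hs : Agree 0 0 s h) : Agree 0 0 (c.compile.run O s) (c.den O h) := by
  induction c generalizing s h with
  | skip => exact (Agree.tick _ _).trans hs
  | nset x e =>
    simp only [wf, Bool.and_eq_true, decide_eq_true_eq] at hw
    obtain ⟨a1, a2, a3, a4⟩ := NExpr.compile_spec O e (by norm_num : 0 ≤ 50) 0 hw.2 s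
    refine ⟨fun x' hx' => ?_, ?_, fun b hb => ?_⟩
    · have h1 : 150 ≠ x := by omega
      simp only [compile, Program.run, den, State.setVar, State.tick, if_true, h1, if_false]
      split_ifs with g
      · rw [← NExpr.eval_congr hs e hw.2, ← a4, zero_add]
      · rw [a1 x' (by omega), hs.var x' hx']
    · simp only [compile, Program.run, den, State.setVar, State.tick, a2, hs.nat]
    · simp only [compile, Program.run, den, State.setVar, State.tick, a3, hs.fld b hb]
  | nstore a e e' =>
    simp only [wf, Bool.and_eq_true] at hw
    obtain ⟨a1, a2, a3, a4⟩ := NExpr.compile_spec O e (by norm_num : 0 ≤ 50) 0 hw.1 s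
    set s1 := (e.compile 0).run O s with hs1
    obtain ⟨b1, b2, b3, b4⟩ := NExpr.compile_spec O e' (by norm_num : 0 ≤ 50) 1 hw.2 s1
    set s2 := (e'.compile 1).run O s1 with hs2
    have h1 : Agree 0 0 s1 s := ⟨fun x hx => a1 x (by omega), a2, fun a _ => by rw [a3]⟩
    have h2 : Agree 0 0 s2 s1 := ⟨fun x hx => b1 x (by omega), b2, fun a _ => by rw [b3]⟩
    have hA := (h2.trans h1).trans hs
    have e1 : s2.var 150 = e.eval h := by
      rw [b1 150 (by omega), ← NExpr.eval_congr hs e hw.1]; exact a4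
    have e2 : s2.var 151 = e'.eval h := by
      rw [← NExpr.eval_congr (h1.trans hs) e' hw.2]; exact b4
    refine ⟨fun x hx => ?_, ?_, fun b hb => ?_⟩
    · simp only [compile, Program.run, ← hs1, ← hs2, den, State.setNat₁, State.setNat, State.tick]
      exact hA.var x hx
    · simp only [compile, Program.run, ← hs1, ← hs2, den, State.setNat₁, State.setNat, State.tick,
        e1, e2, hA.nat]
    · simp only [compile, Program.run, ← hs1, ← hs2, den, State.setNat₁, State.setNat, State.tick]
      exact hA.fld b hb
  | map acc a y₁ y₂ y₃ e => exact map_compile O hw hs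
  | seq c c' ih ih' =>
    simp only [wf, Bool.and_eq_true] at hw
    exact ih' hw.2 (ih hw.1 hs)
  | ifLt x y c c' ih ih' =>
    simp only [wf, Bool.and_eq_true, decide_eq_true_eq] at hw
    simp only [compile, Program.run, den, hs.var x hw.1.1.1, hs.var y hw.1.1.2]
    split_ifs
    · exact ih hw.1.2 ((Agree.tick _ _).trans hs)
    · exact ih' hw.2 ((Agree.tick _ _).trans hs)
  | ifZero e c c' ih ih' =>
    simp only [wf, Bool.and_eq_true] at hw
    obtain ⟨a1, a2⟩ := FExpr.compile_spec O e (by norm_num : 0 < 50) 0 hw.1.1 s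
    rw [FExpr.eval_congr e hs hw.1.1] at a2
    simp only [compile, Program.run, den]
    by_cases h0 : e.eval 0 h = 0
    · rw [if_pos (a2.trans h0), if_pos h0]
      exact ih hw.1.2 ((Agree.tick _ _).trans (a1.trans hs))
    · rw [if_neg (fun h1 => h0 (a2.symm.trans h1)), if_neg h0]
      exact ih' hw.2 ((Agree.tick _ _).trans (a1.trans hs))
  | loop x y c ih =>
    simp only [wf, Bool.and_eq_true, decide_eq_true_eq] at hw
    simp only [compile, Program.run, den, hs.var y hw.1.2]
    exact agree_iterate _ ((Agree.tick _ _).trans hs) fun m s h hsh =>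
      ih hw.2 ((Agree.tick _ _).trans (hsh.setVar x m))
  | diag x A P D =>
    simp only [wf, Bool.and_eq_true, decide_eq_true_eq] at hw
    obtain ⟨⟨⟨hx, hA⟩, hP⟩, hD⟩ := hw
    have e1 : s.readMatrix A (h.var x) = h.readMatrix A (h.var x) := by
      simp only [State.readMatrix, hs.fld A hA]
    simp only [compile, Program.run, den, hs.var x hx]
    refine ⟨hs.var, hs.nat, fun b hb => ?_⟩
    simp only [State.callOracle, State.writeVector, State.writeMatrix, e1, hs.fld b hb]

/-! ## Bounds on the running time -/

/-- A program that does not change the variables in `S` and `L`, and whose loops are bounded by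
variables in `S`, or in `L` (these loops must not be nested, and occur only if `big` is set).
The oracle is only called outside of loops, and only if `orc` is set. -/
def Program.tame : List ℕ → List ℕ → Bool → Bool → Program → Bool
  | _, _, _, _, .skip => true
  | S, L, _, _, .const x _ => !S.contains x && !L.contains x
  | S, L, _, _, .add x _ _ => !S.contains x && !L.contains x
  | S, L, _, _, .sub x _ _ => !S.contains x && !L.contains x
  | S, L, _, _, .load x _ => !S.contains x && !L.contains x
  | _, _, _, _, .store _ _ => true
  | _, _, _, _, .fconst _ _ => true
  | _, _, _, _, .fcopy _ _ => true
  | _, _, _, _, .farith _ _ _ _ => true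
  | S, _, _, orc, .diagonalize x _ _ _ => orc && S.contains x
  | S, L, big, orc, .seq c c' => c.tame S L big orc && c'.tame S L big orc
  | S, L, big, orc, .ifLt _ _ c c' => c.tame S L big orc && c'.tame S L big orc
  | S, L, big, orc, .ifZero _ c c' => c.tame S L big orc && c'.tame S L big orc
  | S, L, big, _, .loop x y c => !S.contains x && !L.contains x &&
      ((S.contains y && c.tame (x :: S) L big false) ||
        (L.contains y && big && c.tame S L false false))

theorem Program.tame_keeps (O : DiagOracle F) (c : Program) {S L : List ℕ} {big orc : Bool}
    (hc : c.tame S L big orc = true) (s : State F) (x : ℕ) (hx : x ∈ S ∨ x ∈ L) :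
    (c.run O s).var x = s.var x := by
  have key : ∀ {y : ℕ}, (!S.contains y && !L.contains y) = true → x ≠ y := by
    intro y hy
    simp only [Bool.and_eq_true, Bool.not_eq_true', List.contains_eq_mem, decide_eq_false_iff_not]
      at hy
    rintro rfl
    exact hx.elim hy.1 hy.2
  induction c generalizing s S L big orc with
  | skip => rfl
  | const y c => simp [run, State.tick, State.setVar, key hc]
  | add y _ _ => simp [run, State.tick, State.setVar, key hc]
  | sub y _ _ => simp [run, State.tick, State.setVar, key hc]
  | load y _ => simp [run, State.tick, State.setVar, key hc]
  | store _ _ => rfl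
  | fconst _ _ => rfl
  | fcopy _ _ => rfl
  | farith _ _ _ _ => rfl
  | diagonalize _ _ _ _ => rfl
  | seq c c' ih ih' =>
    simp only [tame, Bool.and_eq_true] at hc
    exact (ih' hc.2 _ hx key).trans (ih hc.1 s hx key)
  | ifLt _ _ c c' ih ih' =>
    simp only [tame, Bool.and_eq_true] at hc
    simp only [run]
    split_ifs
    · exact ih hc.1 _ hx key
    · exact ih' hc.2 _ hx key
  | ifZero _ c c' ih ih' =>
    simp only [tame, Bool.and_eq_true] at hc
    simp only [run]
    split_ifs
    · exact ih hc.1 _ hx key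
    · exact ih' hc.2 _ hx key
  | loop z y c ih =>
    rw [tame, Bool.and_eq_true, Bool.or_eq_true] at hc
    obtain ⟨h1, h2⟩ := hc
    have hz := key h1
    simp only [run]
    refine iterate_induction (fun _ (s' : State F) => s'.var x = s.var x) _ rfl
      fun m _ s' hs' => ?_
    have e1 : ((s'.setVar z m).tick 1).var x = s.var x := by
      simpa [State.setVar, State.tick, hz] using hs'
    rw [← e1]
    rcases h2 with h2 | h2
    · rw [Bool.and_eq_true] at h2
      refine ih h2.2 _ (hx.imp (List.mem_cons_of_mem _) id) fun {y} hy => ?_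
      refine key ?_
      simp only [Bool.and_eq_true, Bool.not_eq_true', List.contains_eq_mem,
        decide_eq_false_iff_not, List.mem_cons, not_or] at hy ⊢
      exact ⟨hy.1.2, hy.2⟩
    · simp only [Bool.and_eq_true] at h2
      exact ih h2.2 _ hx key

/-- The sum of the exponents is a crude substitute for their maximum. -/
theorem seq_bound {B W K₁ K₂ d₁ d₂ : ℕ} (hB : 1 ≤ B) :
    K₁ * B ^ d₁ * W + K₂ * B ^ d₂ * W ≤ (K₁ + K₂) * B ^ (d₁ + d₂) * W := by
  have h1 : B ^ d₁ ≤ B ^ (d₁ + d₂) := Nat.pow_le_pow_right hB (by omega)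
  have h2 : B ^ d₂ ≤ B ^ (d₁ + d₂) := Nat.pow_le_pow_right hB (by omega)
  calc K₁ * B ^ d₁ * W + K₂ * B ^ d₂ * W
      ≤ K₁ * B ^ (d₁ + d₂) * W + K₂ * B ^ (d₁ + d₂) * W := by gcongr
    _ = _ := by ring

/-- A loop bounded by `S` multiplies the cost by at most `B`, and its counter, also at most `B`, may
bound further loops. A loop bounded by `L` multiplies it by `H`, but its body has `big` unset, so
this factor occurs only once. Loop bodies have `orc` unset, hence the number of oracle calls depends
on the text of the program only. -/
theorem Program.tame_time (c : Program) {S L : List ℕ} {big orc : Bool}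
    (hc : c.tame S L big orc = true) :
    ∃ K d : ℕ, ∀ (O : DiagOracle F) (s : State F) (B H : ℕ), 1 ≤ B → 1 ≤ H →
      (∀ x ∈ S, s.var x ≤ B) → (∀ x ∈ L, s.var x ≤ H) →
      (c.run O s).time ≤ s.time + K * B ^ d * (if big then H else 1) ∧
      (c.run O s).calls ≤ s.calls + (if orc then K else 0) := by
  have one : ∀ {B H d : ℕ} {big : Bool}, 1 ≤ B → 1 ≤ H →
      1 ≤ 1 * B ^ d * (if big then H else 1) := by
    intro B H d big hB hH
    have h1 : 1 ≤ B ^ d := Nat.one_le_pow _ _ hB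
    cases big
    · simpa using h1
    · simpa using Nat.mul_le_mul h1 hH
  induction c generalizing S L big orc with
  | skip => exact ⟨1, 0, fun O s B H hB hH _ _ => ⟨Nat.add_le_add_left (one hB hH) _, Nat.le_add_right _ _⟩⟩
  | const _ _ => exact ⟨1, 0, fun O s B H hB hH _ _ => ⟨Nat.add_le_add_left (one hB hH) _, Nat.le_add_right _ _⟩⟩
  | add _ _ _ => exact ⟨1, 0, fun O s B H hB hH _ _ => ⟨Nat.add_le_add_left (one hB hH) _, Nat.le_add_right _ _⟩⟩
  | sub _ _ _ => exact ⟨1, 0, fun O s B H hB hH _ _ => ⟨Nat.add_le_add_left (one hB hH) _, Nat.le_add_right _ _⟩⟩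
  | load _ _ => exact ⟨1, 0, fun O s B H hB hH _ _ => ⟨Nat.add_le_add_left (one hB hH) _, Nat.le_add_right _ _⟩⟩
  | store _ _ => exact ⟨1, 0, fun O s B H hB hH _ _ => ⟨Nat.add_le_add_left (one hB hH) _, Nat.le_add_right _ _⟩⟩
  | fconst _ _ => exact ⟨1, 0, fun O s B H hB hH _ _ => ⟨Nat.add_le_add_left (one hB hH) _, Nat.le_add_right _ _⟩⟩
  | fcopy _ _ => exact ⟨1, 0, fun O s B H hB hH _ _ => ⟨Nat.add_le_add_left (one hB hH) _, Nat.le_add_right _ _⟩⟩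
  | farith _ _ _ _ => exact ⟨1, 0, fun O s B H hB hH _ _ => ⟨Nat.add_le_add_left (one hB hH) _, Nat.le_add_right _ _⟩⟩
  | diagonalize x _ _ _ =>
    simp only [tame, Bool.and_eq_true, List.contains_eq_mem, decide_eq_true_eq] at hc
    obtain ⟨rfl, hx⟩ := hc
    refine ⟨3, 2, fun O s B H hB hH hS hL => ⟨?_, ?_⟩⟩
    · have h1 := hS x hx
      simp only [run, State.callOracle]
      refine Nat.add_le_add_left ?_ _
      have h2 : s.var x ^ 2 ≤ B ^ 2 := Nat.pow_le_pow_left h1 2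
      have h3 : B ≤ B ^ 2 := by nlinarith
      calc s.var x ^ 2 + s.var x + 1 ≤ 3 * B ^ 2 * 1 := by omega
        _ ≤ 3 * B ^ 2 * (if big then H else 1) := Nat.mul_le_mul_left _ (by split_ifs <;> omega)
    · simp [run, State.callOracle]
  | seq c c' ih ih' =>
    simp only [tame, Bool.and_eq_true] at hc
    obtain ⟨K₁, d₁, h₁⟩ := ih hc.1
    obtain ⟨K₂, d₂, h₂⟩ := ih' hc.2
    refine ⟨K₁ + K₂, d₁ + d₂, fun O s B H hB hH hS hL => ?_⟩
    obtain ⟨a1, a2⟩ := h₁ O s B H hB hH hS hL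
    obtain ⟨b1, b2⟩ := h₂ O (c.run O s) B H hB hH
      (fun x hx => by rw [tame_keeps O c hc.1 s x (Or.inl hx)]; exact hS x hx)
      (fun x hx => by rw [tame_keeps O c hc.1 s x (Or.inr hx)]; exact hL x hx)
    have := seq_bound (W := if big then H else 1) (K₁ := K₁) (K₂ := K₂) (d₁ := d₁) (d₂ := d₂) hB
    simp only [run]
    refine ⟨by omega, ?_⟩
    split_ifs at a2 b2 ⊢ <;> omega
  | ifLt x y c c' ih ih' =>
    simp only [tame, Bool.and_eq_true] at hc
    obtain ⟨K₁, d₁, h₁⟩ := ih hc.1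
    obtain ⟨K₂, d₂, h₂⟩ := ih' hc.2
    refine ⟨K₁ + K₂ + 1, d₁ + d₂, fun O s B H hB hH hS hL => ?_⟩
    obtain ⟨a1, a2⟩ := h₁ O (s.tick 1) B H hB hH hS hL
    obtain ⟨b1, b2⟩ := h₂ O (s.tick 1) B H hB hH hS hL
    have := seq_bound (W := if big then H else 1) (K₁ := K₁) (K₂ := K₂) (d₁ := d₁) (d₂ := d₂) hB
    have h1 := one (d := d₁ + d₂) (big := big) hB hH
    have e1 : (s.tick 1).time = s.time + 1 := rfl
    have e2 : (s.tick 1).calls = s.calls := rfl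
    rw [e1] at a1 b1
    rw [e2] at a2 b2
    rw [add_mul, add_mul]
    simp only [run]
    by_cases hxy : s.var x < s.var y
    · rw [if_pos hxy]
      refine ⟨by omega, ?_⟩
      split_ifs at a2 ⊢ <;> omega
    · rw [if_neg hxy]
      refine ⟨by omega, ?_⟩
      split_ifs at b2 ⊢ <;> omega
  | ifZero l c c' ih ih' =>
    simp only [tame, Bool.and_eq_true] at hc
    obtain ⟨K₁, d₁, h₁⟩ := ih hc.1
    obtain ⟨K₂, d₂, h₂⟩ := ih' hc.2
    refine ⟨K₁ + K₂ + 1, d₁ + d₂, fun O s B H hB hH hS hL => ?_⟩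
    obtain ⟨a1, a2⟩ := h₁ O (s.tick 1) B H hB hH hS hL
    obtain ⟨b1, b2⟩ := h₂ O (s.tick 1) B H hB hH hS hL
    have := seq_bound (W := if big then H else 1) (K₁ := K₁) (K₂ := K₂) (d₁ := d₁) (d₂ := d₂) hB
    have h1 := one (d := d₁ + d₂) (big := big) hB hH
    have e1 : (s.tick 1).time = s.time + 1 := rfl
    have e2 : (s.tick 1).calls = s.calls := rfl
    rw [e1] at a1 b1
    rw [e2] at a2 b2
    rw [add_mul, add_mul]
    simp only [run]
    by_cases hxy : s.get l = 0
    · rw [if_pos hxy]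
      refine ⟨by omega, ?_⟩
      split_ifs at a2 ⊢ <;> omega
    · rw [if_neg hxy]
      refine ⟨by omega, ?_⟩
      split_ifs at b2 ⊢ <;> omega
  | loop z y c ih =>
    have hkeep := fun O s => tame_keeps (F := F) O (.loop z y c) hc s
    rw [tame, Bool.and_eq_true, Bool.or_eq_true] at hc
    obtain ⟨h1, h2⟩ := hc
    have hz : z ∉ S ∧ z ∉ L := by
      simpa only [Bool.and_eq_true, Bool.not_eq_true', List.contains_eq_mem,
        decide_eq_false_iff_not] using h1
    -- one round takes at most `1 + M` steps
    have rounds : ∀ (O : DiagOracle F) (s : State F) (M : ℕ),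
        (∀ m < s.var y, ∀ s' : State F, (∀ x, x ∈ S ∨ x ∈ L → s'.var x = s.var x) →
          (∀ x, x ∈ S ∨ x ∈ L → (c.run O ((s'.setVar z m).tick 1)).var x = s.var x) ∧
          (c.run O ((s'.setVar z m).tick 1)).time ≤ s'.time + 1 + M ∧
          (c.run O ((s'.setVar z m).tick 1)).calls ≤ s'.calls) →
        ((Program.loop z y c).run O s).time ≤ s.time + 1 + s.var y * (1 + M) ∧
        ((Program.loop z y c).run O s).calls ≤ s.calls := by
      intro O s M hM
      have := iterate_induction (f := fun m s' => c.run O ((s'.setVar z m).tick 1))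
        (fun m (s' : State F) => (∀ x, x ∈ S ∨ x ∈ L → s'.var x = s.var x) ∧
          s'.time ≤ s.time + 1 + m * (1 + M) ∧ s'.calls ≤ s.calls) (s.var y) (s := s.tick 1)
        ⟨fun _ _ => rfl, by simp [State.tick], le_rfl⟩ ?_
      · exact this.2
      · rintro m hm s' ⟨b1, b2, b3⟩
        obtain ⟨c1, c2, c3⟩ := hM m hm s' b1
        refine ⟨c1, ?_, c3.trans b3⟩
        rw [add_mul, one_mul]
        omega
    have ev : ∀ (s' : State F) (m x : ℕ), x ∈ S ∨ x ∈ L →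
        ((s'.setVar z m).tick 1).var x = s'.var x := by
      intro s' m x hx
      have : x ≠ z := by rintro rfl; exact hx.elim hz.1 hz.2
      simp [State.tick, State.setVar, this]
    rcases h2 with h2 | h2
    · simp only [Bool.and_eq_true, List.contains_eq_mem, decide_eq_true_eq] at h2
      obtain ⟨hy, h2⟩ := h2
      obtain ⟨K, d, hK⟩ := ih h2
      -- The summand `2` pays for setting up the loop and for the step that each round takes.
      refine ⟨K + 2, d + 1, fun O s B H hB hH hS hL => ?_⟩
      set W := if big then H else 1 with hW
      have hW1 : 1 ≤ W := by rw [hW]; split_ifs <;> omega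
      obtain ⟨a1, a2⟩ := rounds O s (K * B ^ d * W) fun m hm s' hs' => by
        have hv : ∀ x ∈ z :: S, ((s'.setVar z m).tick 1).var x ≤ B := by
          intro x hx
          rcases List.mem_cons.1 hx with rfl | hx
          · simp only [State.tick, State.setVar, if_true]
            exact hm.le.trans (hS y hy)
          · rw [ev s' m x (Or.inl hx), hs' x (Or.inl hx)]; exact hS x hx
        obtain ⟨b1, b2⟩ := hK O ((s'.setVar z m).tick 1) B H hB hH hv fun x hx => by
          rw [ev s' m x (Or.inr hx), hs' x (Or.inr hx)]; exact hL x hx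
        refine ⟨fun x hx => ?_, b1, by simpa [State.tick, State.setVar] using b2⟩
        rw [tame_keeps O c h2 _ x (hx.imp (List.mem_cons_of_mem _) id), ev s' m x hx, hs' x hx]
      refine ⟨a1.trans ?_, a2.trans (Nat.le_add_right _ _)⟩
      have h3 := hS y hy
      have h4 : s.var y * (1 + K * B ^ d * W) ≤ B * (1 + K * B ^ d * W) :=
        Nat.mul_le_mul_right _ h3
      have h5 : B ≤ B ^ (d + 1) * W := by
        calc B = B ^ 1 * 1 := by ring
          _ ≤ B ^ (d + 1) * W := Nat.mul_le_mul (Nat.pow_le_pow_right hB (by omega)) hW1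
      have h6 : (K + 2) * B ^ (d + 1) * W = B * (K * B ^ d * W) + 2 * (B ^ (d + 1) * W) := by ring
      rw [h6]
      have h7 : B * (1 + K * B ^ d * W) = B + B * (K * B ^ d * W) := by ring
      omega
    · simp only [Bool.and_eq_true, List.contains_eq_mem, decide_eq_true_eq] at h2
      obtain ⟨⟨hy, rfl⟩, h2⟩ := h2
      obtain ⟨K, d, hK⟩ := ih h2
      refine ⟨K + 2, d, fun O s B H hB hH hS hL => ?_⟩
      obtain ⟨a1, a2⟩ := rounds O s (K * B ^ d) fun m hm s' hs' => by
        obtain ⟨b1, b2⟩ := hK O ((s'.setVar z m).tick 1) B H hB hH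
          (fun x hx => by rw [ev s' m x (Or.inl hx), hs' x (Or.inl hx)]; exact hS x hx)
          (fun x hx => by rw [ev s' m x (Or.inr hx), hs' x (Or.inr hx)]; exact hL x hx)
        refine ⟨fun x hx => ?_, by simpa [State.tick, State.setVar] using b1,
          by simpa [State.tick, State.setVar] using b2⟩
        rw [tame_keeps O c h2 _ x hx, ev s' m x hx, hs' x hx]
      refine ⟨a1.trans ?_, a2.trans (Nat.le_add_right _ _)⟩
      have h3 := hL y hy
      have h4 : s.var y * (1 + K * B ^ d) ≤ H * (1 + K * B ^ d) :=
        Nat.mul_le_mul_right _ h3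
      have h5 : H ≤ B ^ d * H := Nat.le_mul_of_pos_left _ (Nat.pow_pos hB)
      rw [if_pos rfl]
      have h6 : (K + 2) * B ^ d * H = H * (K * B ^ d) + 2 * (B ^ d * H) := by ring
      rw [h6]
      have h7 : H * (1 + K * B ^ d) = H + H * (K * B ^ d) := by ring
      omega

/-! ## Row reduction -/

/-- The pairing of two `n × n'` matrices. -/
def dot (n n' : ℕ) (x g : ℕ → ℕ → F) : F :=
  ∑ j ∈ Finset.range n, ∑ k ∈ Finset.range n', x j k * g j k

theorem dot_congr {n n' : ℕ} {x x' g g' : ℕ → ℕ → F}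
    (hx : ∀ j < n, ∀ k < n', x j k = x' j k) (hg : ∀ j < n, ∀ k < n', g j k = g' j k) :
    dot n n' x g = dot n n' x' g' := by
  refine Finset.sum_congr rfl fun j hj => Finset.sum_congr rfl fun k hk => ?_
  rw [Finset.mem_range] at hj hk
  rw [hx j hj k hk, hg j hj k hk]

theorem dot_sub_smul (n n' : ℕ) (x y g : ℕ → ℕ → F) (c : F) :
    dot n n' (fun j k => x j k - c * y j k) g = dot n n' x g - c * dot n n' y g := by
  simp only [dot, Finset.mul_sum, ← Finset.sum_sub_distrib]
  exact Finset.sum_congr rfl fun j _ => Finset.sum_congr rfl fun k _ => by ring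

theorem dot_sub_sum (n n' : ℕ) {ι : Type*} (s : Finset ι) (x g : ℕ → ℕ → F) (c : ι → F)
    (B : ι → ℕ → ℕ → F) :
    dot n n' (fun j k => x j k - ∑ a ∈ s, c a * B a j k) g =
      dot n n' x g - ∑ a ∈ s, c a * dot n n' (B a) g := by
  classical
  induction s using Finset.induction_on with
  | empty => simp
  | insert a s ha ih =>
    have h1 : dot n n' (fun j k => x j k - ∑ b ∈ insert a s, c b * B b j k) g =
        dot n n' (fun j k => (x j k - ∑ b ∈ s, c b * B b j k) - c a * B a j k) g := by
      refine dot_congr (fun j _ k _ => ?_) fun _ _ _ _ => rfl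
      rw [Finset.sum_insert ha]; ring
    rw [h1, dot_sub_smul, ih, Finset.sum_insert ha]
    ring

theorem dot_zero_left {n n' : ℕ} {x g : ℕ → ℕ → F} (hx : ∀ j < n, ∀ k < n', x j k = 0) :
    dot n n' x g = 0 :=
  Finset.sum_eq_zero fun j hj => Finset.sum_eq_zero fun k hk => by
    rw [hx j (Finset.mem_range.1 hj) k (Finset.mem_range.1 hk), zero_mul]

theorem dot_comm (n n' : ℕ) (x g : ℕ → ℕ → F) : dot n n' x g = dot n n' g x :=
  Finset.sum_congr rfl fun _ _ => Finset.sum_congr rfl fun _ _ => mul_comm _ _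

/-- The rows `B a`, `a < r`, of size `n × n'`, are reduced with pivots `(pj a, pk a)`, and `Kr` is
the common kernel of the rows that have been inserted so far, at most `cnt` in number. -/
structure Red (n n' rm : ℕ) (B : ℕ → ℕ → ℕ → F) (pj pk : ℕ → ℕ) (r : ℕ)
    (Kr : (ℕ → ℕ → F) → Prop) (cnt : ℕ) : Prop where
  hj : ∀ a < r, pj a < n
  hk : ∀ a < r, pk a < n'
  unit : ∀ a < r, ∀ b < r, B a (pj b) (pk b) = if a = b then 1 else 0
  -- The rows not yet in use vanish, so sums may run to the fixed bound `rm` instead of the changing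
  -- number `r`.
  zero : ∀ a, r ≤ a → a < rm → ∀ j < n, ∀ k < n', B a j k = 0
  ker : ∀ g, Kr g ↔ ∀ a < r, dot n n' (B a) g = 0
  -- A vector that annihilates the kernel and whose last nonzero row contains the pivot. Later
  -- insertions may spoil this shape for `B a` itself, but they only shrink the kernel, so the
  -- witness `y` survives.
  last : ∀ a < r, ∃ y : ℕ → ℕ → F, y (pj a) (pk a) ≠ 0 ∧
    (∀ j < n, ∀ k < n', y j k ≠ 0 → j ≤ pj a) ∧ ∀ g, Kr g → dot n n' y g = 0
  le : r ≤ cnt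

namespace Red

variable {n n' rm r cnt : ℕ} {B : ℕ → ℕ → ℕ → F} {pj pk : ℕ → ℕ} {Kr : (ℕ → ℕ → F) → Prop}

theorem congr_ker (h : Red n n' rm B pj pk r Kr cnt) {Kr' : (ℕ → ℕ → F) → Prop} {cnt' : ℕ}
    (hK : ∀ g, Kr g ↔ Kr' g) (hc : cnt = cnt') : Red n n' rm B pj pk r Kr' cnt' := by
  have : Kr = Kr' := funext fun g => propext (hK g)
  rwa [← this, ← hc]

theorem empty (n n' rm : ℕ) {B : ℕ → ℕ → ℕ → F} (pj pk : ℕ → ℕ)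
    (hB : ∀ a < rm, ∀ j < n, ∀ k < n', B a j k = 0) :
    Red n n' rm B pj pk 0 (fun _ => True) 0 where
  hj a ha := absurd ha (Nat.not_lt_zero a)
  hk a ha := absurd ha (Nat.not_lt_zero a)
  unit a ha := absurd ha (Nat.not_lt_zero a)
  zero a _ ha := hB a ha
  ker _ := ⟨fun _ a ha => absurd ha (Nat.not_lt_zero a), fun _ => trivial⟩
  last a ha := absurd ha (Nat.not_lt_zero a)
  le := le_rfl

theorem dot_reduce (h : Red n n' rm B pj pk r Kr cnt) {x y : ℕ → ℕ → F}
    (hy : ∀ j < n, ∀ k < n', y j k = x j k - ∑ a ∈ Finset.range rm, x (pj a) (pk a) * B a j k)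
    {g : ℕ → ℕ → F} (hg : Kr g) : dot n n' y g = dot n n' x g := by
  rw [dot_congr hy fun _ _ _ _ => rfl, dot_sub_sum, Finset.sum_eq_zero, sub_zero]
  intro a ha
  by_cases har : a < r
  · rw [(h.ker g).1 hg a har, mul_zero]
  · rw [dot_zero_left (h.zero a (not_lt.1 har) (Finset.mem_range.1 ha)), mul_zero]

theorem reduce_pivot (h : Red n n' rm B pj pk r Kr cnt) (hrm : r ≤ rm) {x y : ℕ → ℕ → F}
    (hy : ∀ j < n, ∀ k < n', y j k = x j k - ∑ a ∈ Finset.range rm, x (pj a) (pk a) * B a j k)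
    {b : ℕ} (hb : b < r) : y (pj b) (pk b) = 0 := by
  rw [hy _ (h.hj b hb) _ (h.hk b hb), Finset.sum_eq_single b]
  · rw [h.unit b hb b hb, if_pos rfl, mul_one, sub_self]
  · intro a ha hab
    by_cases har : a < r
    · rw [h.unit a har b hb, if_neg hab, mul_zero]
    · rw [h.zero a (not_lt.1 har) (Finset.mem_range.1 ha) _ (h.hj b hb) _ (h.hk b hb), mul_zero]
  · intro hb'
    exact absurd (Finset.mem_range.2 (by omega)) hb'

/-- A row in the span of the others changes nothing. -/
theorem insert_zero (h : Red n n' rm B pj pk r Kr cnt) {x y : ℕ → ℕ → F}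
    (hy : ∀ j < n, ∀ k < n', y j k = x j k - ∑ a ∈ Finset.range rm, x (pj a) (pk a) * B a j k)
    (h0 : ∀ j < n, ∀ k < n', y j k = 0) (hrm : r ≤ rm)
    {B' : ℕ → ℕ → ℕ → F} {pj' pk' : ℕ → ℕ}
    (hB : ∀ a < rm, ∀ j < n, ∀ k < n', B' a j k = B a j k) (hj : ∀ a < r, pj' a = pj a)
    (hk : ∀ a < r, pk' a = pk a) :
    Red n n' rm B' pj' pk' r (fun g => Kr g ∧ dot n n' x g = 0) (cnt + 1) where
  hj a ha := by rw [hj a ha]; exact h.hj a ha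
  hk a ha := by rw [hk a ha]; exact h.hk a ha
  unit a ha b hb := by
    rw [hj b hb, hk b hb, hB a (by omega) _ (h.hj b hb) _ (h.hk b hb), h.unit a ha b hb]
  zero a ha ha' j hj k hk := by rw [hB a ha' j hj k hk, h.zero a ha ha' j hj k hk]
  ker g := by
    have e : (∀ a < r, dot n n' (B' a) g = 0) ↔ ∀ a < r, dot n n' (B a) g = 0 :=
      forall_congr' fun a => forall_congr' fun ha => by
        rw [dot_congr (hB a (by omega)) fun _ _ _ _ => rfl]
    rw [e, ← h.ker g]
    exact ⟨fun hg => hg.1, fun hg => ⟨hg, by rw [← h.dot_reduce hy hg, dot_zero_left h0]⟩⟩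
  last a ha := by
    obtain ⟨z, h1, h2, h3⟩ := h.last a ha
    rw [hj a ha, hk a ha]
    exact ⟨z, h1, h2, fun g hg => h3 g hg.1⟩
  le := h.le.trans (Nat.le_succ _)

/-- One formula covers three cases: for `a < r` it clears the new pivot position, for `a = r`, a
zero row, it yields `y` divided by its pivot entry, and for `a > r` it yields zero. The old pivot
positions are unaffected because `y` vanishes there. -/
theorem insert_pivot (h : Red n n' rm B pj pk r Kr cnt) {x y : ℕ → ℕ → F}
    (hy : ∀ j < n, ∀ k < n', y j k = x j k - ∑ a ∈ Finset.range rm, x (pj a) (pk a) * B a j k)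
    (hrm : r < rm) {q q' : ℕ} (hq : q < n) (hq' : q' < n') (h0 : y q q' ≠ 0)
    (hlast : ∀ j < n, ∀ k < n', y j k ≠ 0 → j ≤ q)
    {B' : ℕ → ℕ → ℕ → F} {pj' pk' : ℕ → ℕ}
    (hB : ∀ a < rm, ∀ j < n, ∀ k < n',
      B' a j k = B a j k - (B a q q' - if a = r then 1 else 0) / y q q' * y j k)
    (hj : ∀ a < r, pj' a = pj a) (hk : ∀ a < r, pk' a = pk a) (hjr : pj' r = q)
    (hkr : pk' r = q') :
    Red n n' rm B' pj' pk' (r + 1) (fun g => Kr g ∧ dot n n' x g = 0) (cnt + 1) where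
  hj a ha := by
    rcases Nat.lt_succ_iff_lt_or_eq.1 ha with ha | rfl
    · rw [hj a ha]; exact h.hj a ha
    · rwa [hjr]
  hk a ha := by
    rcases Nat.lt_succ_iff_lt_or_eq.1 ha with ha | rfl
    · rw [hk a ha]; exact h.hk a ha
    · rwa [hkr]
  unit a ha b hb := by
    rcases Nat.lt_succ_iff_lt_or_eq.1 hb with hb | rfl
    · rw [hj b hb, hk b hb, hB a (by omega) _ (h.hj b hb) _ (h.hk b hb),
        h.reduce_pivot hrm.le hy hb, mul_zero, sub_zero]
      rcases Nat.lt_succ_iff_lt_or_eq.1 ha with ha | rfl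
      · exact h.unit a ha b hb
      · rw [h.zero a le_rfl hrm _ (h.hj b hb) _ (h.hk b hb), if_neg (by omega)]
    · rw [hjr, hkr, hB a (by omega) q hq q' hq', div_mul_cancel₀ _ h0, sub_sub_cancel]
  zero a ha ha' j hj k hk := by
    rw [hB a ha' j hj k hk, h.zero a (by omega) ha' j hj k hk, h.zero a (by omega) ha' q hq q' hq',
      if_neg (by omega)]
    simp
  ker g := by
    have e : ∀ a < rm, dot n n' (B' a) g = dot n n' (B a) g -
        (B a q q' - if a = r then 1 else 0) / y q q' * dot n n' y g := fun a ha => by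
      rw [dot_congr (hB a ha) fun _ _ _ _ => rfl, dot_sub_smul]
    have er : dot n n' (B' r) g = dot n n' y g / y q q' := by
      rw [e r hrm, dot_zero_left (h.zero r le_rfl hrm), h.zero r le_rfl hrm q hq q' hq',
        if_pos rfl]
      ring
    constructor
    · rintro ⟨hg, hx⟩ a ha
      rw [e a (by omega), h.dot_reduce hy hg, hx, mul_zero, sub_zero]
      rcases Nat.lt_succ_iff_lt_or_eq.1 ha with ha | rfl
      · exact (h.ker g).1 hg a ha
      · exact dot_zero_left (h.zero a le_rfl hrm)
    · intro hg
      have hy0 : dot n n' y g = 0 := by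
        have := hg r (Nat.lt_succ_self r)
        rw [er, div_eq_zero_iff] at this
        exact this.resolve_right h0
      have hK : Kr g := (h.ker g).2 fun a ha => by
        have := hg a (by omega)
        rwa [e a (by omega), hy0, mul_zero, sub_zero] at this
      exact ⟨hK, by rw [← h.dot_reduce hy hK, hy0]⟩
  last a ha := by
    rcases Nat.lt_succ_iff_lt_or_eq.1 ha with ha | rfl
    · obtain ⟨z, h1, h2, h3⟩ := h.last a ha
      rw [hj a ha, hk a ha]
      exact ⟨z, h1, h2, fun g hg => h3 g hg.1⟩
    · rw [hjr, hkr]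
      exact ⟨y, h0, hlast, fun g hg => by rw [h.dot_reduce hy hg.1, hg.2]⟩
  le := Nat.succ_le_succ h.le

end Red

/-! ## Frame rules -/

namespace Cmd

/-- The command does not write to the variable `x`. -/
def keepsVar (x : ℕ) : Cmd → Bool
  | nset y _ => decide (y ≠ x)
  | seq c c' => c.keepsVar x && c'.keepsVar x
  | ifLt _ _ c c' => c.keepsVar x && c'.keepsVar x
  | ifZero _ c c' => c.keepsVar x && c'.keepsVar x
  | loop y _ c => decide (y ≠ x) && c.keepsVar x
  | _ => true

/-- The command does not write to the array `a` of integers. -/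
def keepsNat (a : ℕ) : Cmd → Bool
  | nstore b _ _ => decide (b ≠ a)
  | seq c c' => c.keepsNat a && c'.keepsNat a
  | ifLt _ _ c c' => c.keepsNat a && c'.keepsNat a
  | ifZero _ c c' => c.keepsNat a && c'.keepsNat a
  | loop _ _ c => c.keepsNat a
  | _ => true

/-- The command does not write to the array `a` of field elements. -/
def keepsFld (a : ℕ) : Cmd → Bool
  | map _ b _ _ _ _ => decide (b ≠ a)
  | diag _ _ P D => decide (P ≠ a) && decide (D ≠ a)
  | seq c c' => c.keepsFld a && c'.keepsFld a
  | ifLt _ _ c c' => c.keepsFld a && c'.keepsFld a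
  | ifZero _ c c' => c.keepsFld a && c'.keepsFld a
  | loop _ _ c => c.keepsFld a
  | _ => true

theorem var_den (O : DiagOracle F) {x : ℕ} (c : Cmd) (hc : c.keepsVar x = true) (s : State F) :
    (c.den O s).var x = s.var x := by
  induction c generalizing s with
  | nset y e =>
    have : x ≠ y := Ne.symm (by simpa [keepsVar] using hc)
    simp [den, State.setVar, this]
  | seq c c' ih ih' =>
    simp only [keepsVar, Bool.and_eq_true] at hc
    exact (ih' hc.2 _).trans (ih hc.1 s)
  | ifLt _ _ c c' ih ih' =>
    simp only [keepsVar, Bool.and_eq_true] at hc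
    simp only [den]
    split_ifs
    · exact ih hc.1 s
    · exact ih' hc.2 s
  | ifZero _ c c' ih ih' =>
    simp only [keepsVar, Bool.and_eq_true] at hc
    simp only [den]
    split_ifs
    · exact ih hc.1 s
    · exact ih' hc.2 s
  | loop y _ c ih =>
    simp only [keepsVar, Bool.and_eq_true, decide_eq_true_eq] at hc
    simp only [den]
    refine iterate_induction (fun _ (s' : State F) => s'.var x = s.var x) _ rfl fun m _ s' hs => ?_
    rw [ih hc.2]
    simpa [State.setVar, hc.1.symm] using hs
  | _ => rfl

theorem nat_den (O : DiagOracle F) {a : ℕ} (c : Cmd) (hc : c.keepsNat a = true) (s : State F) :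
    (c.den O s).nat a = s.nat a := by
  induction c generalizing s with
  | nstore b e e' =>
    have : a ≠ b := Ne.symm (by simpa [keepsNat] using hc)
    funext i j k
    simp [den, State.setNat₁, this]
  | seq c c' ih ih' =>
    simp only [keepsNat, Bool.and_eq_true] at hc
    exact (ih' hc.2 _).trans (ih hc.1 s)
  | ifLt _ _ c c' ih ih' =>
    simp only [keepsNat, Bool.and_eq_true] at hc
    simp only [den]
    split_ifs
    · exact ih hc.1 s
    · exact ih' hc.2 s
  | ifZero _ c c' ih ih' =>
    simp only [keepsNat, Bool.and_eq_true] at hc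
    simp only [den]
    split_ifs
    · exact ih hc.1 s
    · exact ih' hc.2 s
  | loop y _ c ih =>
    simp only [den]
    exact iterate_induction (fun _ (s' : State F) => s'.nat a = s.nat a) _ rfl
      fun m _ s' hs => (ih hc _).trans hs
  | _ => rfl

theorem fld_den (O : DiagOracle F) {a : ℕ} (c : Cmd) (hc : c.keepsFld a = true) (s : State F) :
    (c.den O s).fld a = s.fld a := by
  induction c generalizing s with
  | map acc b _ _ _ _ =>
    have : a ≠ b := Ne.symm (by simpa [keepsFld] using hc)
    funext i j k
    simp [den, State.fill, this]
  | diag _ _ P D =>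
    simp only [keepsFld, Bool.and_eq_true, decide_eq_true_eq] at hc
    funext i j k
    simp [den, State.callOracle, State.writeVector, State.writeMatrix, hc.1.symm, hc.2.symm]
  | seq c c' ih ih' =>
    simp only [keepsFld, Bool.and_eq_true] at hc
    exact (ih' hc.2 _).trans (ih hc.1 s)
  | ifLt _ _ c c' ih ih' =>
    simp only [keepsFld, Bool.and_eq_true] at hc
    simp only [den]
    split_ifs
    · exact ih hc.1 s
    · exact ih' hc.2 s
  | ifZero _ c c' ih ih' =>
    simp only [keepsFld, Bool.and_eq_true] at hc
    simp only [den]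
    split_ifs
    · exact ih hc.1 s
    · exact ih' hc.2 s
  | loop y _ c ih =>
    simp only [den]
    exact iterate_induction (fun _ (s' : State F) => s'.fld a = s.fld a) _ rfl
      fun m _ s' hs => (ih hc _).trans hs
  | _ => rfl

/-! ## Subroutines -/

/-- `z := x * y` -/
def mul (z x y : ℕ) : Cmd :=
  seq (nset z (.const 0)) (loop 42 x (nset z (.add (.var z) (.var y))))

theorem mul_spec (O : DiagOracle F) {z x y : ℕ} (hx : x ≠ z) (hy : y ≠ z) (hy' : y ≠ 42)
    (hz : z ≠ 42) (s : State F) : ((mul z x y).den O s).var z = s.var x * s.var y := by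
  simp only [mul, den]
  have e1 : (s.setVar z ((NExpr.const 0).eval s)).var x = s.var x := by
    simp [State.setVar, hx]
  rw [e1]
  refine (iterate_induction (fun m (s' : State F) => s'.var z = m * s.var y ∧ s'.var y = s.var y)
    (s.var x) ?_ ?_).1
  · simp [State.setVar, NExpr.eval, hy]
  · rintro m _ s' ⟨h1, h2⟩
    refine ⟨?_, ?_⟩
    · simp [State.setVar, NExpr.eval, h1, h2, hy', hz]
      ring
    · simp [State.setVar, h2, hy, hy']

/-- Search a block of the array `a` for the last nonzero entry: the variable `11` tells whether
there is one, and the variables `12`, `13`, `14` hold its position. -/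
def find (a y₁ y₂ y₃ : ℕ) : Cmd :=
  seq (nset 11 (.const 0)) (loop 25 y₁ (loop 26 y₂ (loop 27 y₃
    (ifZero (.cell a (.var 25) (.var 26) (.var 27)) skip
      (seq (nset 11 (.const 1)) (seq (nset 12 (.var 25))
        (seq (nset 13 (.var 26)) (nset 14 (.var 27)))))))))

/-- The outcome of a search among the entries that satisfy `D`. -/
def Found (D : ℕ → ℕ → ℕ → Prop) (f : ℕ → ℕ → ℕ → F) (s : State F) : Prop :=
  (s.var 11 = 0 ∧ ∀ i j k, D i j k → f i j k = 0) ∨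
  (s.var 11 = 1 ∧ D (s.var 12) (s.var 13) (s.var 14) ∧
    f (s.var 12) (s.var 13) (s.var 14) ≠ 0 ∧
    ∀ i j k, D i j k → f i j k ≠ 0 → i < s.var 12 ∨ (i = s.var 12 ∧ j ≤ s.var 13))

theorem Found.congr {D D' : ℕ → ℕ → ℕ → Prop} {f : ℕ → ℕ → ℕ → F} {s : State F}
    (h : Found D f s) (hD : ∀ i j k, D i j k ↔ D' i j k) : Found D' f s := by
  have : D = D' := by funext i j k; exact propext (hD i j k)
  rwa [← this]

/-- The scan is lexicographic and every hit overwrites the previous one, so the last hit remains.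
Its being last is recorded for the first two indices only, which suffices for `Red.last`. -/
theorem find_spec (O : DiagOracle F) {a y₁ y₂ y₃ : ℕ} (h₁ : y₁ < 11) (h₂ : y₂ < 11)
    (h₃ : y₃ < 11) (s : State F) :
    Found (fun i j k => i < s.var y₁ ∧ j < s.var y₂ ∧ k < s.var y₃) (s.fld a)
      ((find a y₁ y₂ y₃).den O s) := by
  set cbody : Cmd := ifZero (.cell a (.var 25) (.var 26) (.var 27)) skip
      (seq (nset 11 (.const 1)) (seq (nset 12 (.var 25))
        (seq (nset 13 (.var 26)) (nset 14 (.var 27))))) with hcb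
  -- one test
  have test : ∀ (D : ℕ → ℕ → ℕ → Prop) (t : State F), Found D (s.fld a) t → t.fld a = s.fld a →
      (∀ i j k, D i j k → i < t.var 25 ∨ (i = t.var 25 ∧ j ≤ t.var 26)) →
      Found (fun i j k => D i j k ∨ (i = t.var 25 ∧ j = t.var 26 ∧ k = t.var 27)) (s.fld a)
        (cbody.den O t) := by
    intro D t ht hf hD
    have ev : (FExpr.cell a (.var 25) (.var 26) (.var 27)).eval 0 t =
        s.fld a (t.var 25) (t.var 26) (t.var 27) := by simp [FExpr.eval, NExpr.eval, hf]
    simp only [hcb, den]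
    by_cases h0 : s.fld a (t.var 25) (t.var 26) (t.var 27) = 0
    · rw [if_pos (ev.trans h0)]
      rcases ht with ⟨t1, t2⟩ | ⟨t1, t2, t3, t4⟩
      · refine Or.inl ⟨t1, ?_⟩
        rintro i j k (h | ⟨rfl, rfl, rfl⟩)
        · exact t2 i j k h
        · exact h0
      · refine Or.inr ⟨t1, Or.inl t2, t3, ?_⟩
        rintro i j k (h | ⟨rfl, rfl, rfl⟩) h'
        · exact t4 i j k h h'
        · exact absurd h0 h'
    · rw [if_neg fun h => h0 (ev.symm.trans h)]
      refine Or.inr ?_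
      simp only [State.setVar, NExpr.eval]
      norm_num
      refine ⟨h0, ?_⟩
      rintro i j k (h | ⟨rfl, rfl, rfl⟩) _
      · exact hD i j k h
      · exact Or.inr ⟨rfl, le_rfl⟩
  have k1 : ∀ {y : ℕ}, y < 11 → cbody.keepsVar y = true := by
    intro y hy
    simp [hcb, keepsVar]
    omega
  have k2 : cbody.keepsFld a = true := rfl
  have setF : ∀ {D : ℕ → ℕ → ℕ → Prop} {t : State F} (x m : ℕ), (x = 25 ∨ x = 26 ∨ x = 27) →
      Found D (s.fld a) t → Found D (s.fld a) (t.setVar x m) := by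
    rintro D t x m hx ht
    have e : ∀ y, y < 15 → (t.setVar x m).var y = t.var y := by
      intro y hy
      have : y ≠ x := by omega
      simp [State.setVar, this]
    simpa only [Found, e 11 (by norm_num), e 12 (by norm_num), e 13 (by norm_num),
      e 14 (by norm_num)] using ht
  have inv : ∀ {t : State F} (x m y : ℕ), x ≠ y → (t.setVar x m).var y = t.var y := by
    intro t x m y hy
    simp [State.setVar, hy.symm]
  set s0 := s.setVar 11 0 with hs0
  have e0 : ∀ {y}, y < 11 → s0.var y = s.var y := fun {y} hy => inv 11 0 y (by omega)
  have main : Found (fun i j k => i < s.var y₁ ∧ j < s.var y₂ ∧ k < s.var y₃) (s.fld a)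
      ((loop 25 y₁ (loop 26 y₂ (loop 27 y₃ cbody))).den O s0) := by
    simp only [den]
    rw [e0 h₁]
    refine (iterate_induction (fun m (t : State F) => Found
      (fun i j k => i < m ∧ j < s.var y₂ ∧ k < s.var y₃) (s.fld a) t ∧ t.fld a = s.fld a ∧
      t.var y₂ = s.var y₂ ∧ t.var y₃ = s.var y₃) (s.var y₁) ?_ ?_).1
    · refine ⟨Or.inl ⟨by simp [hs0, State.setVar], fun i j k h => absurd h.1 (Nat.not_lt_zero i)⟩,
        rfl, e0 h₂, e0 h₃⟩
    rintro i hi t ⟨t1, t2, t3, t4⟩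
    set t' := t.setVar 25 i with ht'
    rw [inv 25 i y₂ (by omega), t3]
    have := iterate_induction (f := fun m s' => iterate (fun m s' => cbody.den O (s'.setVar 27 m))
      ((s'.setVar 26 m).var y₃) (s'.setVar 26 m)) (fun m (t : State F) => Found
      (fun i' j k => (i' < i ∧ j < s.var y₂ ∧ k < s.var y₃) ∨ (i' = i ∧ j < m ∧ k < s.var y₃))
        (s.fld a) t ∧ t.fld a = s.fld a ∧
      t.var y₂ = s.var y₂ ∧ t.var y₃ = s.var y₃ ∧ t.var 25 = i) (s.var y₂) (s := t') ?_ ?_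
    · exact ⟨this.1.congr fun i' j k => by omega, this.2.1, this.2.2.1, this.2.2.2.1⟩
    · exact ⟨(setF 25 i (Or.inl rfl) t1).congr fun i' j k => by omega, t2,
        (inv 25 i y₂ (by omega)).trans t3, (inv 25 i y₃ (by omega)).trans t4,
        by simp [ht', State.setVar]⟩
    rintro j hj t ⟨t1, t2, t3, t4, t5⟩
    rw [inv 26 j y₃ (by omega), t4]
    have := iterate_induction (f := fun m s' => cbody.den O (s'.setVar 27 m))
      (fun m (t : State F) => Found
      (fun i' j' k => ((i' < i ∧ j' < s.var y₂ ∧ k < s.var y₃) ∨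
        (i' = i ∧ j' < j ∧ k < s.var y₃)) ∨ (i' = i ∧ j' = j ∧ k < m))
        (s.fld a) t ∧ t.fld a = s.fld a ∧
      t.var y₂ = s.var y₂ ∧ t.var y₃ = s.var y₃ ∧ t.var 25 = i ∧ t.var 26 = j) (s.var y₃)
      (s := t.setVar 26 j) ?_ ?_
    · exact ⟨this.1.congr fun i' j' k => by omega, this.2.1, this.2.2.1, this.2.2.2.1,
        this.2.2.2.2.1⟩
    · exact ⟨(setF 26 j (by norm_num) t1).congr fun i' j' k => by omega, t2,
        (inv 26 j y₂ (by omega)).trans t3, (inv 26 j y₃ (by omega)).trans t4,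
        (inv 26 j 25 (by omega)).trans t5, by simp [State.setVar]⟩
    rintro k hk t ⟨t1, t2, t3, t4, t5, t6⟩
    have v25 : (t.setVar 27 k).var 25 = i := (inv 27 k 25 (by omega)).trans t5
    have v26 : (t.setVar 27 k).var 26 = j := (inv 27 k 26 (by omega)).trans t6
    have v27 : (t.setVar 27 k).var 27 = k := by simp [State.setVar]
    have := test _ (t.setVar 27 k) (setF 27 k (by norm_num) t1) t2 (by
      rw [v25, v26]
      intro i' j' k' h
      omega)
    rw [v25, v26, v27] at this
    refine ⟨this.congr fun i' j' k' => by omega, ?_, ?_, ?_, ?_, ?_⟩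
    · rw [fld_den O _ k2]; exact t2
    · rw [var_den O _ (k1 h₂), inv 27 k y₂ (by omega), t3]
    · rw [var_den O _ (k1 h₃), inv 27 k y₃ (by omega), t4]
    · rw [var_den O _ (by rfl), v25]
    · rw [var_den O _ (by rfl), v26]
  exact main

end Cmd

/-! ### Gaussian elimination as a command. -/

/-- The rows in the array `σ`, with pivots in the integer arrays `σ` and `σ + 10` and their number
in the variable `σ`, are reduced. -/
def RedS (σ n n' rm : ℕ) (h : State F) (Kr : (ℕ → ℕ → F) → Prop) (cnt : ℕ) : Prop :=
  Red n n' rm (h.fld σ) (fun a => h.nat σ a a a) (fun a => h.nat (σ + 10) a a a) (h.var σ) Kr cnt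

theorem RedS.congr_state {σ n n' rm cnt : ℕ} {h h' : State F} {Kr : (ℕ → ℕ → F) → Prop}
    (hR : RedS σ n n' rm h Kr cnt) (h1 : h'.fld σ = h.fld σ) (h2 : h'.nat σ = h.nat σ)
    (h3 : h'.nat (σ + 10) = h.nat (σ + 10)) (h4 : h'.var σ = h.var σ) :
    RedS σ n n' rm h' Kr cnt := by
  unfold RedS
  rw [h1, h2, h3, h4]
  exact hR

namespace Cmd

/-- The part of `insert` that computes. -/
def insertRow (σ rm n n' : ℕ) : Cmd :=
  -- The multipliers are saved in array `6` first, because the update of `σ` must not read `σ` in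
  -- its expression.
  seq (map false 6 rm 3 3 (.op .div (.op .sub (.cell σ (.var (lv 0)) (.var 13) (.var 14))
    (.eq (.var (lv 0)) (.var σ))) (.cell 5 (.const 0) (.var 13) (.var 14))))
  (seq (map true σ rm n n' (.op .sub (.const 0) (.op .mul
    (.cell 6 (.var (lv 0)) (.const 0) (.const 0)) (.cell 5 (.const 0) (.var (lv 1)) (.var (lv 2))))))
  (seq (nstore σ (.var σ) (.var 13)) (seq (nstore (σ + 10) (.var σ) (.var 14))
    (nset σ (.add (.var σ) (.var 11))))))

/-- Subtract from the row in array `4` its combination of the reduced rows. -/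
def reduceRow (σ rm n n' : ℕ) : Cmd :=
  map false 5 3 n n' (.op .sub (.cell 4 (.var (lv 0)) (.var (lv 1)) (.var (lv 2)))
    (.sum rm (.op .mul
      (.cell 4 (.var (lv 0)) (.load σ (.var (lv 3))) (.load (σ + 10) (.var (lv 3))))
      (.cell σ (.var (lv 3)) (.var (lv 1)) (.var (lv 2))))))

/-- Insert the row in array `4` into the reduced rows `σ`. The sizes are held by the variables `n`
and `n'`, and `rm` holds a bound for the number of rows. -/
def insert (σ rm n n' : ℕ) : Cmd :=
  seq (reduceRow σ rm n n') (seq (find 5 3 n n') (insertRow σ rm n n'))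

theorem insert_keepsFld {σ rm n n' x : ℕ} (h1 : x ≠ σ) (h2 : x ≠ 5) (h3 : x ≠ 6) :
    (insert σ rm n n').keepsFld x = true := by
  simp [insert, reduceRow, insertRow, find, keepsFld]
  omega

theorem fill_of_ne {acc : Bool} {a b m₁ m₂ m₃ : ℕ} {f : ℕ → ℕ → ℕ → F} {s : State F} (h : b ≠ a) :
    (s.fill acc a m₁ m₂ m₃ f).fld b = s.fld b := by
  funext i j k
  simp [State.fill, h]

theorem fill_set {a m₁ m₂ m₃ : ℕ} {f : ℕ → ℕ → ℕ → F} {s : State F} {i j k : ℕ}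
    (hi : i < m₁) (hj : j < m₂) (hk : k < m₃) :
    (s.fill false a m₁ m₂ m₃ f).fld a i j k = f i j k := by
  simp [State.fill, hi, hj, hk]

theorem fill_add {a m₁ m₂ m₃ : ℕ} {f : ℕ → ℕ → ℕ → F} {s : State F} {i j k : ℕ}
    (hi : i < m₁) (hj : j < m₂) (hk : k < m₃) :
    (s.fill true a m₁ m₂ m₃ f).fld a i j k = s.fld a i j k + f i j k := by
  simp [State.fill, hi, hj, hk]

theorem insertRow_spec (O : DiagOracle F) {σ rm n n' : ℕ} (hσ : 30 ≤ σ) (hσ' : σ < 40) {s : State F} (h3 : s.var 3 = 1) :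
    (∀ a < s.var rm, ∀ j < s.var n, ∀ k < s.var n',
      ((insertRow σ rm n n').den O s).fld σ a j k = s.fld σ a j k -
        (s.fld σ a (s.var 13) (s.var 14) - if a = s.var σ then 1 else 0) /
          s.fld 5 0 (s.var 13) (s.var 14) * s.fld 5 0 j k) ∧
    (∀ a, ((insertRow σ rm n n').den O s).nat σ a a a =
      if a = s.var σ then s.var 13 else s.nat σ a a a) ∧
    (∀ a, ((insertRow σ rm n n').den O s).nat (σ + 10) a a a =
      if a = s.var σ then s.var 14 else s.nat (σ + 10) a a a) ∧
    ((insertRow σ rm n n').den O s).var σ = s.var σ + s.var 11 := by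
  have e13 : 13 ≠ σ := by omega
  have e14 : 14 ≠ σ := by omega
  refine ⟨fun a ha j hj k hk => ?_, fun a => ?_, fun a => ?_, ?_⟩
  · have h5 : (5 : ℕ) ≠ 6 := by norm_num
    have h5σ : σ ≠ 6 := by omega
    have l0 : lv 0 ≠ lv 1 ∧ lv 0 ≠ lv 2 ∧ lv 1 ≠ lv 2 := by simp [lv]
    have l1 : ∀ ℓ, 13 ≠ lv ℓ ∧ 14 ≠ lv ℓ ∧ σ ≠ lv ℓ := by intro ℓ; simp only [lv]; omega
    simp only [insertRow, den]
    set s1 := s.fill false 6 (s.var rm) (s.var 3) (s.var 3) _ with hs1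
    have v1 : s1.var = s.var := rfl
    have key : s1.fld 6 a 0 0 = (s.fld σ a (s.var 13) (s.var 14) - if a = s.var σ then 1 else 0) /
          s.fld 5 0 (s.var 13) (s.var 14) := by
      rw [hs1, fill_set ha (by omega) (by omega)]
      simp [FExpr.eval, NExpr.eval, State.bind₃, State.setVar, FieldOp.apply, l1,
        show σ ≠ 100 by omega]
    have k5 : s1.fld 5 = s.fld 5 := fill_of_ne (by norm_num)
    have kσ : s1.fld σ = s.fld σ := fill_of_ne h5σ
    simp only [State.setNat₁, State.setVar]
    rw [fill_add (by rw [v1]; exact ha) (by rw [v1]; exact hj) (by rw [v1]; exact hk), kσ]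
    simp only [FExpr.eval, NExpr.eval, State.bind₃, State.setVar, FieldOp.apply, l0, if_true,
      if_false, key, k5, Nat.cast_zero, zero_sub]
    ring
  · simp [insertRow, den, State.setNat₁, State.setVar, NExpr.eval, State.fill]
  · simp [insertRow, den, State.setNat₁, State.setVar, NExpr.eval, State.fill]
  · simp [insertRow, den, State.setNat₁, State.setVar, NExpr.eval, State.fill]

theorem insert_spec (O : DiagOracle F) {σ rm n n' : ℕ} (hσ : 30 ≤ σ) (hσ' : σ < 40)
    (hrm : rm < 11) (hn : n < 11) (hn' : n' < 11) {h : State F} {Kr : (ℕ → ℕ → F) → Prop}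
    {cnt : ℕ} (hR : RedS σ (h.var n) (h.var n') (h.var rm) h Kr cnt) (hc : cnt < h.var rm)
    (h3 : h.var 3 = 1) :
    RedS σ (h.var n) (h.var n') (h.var rm) ((insert σ rm n n').den O h)
      (fun g => Kr g ∧ dot (h.var n) (h.var n') (h.fld 4 0) g = 0) (cnt + 1) := by
  simp only [insert, den]
  set s1 := (reduceRow σ rm n n').den O h with hs1
  have e5 : σ ≠ 5 := by omega
  have v1 : s1.var = h.var := rfl
  have n1 : s1.nat = h.nat := rfl
  have fσ : s1.fld σ = h.fld σ := by
    rw [hs1, reduceRow, den]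
    exact fill_of_ne e5
  have hy : ∀ j < h.var n, ∀ k < h.var n', s1.fld 5 0 j k = h.fld 4 0 j k -
      ∑ a ∈ Finset.range (h.var rm), h.fld 4 0 (h.nat σ a a a) (h.nat (σ + 10) a a a) *
        h.fld σ a j k := by
    intro j hj k hk
    rw [hs1, reduceRow, den, fill_set (by omega) hj hk]
    simp [FExpr.eval, NExpr.eval, State.bind₃, State.setVar, FieldOp.apply, lv,
      show rm ≠ 100 by omega, show rm ≠ 101 by omega, show rm ≠ 102 by omega]
  have hF := find_spec O (a := 5) (y₁ := 3) (by norm_num) hn hn' s1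
  set s2 := (find 5 3 n n').den O s1 with hs2
  have v2 : ∀ {x}, (x < 11 ∨ 14 < x) → (x < 25 ∨ 27 < x) → s2.var x = h.var x := by
    intro x h1 h2
    rw [← v1]
    refine var_den O _ ?_ s1
    simp [find, keepsVar]
    omega
  have n2 : s2.nat = h.nat := by
    funext a
    rw [← n1]
    exact nat_den O _ (by simp [find, keepsNat]) s1
  have f2 : s2.fld = s1.fld := by
    funext a
    exact fld_den O _ (by simp [find, keepsFld]) s1
  rw [v1, h3] at hF
  obtain ⟨b1, b2, b3, b4⟩ := insertRow_spec O hσ hσ' (rm := rm) (n := n) (n' := n') (s := s2)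
    (by rw [v2 (by norm_num) (by norm_num), h3])
  rw [v2 (x := rm) (by omega) (by omega), v2 (x := n) (by omega) (by omega),
    v2 (x := n') (by omega) (by omega), v2 (x := σ) (by omega) (by omega), f2, fσ] at b1
  rw [v2 (x := σ) (by omega) (by omega), n2] at b2 b3
  rw [v2 (x := σ) (by omega) (by omega)] at b4
  unfold RedS at hR ⊢
  have hle := hR.le
  rw [b4]
  rcases hF with ⟨g1, g2⟩ | ⟨g1, g2, g3, g4⟩
  -- Without a pivot no branch is needed: multiples of a zero row are subtracted, the pivot position
  -- is written beyond the `r` entries in use, and the flag `0` is added to the number of rows.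
  · rw [g1, add_zero]
    refine hR.insert_zero hy (fun j hj k hk => g2 0 j k ⟨Nat.one_pos, hj, hk⟩) (by omega) ?_ ?_ ?_
    · intro a ha j hj k hk
      rw [b1 a ha j hj k hk, g2 0 j k ⟨Nat.one_pos, hj, hk⟩, mul_zero, sub_zero]
    · intro a ha
      rw [b2, if_neg (by omega)]
    · intro a ha
      rw [b3, if_neg (by omega)]
  · have p12 : s2.var 12 = 0 := by omega
    rw [p12] at g3
    rw [g1]
    refine hR.insert_pivot hy (by omega) g2.2.1 g2.2.2 g3 ?_ b1 ?_ ?_ ?_ ?_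
    · intro j hj k hk h0
      have := g4 0 j k ⟨Nat.one_pos, hj, hk⟩ h0
      omega
    · intro a ha
      rw [b2, if_neg (by omega)]
    · intro a ha
      rw [b3, if_neg (by omega)]
    · rw [b2, if_pos rfl]
    · rw [b3, if_pos rfl]

end Cmd

/-- The command `c` keeps `inv` and inserts `k` rows with common kernel `row` into the reduced rows
`σ`. -/
def Adds (O : DiagOracle F) (σ n n' rm : ℕ) (inv : State F → Prop) (c : Cmd) (k : ℕ)
    (row : (ℕ → ℕ → F) → Prop) : Prop :=
  ∀ (h : State F) (Kr : (ℕ → ℕ → F) → Prop) (cnt : ℕ), inv h → RedS σ n n' rm h Kr cnt →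
    cnt + k ≤ rm → inv (c.den O h) ∧ RedS σ n n' rm (c.den O h) (fun g => Kr g ∧ row g) (cnt + k)

namespace Adds

variable {O : DiagOracle F} {σ n n' rm k : ℕ} {inv : State F → Prop} {c : Cmd}

theorem loop {x y Y : ℕ} {row : ℕ → (ℕ → ℕ → F) → Prop} (hx : x ≠ σ)
    (hy : ∀ h, inv h → h.var y = Y) (hset : ∀ h m, inv h → inv (h.setVar x m))
    (hc : ∀ m < Y, Adds O σ n n' rm (fun h => inv h ∧ h.var x = m) c k (row m)) :
    Adds O σ n n' rm inv (.loop x y c) (Y * k) (fun g => ∀ m < Y, row m g) := by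
  intro h Kr cnt hi hR hle
  simp only [Cmd.den]
  rw [hy h hi]
  refine iterate_induction (f := fun m s' => c.den O (s'.setVar x m)) (fun m h' => inv h' ∧
    RedS σ n n' rm h' (fun g => Kr g ∧ ∀ m' < m, row m' g) (cnt + m * k)) Y ?_ ?_
  · exact ⟨hi, hR.congr_ker (fun g => by simp) (by simp)⟩
  · rintro m hm h' ⟨h1, h2⟩
    have hle' : cnt + m * k + k ≤ rm := by
      have : (m + 1) * k ≤ Y * k := Nat.mul_le_mul_right _ hm
      rw [add_mul, one_mul] at this
      omega
    obtain ⟨a1, a2⟩ := hc m hm (h'.setVar x m) _ _ ⟨hset h' m h1, by simp [State.setVar]⟩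
      (h2.congr_state rfl rfl rfl (by simp [State.setVar, hx.symm])) hle'
    refine ⟨a1.1, a2.congr_ker (fun g => ?_) (by ring)⟩
    simp only [Nat.lt_succ_iff_lt_or_eq, or_imp, forall_and, forall_eq, and_assoc]

/-- `p` is a preparation that leaves the rows, their pivots and their number alone, and may
strengthen the invariant for the command after it. -/
theorem pre {p : Cmd} {inv' : State F → Prop} {row : (ℕ → ℕ → F) → Prop}
    (hp : ∀ h, inv h → inv' (p.den O h)) (hi : ∀ h, inv' h → inv h)
    (h1 : p.keepsFld σ = true) (h2 : p.keepsNat σ = true) (h3 : p.keepsNat (σ + 10) = true)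
    (h4 : p.keepsVar σ = true) (hc : Adds O σ n n' rm inv' c k row) :
    Adds O σ n n' rm inv (.seq p c) k row := by
  intro h Kr cnt hh hR hle
  obtain ⟨a1, a2⟩ := hc (p.den O h) Kr cnt (hp h hh) (hR.congr_state (Cmd.fld_den O p h1 h)
    (Cmd.nat_den O p h2 h) (Cmd.nat_den O p h3 h) (Cmd.var_den O p h4 h)) hle
  exact ⟨hi _ a1, a2⟩

theorem insert {vrm vn vn' : ℕ} (hσ : 30 ≤ σ) (hσ' : σ < 40)
    (hrm : vrm < 11) (hn : vn < 11) (hn' : vn' < 11) {row : (ℕ → ℕ → F) → Prop}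
    (hv : ∀ h, inv h → h.var vn = n ∧ h.var vn' = n' ∧ h.var vrm = rm ∧ h.var 3 = 1)
    (hrow : ∀ h, inv h → ∀ g, dot n n' (h.fld 4 0) g = 0 ↔ row g)
    (hi : ∀ h, inv h → inv ((Cmd.insert σ vrm vn vn').den O h)) :
    Adds O σ n n' rm inv (Cmd.insert σ vrm vn vn') 1 row := by
  intro h Kr cnt hh hR hle
  obtain ⟨rfl, rfl, rfl, h3⟩ := hv h hh
  exact ⟨hi h hh, (Cmd.insert_spec O hσ hσ' hrm hn hn' hR hle h3).congr_ker
    (fun g => by rw [hrow h hh]) rfl⟩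

end Adds

/-! ## The algorithm -/

namespace Algo

open Cmd FExpr

/-- The entry `(i, j)` of the `c`-th basis vector of the span of the slices. -/
def uE (c i j : NExpr) : FExpr := .cell 0 i j (.load 30 c)

/-- The pairing of the minors with `u_a u_b`. -/
def minorE (a b i i' j j' : NExpr) : FExpr :=
  .op .sub (.op .add (.op .mul (uE a i j) (uE b i' j')) (.op .mul (uE b i j) (uE a i' j')))
    (.op .add (.op .mul (uE a i j') (uE b i' j)) (.op .mul (uE b i j') (uE a i' j)))

/-- The sizes `one`, `n₁ n₂`, in the variables `3`, `4`. -/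
def sizes : Cmd := seq (nset 3 (.const 1)) (mul 4 0 1)

def sizesSq : Cmd := mul 5 4 4

/-- Find a basis of the span of the slices, of length `R`, among the slices. -/
def basis : Cmd :=
  loop 15 0 (loop 16 1 (seq (map false 4 3 2 3 (.cell 0 (.var 15) (.var 16) (.var (lv 1))))
    (insert 30 4 2 3)))

/-- `R`, `R ^ 2`, `R ^ 4`, the number of trials, and `n₃ + R`, in the variables `6` to `10`. -/
def rankSize : Cmd := nset 6 (.var 30)

def rankSq : Cmd := mul 7 6 6

def rankSizes : Cmd :=
  seq (mul 8 7 7) (seq (nset 9 (.add (.add (.var 8) (.var 7)) (.const 1)))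
    (nset 10 (.add (.var 2) (.var 6))))

/-- Reduce the equations for the quadratic forms on the basis that annihilate the minors. -/
def minors : Cmd :=
  loop 15 0 (loop 17 0 (loop 16 1 (loop 18 1 (seq
    (map false 4 3 6 6
      (minorE (.var (lv 1)) (.var (lv 2)) (.var 15) (.var 17) (.var 16) (.var 18)))
    (insert 31 5 6 6)))))

/-- The projection of a unit vector to the solutions. -/
def solution : Cmd :=
  map false 7 3 6 6 (.op .sub
    (.op .mul (.eq (.var 21) (.var (lv 1))) (.eq (.var 22) (.var (lv 2))))
    (.sum 5 (.op .mul (.cell 31 (.var (lv 3)) (.var 21) (.var 22))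
      (.op .mul (.eq (.var (lv 1)) (.load 31 (.var (lv 3))))
        (.eq (.var (lv 2)) (.load 41 (.var (lv 3))))))))

/-- The entry `(c, b)` of the symmetrized solution. -/
def symE (c b : NExpr) : FExpr := .op .add (.cell 7 (.const 0) c b) (.cell 7 (.const 0) b c)

/-- Reduce the equations for the matrices whose products with the symmetrized solutions are
symmetric. -/
def algebra : Cmd :=
  loop 21 6 (loop 22 6 (seq solution (loop 23 6 (loop 24 6 (seq
    (map false 4 3 6 6 (.op .sub
      (.op .mul (.eq (.var (lv 1)) (.var 23)) (symE (.var (lv 2)) (.var 24)))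
      (.op .mul (.eq (.var (lv 1)) (.var 24)) (symE (.var (lv 2)) (.var 23)))))
    (insert 32 8 6 6))))))

/-- The number of the trial as a field element. -/
def tauE : FExpr := .sum 20 (.const 1)

/-- The entry `(j, k)` is `t ^ (j + R k)` in trial `t`. The exponents of the `R²` entries are
distinct, so a nonzero linear form in the entries becomes a nonzero polynomial in `t`. -/
def trialVector : Cmd :=
  map false 8 3 6 6 (.op .mul (.prod (lv 1) tauE) (.prod (lv 2) (.prod 6 tauE)))

/-- A matrix in the algebra, the projection of the trial vector. -/
def trialMatrix : Cmd :=
  map false 9 3 6 6 (.op .sub (.cell 8 (.const 0) (.var (lv 1)) (.var (lv 2)))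
    (.sum 8 (.op .mul
      (.sum 6 (.sum 6 (.op .mul (.cell 32 (.var (lv 3)) (.var (lv 4)) (.var (lv 5)))
        (.cell 8 (.const 0) (.var (lv 4)) (.var (lv 5))))))
      (.op .mul (.eq (.var (lv 1)) (.load 32 (.var (lv 3))))
        (.eq (.var (lv 2)) (.load 42 (.var (lv 3))))))))

def krylovStart : Cmd :=
  seq (map false 33 6 6 3 (.const 0)) (seq (nset 33 (.const 0))
    (map false 13 3 6 3 (.cell 8 (.const 0) (.var (lv 1)) (.const 0))))

/-- Array `14` is a buffer: the next Krylov vector cannot be computed in place. -/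
def krylovStep : Cmd :=
  seq (seq (map false 4 3 6 3 (.cell 13 (.const 0) (.var (lv 1)) (.const 0))) (insert 33 6 6 3))
    (seq (map false 14 3 6 3 (.sum 6 (.op .mul
      (.cell 9 (.const 0) (.var (lv 1)) (.var (lv 3)))
      (.cell 13 (.const 0) (.var (lv 3)) (.const 0)))))
    (map false 13 3 6 3 (.cell 14 (.const 0) (.var (lv 1)) (.const 0))))

/-- The number of independent Krylov vectors reaches `R` only if the starting vector is cyclic, and
a diagonalizable matrix with a cyclic vector has distinct eigenvalues. Otherwise array `10` keeps
the matrix of the last successful trial. -/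
def trial : Cmd :=
  seq trialVector (seq trialMatrix (seq krylovStart (seq (loop 19 6 krylovStep)
    (ifLt 33 6 skip (map false 10 6 6 3 (.cell 9 (.const 0) (.var (lv 0)) (.var (lv 1))))))))

/-- Find a matrix in the algebra with distinct eigenvalues. -/
def search : Cmd := loop 20 9 trial

/-- Diagonalize it. -/
def oracle : Cmd := diag 6 10 11 12

/-- The entry `(i, j)` of the matrix `v_c` that the `c`-th eigenvector describes; `ℓ` is the number
of variables already bound. -/
def vE (ℓ : ℕ) (c i j : NExpr) : FExpr :=
  .sum 6 (.op .mul (.cell 11 (.var (lv ℓ)) c (.const 0)) (uE (.var (lv ℓ)) i j))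

/-- Solve for the vectors `w_c`. -/
def solveW : Cmd :=
  loop 15 0 (loop 16 1 (seq
    (map false 4 3 10 3 (.op .add (.cell 0 (.var 15) (.var 16) (.var (lv 1)))
      (.sum 6 (.op .mul (.eq (.var (lv 1)) (.add (.var 2) (.var (lv 3))))
        (vE 4 (.var (lv 3)) (.var 15) (.var 16))))))
    (insert 34 4 10 3)))

def writeW : Cmd :=
  map false 3 6 2 3 (.sum 4 (.op .mul
    (.eq (.load 34 (.var (lv 3))) (.add (.var 2) (.var (lv 0))))
    (.cell 34 (.var (lv 3)) (.var (lv 1)) (.const 0))))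

/-- Find a nonzero entry of each `v_c`. -/
def pivots : Cmd :=
  loop 19 6 (seq (map false 5 3 0 1 (vE 3 (.var 19) (.var (lv 1)) (.var (lv 2))))
    (seq (find 5 3 0 1) (seq (nstore 50 (.var 19) (.var 13)) (nstore 51 (.var 19) (.var 14)))))

def writeX : Cmd :=
  map false 1 6 0 3 (vE 3 (.var (lv 0)) (.var (lv 1)) (.load 51 (.var (lv 0))))

def writeY : Cmd :=
  map false 2 6 1 3 (.op .div (vE 3 (.var (lv 0)) (.load 50 (.var (lv 0))) (.var (lv 1)))
    (vE 3 (.var (lv 0)) (.load 50 (.var (lv 0))) (.load 51 (.var (lv 0)))))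

/-- Check the decomposition: the variable `41` is zero if it is correct. -/
def verify : Cmd :=
  seq (nset 41 (.const 0)) (loop 15 0 (loop 16 1 (loop 17 2
    (ifZero (.op .sub (.cell 0 (.var 15) (.var 16) (.var 17))
      (.sum 6 (.op .mul (.op .mul (.cell 1 (.var (lv 0)) (.var 15) (.const 0))
        (.cell 2 (.var (lv 0)) (.var 16) (.const 0)))
        (.cell 3 (.var (lv 0)) (.var 17) (.const 0))))) skip (nset 41 (.const 1))))))

/-- Everything from the computation of the algebra on. -/
def decompose : Cmd :=
  seq algebra (seq search (seq oracle (seq solveW (seq writeW (seq pivots (seq writeX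
    (seq writeY verify)))))))

/-- Fail unless the decomposition is correct and the number of independent minors is right. -/
def finish : Cmd :=
  seq (nset 43 (.add (.add (.var 31) (.var 31)) (.var 6))) (seq (nset 40 (.const 0))
    (ifLt 40 41 (nset 0 (.const 0)) (ifLt 43 7 (nset 0 (.const 0))
      (ifLt 7 43 (nset 0 (.const 0)) (seq (nset 0 (.const 1)) (nset 1 (.var 6)))))))

theorem wf_all : (sizes.wf && sizesSq.wf && basis.wf && rankSize.wf && rankSq.wf && rankSizes.wf &&
    minors.wf && decompose.wf && finish.wf) = true := by decide +kernel

/-- The lists name sizes that are already final at that stage. Cutting the algorithm where a size is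
computed makes each part tame by itself. Only `n₃` and `n₃ + R`, in the variables `2` and `10`, are
ever used as unnested large bounds. -/
theorem tame_sizes : sizes.compile.tame [0, 1] [2] true true = true := by decide +kernel
theorem tame_sizesSq : sizesSq.compile.tame [0, 1, 3, 4] [2] true true = true := by decide +kernel
theorem tame_basis : basis.compile.tame [0, 1, 3, 4] [2] true true = true := by decide +kernel
theorem tame_rankSize : rankSize.compile.tame [] [] true true = true := by decide +kernel
theorem tame_rankSq : rankSq.compile.tame [6] [] true true = true := by decide +kernel
theorem tame_rankSizes : rankSizes.compile.tame [7] [] true true = true := by decide +kernel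
theorem tame_minors : minors.compile.tame [0, 1, 3, 4, 5, 6, 7, 8, 9] [2, 10] true true = true := by
  decide +kernel
theorem tame_decompose :
    decompose.compile.tame [0, 1, 3, 4, 5, 6, 7, 8, 9] [2, 10] true true = true := by
  decide +kernel
theorem tame_finish : finish.compile.tame [] [] true true = true := by decide +kernel

end Algo

/-! ## What the parts of the algorithm compute -/

/-- The states agree on the variables in `Vs` and on the arrays in `Fs` and `Ns`. -/
structure Same (Vs Fs Ns : List ℕ) (h₀ h : State F) : Prop where
  var : ∀ x ∈ Vs, h.var x = h₀.var x
  fld : ∀ a ∈ Fs, h.fld a = h₀.fld a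
  nat : ∀ a ∈ Ns, h.nat a = h₀.nat a

/-- The command does not change the variables in `Vs` and the arrays in `Fs` and `Ns`. -/
def Cmd.keeps (Vs Fs Ns : List ℕ) (c : Cmd) : Bool :=
  Vs.all (fun x => c.keepsVar x) && Fs.all (fun x => c.keepsFld x) && Ns.all (fun x => c.keepsNat x)

namespace Same

variable {Vs Fs Ns : List ℕ} {h₀ h h' : State F}

theorem refl (Vs Fs Ns : List ℕ) (h : State F) : Same Vs Fs Ns h h :=
  ⟨fun _ _ => rfl, fun _ _ => rfl, fun _ _ => rfl⟩

theorem den (O : DiagOracle F) {c : Cmd} (hc : c.keeps Vs Fs Ns = true) (H : Same Vs Fs Ns h₀ h) :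
    Same Vs Fs Ns h₀ (c.den O h) := by
  simp only [Cmd.keeps, Bool.and_eq_true, List.all_eq_true] at hc
  exact ⟨fun x hx => (Cmd.var_den O c (hc.1.1 x hx) h).trans (H.var x hx),
    fun x hx => (Cmd.fld_den O c (hc.1.2 x hx) h).trans (H.fld x hx),
    fun x hx => (Cmd.nat_den O c (hc.2 x hx) h).trans (H.nat x hx)⟩

theorem of_den (O : DiagOracle F) {c : Cmd} (Vs Fs Ns : List ℕ) (hc : c.keeps Vs Fs Ns = true)
    (h : State F) : Same Vs Fs Ns h (c.den O h) :=
  (refl Vs Fs Ns h).den O hc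

theorem cons_setVar (H : Same Vs Fs Ns h₀ h) (x m : ℕ) :
    Same (x :: Vs) Fs Ns (h₀.setVar x m) (h.setVar x m) := by
  refine ⟨fun y hy => ?_, H.fld, H.nat⟩
  simp only [State.setVar]
  split_ifs with g
  · rfl
  · exact H.var y ((List.mem_cons.1 hy).resolve_left g)

theorem of_cons {x m : ℕ} (hx : x ∉ Vs) (H : Same (x :: Vs) Fs Ns (h₀.setVar x m) h) :
    Same Vs Fs Ns h₀ h := by
  refine ⟨fun y hy => ?_, H.fld, H.nat⟩
  have : y ≠ x := fun e => hx (e ▸ hy)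
  rw [H.var y (List.mem_cons_of_mem _ hy)]
  simp [State.setVar, this]

end Same

namespace Adds

variable {O : DiagOracle F} {σ n n' rm k : ℕ} {c : Cmd} {Vs Fs Ns : List ℕ} {h₀ : State F}

theorem same_loop {x y : ℕ} {row : ℕ → (ℕ → ℕ → F) → Prop} (hx : x ≠ σ) (hy : y ∈ Vs)
    (hx' : x ∉ Vs)
    (hc : ∀ m < h₀.var y, Adds O σ n n' rm (Same (x :: Vs) Fs Ns (h₀.setVar x m)) c k (row m)) :
    Adds O σ n n' rm (Same Vs Fs Ns h₀) (.loop x y c) (h₀.var y * k)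
      (fun g => ∀ m < h₀.var y, row m g) := by
  refine Adds.loop hx (fun h hh => hh.var y hy)
    (fun h m hh => (hh.cons_setVar x m).of_cons hx') fun m hm h Kr cnt hh hR hle => ?_
  have e : Same (x :: Vs) Fs Ns (h₀.setVar x m) h := by
    refine ⟨fun z hz => ?_, hh.1.fld, hh.1.nat⟩
    rcases List.mem_cons.1 hz with rfl | hz
    · simp [hh.2, State.setVar]
    · have : z ≠ x := fun e => hx' (e ▸ hz)
      simp [hh.1.var z hz, State.setVar, this]
  obtain ⟨a1, a2⟩ := hc m hm h Kr cnt e hR hle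
  refine ⟨⟨a1.of_cons hx', ?_⟩, a2⟩
  rw [a1.var x (List.mem_cons_self ..)]
  simp [State.setVar]

/-- `p` computes an auxiliary array `b`; it stays fixed while `c` runs, so the rows inserted by `c`
may depend on it. -/
theorem same_pre {p : Cmd} {b : ℕ} {row : (ℕ → ℕ → F) → Prop}
    (hp : p.keeps (σ :: Vs) (σ :: Fs) (σ :: (σ + 10) :: Ns) = true)
    (hc : ∀ h, Same Vs Fs Ns h₀ h → Adds O σ n n' rm (Same Vs (b :: Fs) Ns (p.den O h)) c k row) :
    Adds O σ n n' rm (Same Vs Fs Ns h₀) (.seq p c) k row := by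
  intro h Kr cnt hh hR hle
  have hp' := Same.of_den O _ _ _ hp h
  obtain ⟨a1, a2⟩ := hc h hh (p.den O h) Kr cnt (Same.refl ..)
    (hR.congr_state (hp'.fld σ (List.mem_cons_self ..)) (hp'.nat σ (List.mem_cons_self ..))
      (hp'.nat (σ + 10) (by simp)) (hp'.var σ (List.mem_cons_self ..))) hle
  refine ⟨⟨fun x hx => ?_, fun x hx => ?_, fun x hx => ?_⟩, a2⟩
  · rw [Cmd.den, a1.var x hx, hp'.var x (List.mem_cons_of_mem _ hx), hh.var x hx]
  · rw [Cmd.den, a1.fld x (List.mem_cons_of_mem _ hx), hp'.fld x (List.mem_cons_of_mem _ hx),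
      hh.fld x hx]
  · rw [Cmd.den, a1.nat x hx, hp'.nat x (by simp [hx]), hh.nat x hx]

theorem row {vrm vn vn' : ℕ} {e : FExpr} (hσ : 30 ≤ σ) (hσ' : σ < 40)
    (hrm : vrm < 11) (hn : vn < 11) (hn' : vn' < 11)
    (hm : (Cmd.map false 4 3 vn vn' e).keeps Vs Fs Ns = true)
    (hi : (Cmd.insert σ vrm vn vn').keeps Vs Fs Ns = true)
    (h1 : vn ∈ Vs) (h2 : vn' ∈ Vs) (h3 : vrm ∈ Vs) (h4 : 3 ∈ Vs)
    (e1 : h₀.var vn = n) (e2 : h₀.var vn' = n') (e3 : h₀.var vrm = rm) (e4 : h₀.var 3 = 1)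
    {f : ℕ → ℕ → F}
    (he : ∀ h, Same Vs Fs Ns h₀ h → ∀ j < n, ∀ k < n', e.eval 3 (h.bind₃ 0 j k) = f j k) :
    Adds O σ n n' rm (Same Vs Fs Ns h₀)
      (.seq (.map false 4 3 vn vn' e) (Cmd.insert σ vrm vn vn')) 1 (fun g => dot n n' f g = 0) := by
  have s1 : σ ≠ 4 := by omega
  refine Adds.pre (inv' := fun h => Same Vs Fs Ns h₀ h ∧ ∀ j < n, ∀ k < n', h.fld 4 0 j k = f j k)
    (fun h hh => ⟨hh.den O hm, fun j hj k hk => ?_⟩) (fun h hh => hh.1)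
    (by simpa [Cmd.keepsFld] using s1.symm) rfl rfl rfl ?_
  · rw [Cmd.den, Cmd.fill_set (by rw [hh.var 3 h4, e4]; exact Nat.one_pos)
      (by rw [hh.var vn h1, e1]; exact hj) (by rw [hh.var vn' h2, e2]; exact hk)]
    exact he h hh j hj k hk
  · refine Adds.insert hσ hσ' hrm hn hn' (fun h hh => ?_) (fun h hh g => ?_) fun h hh => ?_
    · rw [hh.1.var vn h1, hh.1.var vn' h2, hh.1.var vrm h3, hh.1.var 3 h4]
      exact ⟨e1, e2, e3, e4⟩
    · rw [dot_congr hh.2 fun _ _ _ _ => rfl]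
    · refine ⟨hh.1.den O hi, fun j hj k hk => ?_⟩
      rw [Cmd.fld_den O _ (Cmd.insert_keepsFld s1.symm (by norm_num) (by norm_num))]
      exact hh.2 j hj k hk

/-- Insert into the empty set of rows. -/
theorem start {row : (ℕ → ℕ → F) → Prop} (hc : Adds O σ n n' rm (Same Vs Fs Ns h₀) c k row)
    (hk : k ≤ rm) (hσ : h₀.var σ = 0) (hz : ∀ a < rm, ∀ j < n, ∀ k < n', h₀.fld σ a j k = 0) :
    RedS σ n n' rm (c.den O h₀) row k := by
  refine (hc h₀ (fun _ => True) 0 (Same.refl ..) ?_ (by omega)).2.congr_ker (by simp) (by simp)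
  unfold RedS
  rw [hσ]
  exact Red.empty n n' rm _ _ hz

end Adds

namespace Algo

open Cmd FExpr

/-- The pairing of the minors with `u_a u_b`. -/
def phi (u : ℕ → ℕ → ℕ → F) (i i' j j' a b : ℕ) : F :=
  u a i j * u b i' j' + u b i j * u a i' j' - (u a i j' * u b i' j + u b i j' * u a i' j)

/-- There is a row for each position `(i, j)` and a column for each slice. The kernel consists of
the linear relations between the slices, and the pivot columns are the slices that form the basis.
-/
theorem basis_spec (O : DiagOracle F) {h : State F} (h3 : h.var 3 = 1)
    (h4 : h.var 4 = h.var 0 * h.var 1) (h30 : h.var 30 = 0) (hz : ∀ a j k, h.fld 30 a j k = 0) :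
    RedS 30 (h.var 2) 1 (h.var 4) (basis.den O h) (fun g => ∀ i < h.var 0, ∀ j < h.var 1,
      dot (h.var 2) 1 (fun k _ => h.fld 0 i j k) g = 0) (h.var 0 * (h.var 1 * 1)) := by
  refine Adds.start (Vs := [0, 1, 2, 3, 4]) (Fs := [0]) (Ns := []) ?_ (by rw [h4, mul_one]) h30
    fun a _ j _ k _ => hz a j k
  refine Adds.same_loop (by norm_num) (by decide) (by decide) fun i _ =>
    Adds.same_loop (y := 1) (by norm_num) (by decide) (by decide) fun j _ => ?_
  refine Adds.row (by norm_num) (by norm_num) (by norm_num) (by norm_num) (by norm_num)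
    (by decide) (by decide) (by decide) (by decide) (by decide) (by decide) ?_ ?_ ?_ ?_ ?_
  · rfl
  · exact h3
  · rfl
  · exact h3
  · intro h' hh k hk k' hk'
    have e15 := hh.var 15 (by decide)
    have e16 := hh.var 16 (by decide)
    have e0 := hh.fld 0 (by decide)
    simp [State.setVar] at e15 e16 e0
    simp [FExpr.eval, NExpr.eval, State.bind₃, State.setVar, lv, e15, e16, e0]

theorem minors_spec (O : DiagOracle F) {h : State F} (h3 : h.var 3 = 1)
    (h5 : h.var 5 = (h.var 0 * h.var 1) * (h.var 0 * h.var 1))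
    (h31 : h.var 31 = 0) (hz : ∀ a j k, h.fld 31 a j k = 0) :
    RedS 31 (h.var 6) (h.var 6) (h.var 5) (minors.den O h)
      (fun g => ∀ i < h.var 0, ∀ i' < h.var 0, ∀ j < h.var 1, ∀ j' < h.var 1,
        dot (h.var 6) (h.var 6)
          (phi (fun a i j => h.fld 0 i j (h.nat 30 a a a)) i i' j j') g = 0)
      (h.var 0 * (h.var 0 * (h.var 1 * (h.var 1 * 1)))) := by
  refine Adds.start (Vs := [0, 1, 3, 5, 6]) (Fs := [0]) (Ns := [30]) ?_
    (by rw [h5]; exact le_of_eq (by ring)) h31 fun a _ j _ k _ => hz a j k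
  refine Adds.same_loop (by norm_num) (by decide) (by decide) fun i _ =>
    Adds.same_loop (y := 0) (by norm_num) (by decide) (by decide) fun i' _ =>
    Adds.same_loop (y := 1) (by norm_num) (by decide) (by decide) fun j _ =>
    Adds.same_loop (y := 1) (by norm_num) (by decide) (by decide) fun j' _ => ?_
  refine Adds.row (by norm_num) (by norm_num) (by norm_num) (by norm_num) (by norm_num)
    (by decide) (by decide) (by decide) (by decide) (by decide) (by decide) ?_ ?_ ?_ ?_ ?_
  · rfl
  · rfl
  · rfl
  · exact h3
  · intro h' hh k hk k' hk'
    have e15 := hh.var 15 (by decide)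
    have e16 := hh.var 16 (by decide)
    have e17 := hh.var 17 (by decide)
    have e18 := hh.var 18 (by decide)
    have e0 := hh.fld 0 (by decide)
    have e30 := hh.nat 30 (by decide)
    simp [State.setVar] at e15 e16 e17 e18 e0 e30
    simp [minorE, uE, FExpr.eval, NExpr.eval, State.bind₃, State.setVar, lv, e15, e16, e17, e18, e0,
      e30, FieldOp.apply, phi]

/-- The entry `(e, e')` of the projection of `z` to the common kernel of reduced rows. -/
def proj (n n' rm : ℕ) (B : ℕ → ℕ → ℕ → F) (pj pk : ℕ → ℕ) (z : ℕ → ℕ → F) (e e' : ℕ) : F :=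
  z e e' - ∑ a ∈ Finset.range rm, dot n n' (B a) z *
    ((if e = pj a then 1 else 0) * (if e' = pk a then 1 else 0))

/-- The unit matrix with entry `1` at `(j, k)`. -/
def unitAt (j k e e' : ℕ) : F := (if j = e then 1 else 0) * (if k = e' then 1 else 0)

theorem dot_unitAt {n n' j k : ℕ} (hj : j < n) (hk : k < n') (x : ℕ → ℕ → F) :
    dot n n' x (unitAt j k) = x j k := by
  simp [dot, unitAt, hj, hk]

/-- The symmetrized projection of the unit matrix at `(j, k)`. -/
def symSol (R rm : ℕ) (B : ℕ → ℕ → ℕ → F) (pj pk : ℕ → ℕ) (j k c b : ℕ) : F :=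
  proj R R rm B pj pk (unitAt j k) c b + proj R R rm B pj pk (unitAt j k) b c

/-- The coefficients of the entry `(a, b)` of `M S - (M S)ᵀ` as a function of the matrix `M`. -/
def symRow (S : ℕ → ℕ → F) (a b e c : ℕ) : F :=
  (if e = a then 1 else 0) * S c b - (if e = b then 1 else 0) * S c a

/-- The projections of the unit matrices span the solutions, so symmetry of the products need only
be imposed for these `R²` solutions, symmetrized. -/
theorem algebra_spec (O : DiagOracle F) {h : State F} (h3 : h.var 3 = 1)
    (h7 : h.var 7 = h.var 6 * h.var 6) (h8 : h.var 8 = h.var 7 * h.var 7)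
    (h32 : h.var 32 = 0) (hz : ∀ a j k, h.fld 32 a j k = 0) :
    RedS 32 (h.var 6) (h.var 6) (h.var 8) (algebra.den O h)
      (fun M => ∀ j < h.var 6, ∀ k < h.var 6, ∀ a < h.var 6, ∀ b < h.var 6,
        dot (h.var 6) (h.var 6) (symRow (symSol (h.var 6) (h.var 5) (h.fld 31)
          (fun a => h.nat 31 a a a) (fun a => h.nat 41 a a a) j k) a b) M = 0)
      (h.var 6 * (h.var 6 * (h.var 6 * (h.var 6 * 1)))) := by
  refine Adds.start (Vs := [3, 5, 6, 8]) (Fs := [31]) (Ns := [31, 41]) ?_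
    (by rw [h8, h7]; exact le_of_eq (by ring)) h32 fun a _ j _ k _ => hz a j k
  refine Adds.same_loop (by norm_num) (by decide) (by decide) fun j hj =>
    Adds.same_loop (y := 6) (by norm_num) (by decide) (by decide) fun k hk => ?_
  refine Adds.same_pre (b := 7) (by decide) fun h' hh => ?_
  have e21 := hh.var 21 (by decide)
  have e22 := hh.var 22 (by decide)
  have e31 := hh.fld 31 (by decide)
  have n31 := hh.nat 31 (by decide)
  have n41 := hh.nat 41 (by decide)
  have e3 := hh.var 3 (by decide)
  have e5 := hh.var 5 (by decide)
  have e6 := hh.var 6 (by decide)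
  have e8 := hh.var 8 (by decide)
  simp [State.setVar] at e21 e22 e31 n31 n41 e3 e5 e6 e8 hj hk
  set h1 := solution.den O h' with hh1
  have v : h1.var = h'.var := rfl
  have sol : ∀ e < h.var 6, ∀ e' < h.var 6, h1.fld 7 0 e e' = proj (h.var 6) (h.var 6) (h.var 5)
      (h.fld 31) (fun a => h.nat 31 a a a) (fun a => h.nat 41 a a a) (unitAt j k) e e' := by
    intro e he e' he'
    rw [hh1, solution, den, fill_set (by omega) (by omega) (by omega)]
    simp only [FExpr.eval, NExpr.eval, State.bind₃, State.setVar, lv, FieldOp.apply, proj]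
    simp [e21, e22, e31, n31, n41, e5, dot_unitAt hj hk]
    simp [unitAt]
  have w6 : h1.var 6 = h.var 6 := by rw [v, e6]
  have w3 : h1.var 3 = 1 := by rw [v, e3, h3]
  have w8 : h1.var 8 = h.var 8 := by rw [v, e8]
  have goal := Adds.same_loop (O := O) (σ := 32) (n := h.var 6) (n' := h.var 6) (rm := h.var 8)
    (x := 23) (y := 6) (Vs := [22, 21, 3, 5, 6, 8]) (Fs := [7, 31]) (Ns := [31, 41]) (h₀ := h1)
    (c := loop 24 6 (seq
    (map false 4 3 6 6 (.op .sub
      (.op .mul (.eq (.var (lv 1)) (.var 23)) (symE (.var (lv 2)) (.var 24)))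
      (.op .mul (.eq (.var (lv 1)) (.var 24)) (symE (.var (lv 2)) (.var 23)))))
    (insert 32 8 6 6))) (k := h1.var 6 * 1) (row := fun a M => ∀ b < h1.var 6,
        dot (h.var 6) (h.var 6) (symRow (symSol (h.var 6) (h.var 5) (h.fld 31)
          (fun a => h.nat 31 a a a) (fun a => h.nat 41 a a a) j k) a b) M = 0)
    (by norm_num) (by decide) (by decide) fun a ha =>
    Adds.same_loop (y := 6) (by norm_num) (by decide) (by decide) fun b hb => ?_
  · rw [w6] at goal
    exact goal
  refine Adds.row (by norm_num) (by norm_num) (by norm_num) (by norm_num) (by norm_num)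
    (by decide) (by decide) (by decide) (by decide) (by decide) (by decide) ?_ ?_ ?_ ?_ ?_
  · exact w6
  · exact w6
  · exact w8
  · exact w3
  · intro h2 hh2 e he c hc
    have hb' : b < h.var 6 := by
      have : ((h1.setVar 23 a).var 6) = h1.var 6 := rfl
      omega
    have e23 := hh2.var 23 (by decide)
    have e24 := hh2.var 24 (by decide)
    have e7 := hh2.fld 7 (by decide)
    simp [State.setVar] at e23 e24 e7
    simp [symE, FExpr.eval, NExpr.eval, State.bind₃, State.setVar, lv, e23, e24, e7, FieldOp.apply,
      symRow, symSol, ← sol c hc b hb', ← sol b hb' c hc, ← sol c hc a (by omega),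
      ← sol a (by omega) c hc]

end Algo

/-! ## The kernel of reduced rows -/

namespace Red

open Algo

variable {n n' rm r cnt : ℕ} {B : ℕ → ℕ → ℕ → F} {pj pk : ℕ → ℕ} {Kr : (ℕ → ℕ → F) → Prop}

/-- The projection changes `z` at the pivot positions only, so the correction sees nothing of `x`
but its pivot entries. -/
theorem dot_proj (h : Red n n' rm B pj pk r Kr cnt) (hrm : r ≤ rm) (x z : ℕ → ℕ → F) :
    dot n n' x (proj n n' rm B pj pk z) =
      dot n n' x z - ∑ a ∈ Finset.range r, dot n n' (B a) z * x (pj a) (pk a) := by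
  have e1 : dot n n' x (proj n n' rm B pj pk z) = dot n n' (fun e e' => z e e' -
      ∑ a ∈ Finset.range r, dot n n' (B a) z * unitAt (pj a) (pk a) e e') x := by
    rw [dot_comm]
    refine dot_congr (fun e _ e' _ => ?_) fun _ _ _ _ => rfl
    rw [proj, ← Finset.sum_subset (Finset.range_mono hrm)]
    · simp only [unitAt, eq_comm]
    · intro a ha ha'
      rw [Finset.mem_range] at ha ha'
      rw [dot_zero_left (h.zero a (not_lt.1 ha') ha), zero_mul]
  rw [e1, dot_sub_sum, dot_comm]
  congr 1
  refine Finset.sum_congr rfl fun a ha => ?_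
  rw [Finset.mem_range] at ha
  rw [dot_comm n n' _ x]
  exact congrArg _ (dot_unitAt (h.hj a ha) (h.hk a ha) x)

/-- The projection maps to the kernel. -/
theorem ker_proj (h : Red n n' rm B pj pk r Kr cnt) (hrm : r ≤ rm) (z : ℕ → ℕ → F) :
    Kr (proj n n' rm B pj pk z) := by
  rw [h.ker]
  intro b hb
  rw [h.dot_proj hrm, Finset.sum_eq_single b]
  · rw [h.unit b hb b hb, if_pos rfl, mul_one, sub_self]
  · intro a ha hab
    rw [h.unit b hb a (Finset.mem_range.1 ha), if_neg hab.symm, mul_zero]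
  · intro hb'
    exact absurd (Finset.mem_range.2 hb) hb'

/-- The projection fixes the kernel. -/
theorem proj_of_ker (h : Red n n' rm B pj pk r Kr cnt) {z : ℕ → ℕ → F} (hz : Kr z) :
    proj n n' rm B pj pk z = z := by
  funext e e'
  rw [proj, Finset.sum_eq_zero, sub_zero]
  intro a ha
  by_cases har : a < r
  · rw [(h.ker z).1 hz a har, zero_mul]
  · rw [dot_zero_left (h.zero a (not_lt.1 har) (Finset.mem_range.1 ha)), zero_mul]

theorem pivot_injective (h : Red n n' rm B pj pk r Kr cnt) {a b : ℕ} (ha : a < r) (hb : b < r)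
    (hj : pj a = pj b) (hk : pk a = pk b) : a = b := by
  by_contra hab
  have h1 := h.unit a ha b hb
  rw [← hj, ← hk, h.unit a ha a ha, if_pos rfl, if_neg hab] at h1
  exact one_ne_zero h1

/-- A position that is not a pivot gives an element of the kernel. -/
theorem proj_unitAt_self (h : Red n n' rm B pj pk r Kr cnt) {j k : ℕ}
    (hp : ∀ a < r, ¬ (pj a = j ∧ pk a = k)) : proj n n' rm B pj pk (unitAt j k) j k = 1 := by
  rw [proj, Finset.sum_eq_zero]
  · simp [unitAt]
  intro a ha
  by_cases har : a < r
  · have := hp a har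
    by_cases e1 : j = pj a
    · have e2 : k ≠ pk a := fun e2 => this ⟨e1.symm, e2.symm⟩
      simp [e2]
    · simp [e1]
  · rw [dot_zero_left (h.zero a (not_lt.1 har) (Finset.mem_range.1 ha)), zero_mul]

/-- There are `n n'` reduced rows if and only if the kernel is trivial. -/
theorem full_iff (h : Red n n' rm B pj pk r Kr cnt) (hrm : r ≤ rm) :
    r = n * n' ↔ ∀ g, Kr g → ∀ j < n, ∀ k < n', g j k = 0 := by
  let p : Fin r → Fin n × Fin n' := fun a => (⟨pj a, h.hj a a.2⟩, ⟨pk a, h.hk a a.2⟩)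
  have hp : Function.Injective p := by
    intro a b hab
    simp only [p, Prod.mk.injEq, Fin.mk.injEq] at hab
    exact Fin.ext (h.pivot_injective a.2 b.2 hab.1 hab.2)
  constructor
  · intro hr
    have hs : Function.Surjective p :=
      ((Fintype.bijective_iff_injective_and_card p).2 ⟨hp, by simp [hr]⟩).2
    intro g hg j hj k hk
    obtain ⟨a, ha⟩ := hs (⟨j, hj⟩, ⟨k, hk⟩)
    simp only [p, Prod.mk.injEq, Fin.mk.injEq] at ha
    have h1 := (h.ker g).1 hg a a.2
    have h2 : dot n n' (B a) g = g j k := by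
      rw [← dot_unitAt hj hk g, dot_comm]
      refine (dot_comm _ _ _ _).trans ?_
      rw [dot_comm n n' g]
      refine dot_congr (fun j' hj' k' hk' => ?_) fun _ _ _ _ => rfl
      obtain ⟨b, hb⟩ := hs (⟨j', hj'⟩, ⟨k', hk'⟩)
      simp only [p, Prod.mk.injEq, Fin.mk.injEq] at hb
      rw [← hb.1, ← hb.2, h.unit a a.2 b b.2, ← ha.1, ← ha.2, unitAt]
      by_cases hab : a = b
      · simp [hab]
      · have h3 : (a : ℕ) ≠ b := fun e => hab (Fin.ext e)
        rw [if_neg h3]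
        by_cases e1 : pj a = pj b
        · have e2 : pk a ≠ pk b := fun e2 => h3 (h.pivot_injective a.2 b.2 e1 e2)
          simp [e2]
        · simp [e1]
    rw [← h2, h1]
  · intro hg
    have hs : Function.Surjective p := by
      rintro ⟨⟨j, hj⟩, ⟨k, hk⟩⟩
      by_contra hne
      have h1 := h.proj_unitAt_self (j := j) (k := k) fun a ha hjk =>
        hne ⟨⟨a, ha⟩, by simp only [p, Prod.mk.injEq, Fin.mk.injEq]; exact hjk⟩
      rw [hg _ (h.ker_proj hrm _) j hj k hk] at h1
      exact zero_ne_one h1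
    have := Fintype.card_of_bijective ⟨hp, hs⟩
    simpa using this

/-- The extension of a finite matrix by zero. -/
def ext {n n' : ℕ} (g : Fin n × Fin n' → F) (j k : ℕ) : F :=
  if h : j < n ∧ k < n' then g (⟨j, h.1⟩, ⟨k, h.2⟩) else 0

theorem dot_ext (x : ℕ → ℕ → F) (g : Fin n × Fin n' → F) :
    dot n n' x (ext g) = ∑ q : Fin n × Fin n', x q.1 q.2 * g q := by
  rw [dot, Finset.sum_range, Fintype.sum_prod_type]
  refine Finset.sum_congr rfl fun j _ => ?_
  rw [Finset.sum_range]
  exact Finset.sum_congr rfl fun k _ => by simp [ext]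

/-- The number of reduced rows is the rank. -/
theorem rank_eq (h : Red n n' rm B pj pk r Kr cnt) {W : Type*} [AddCommGroup W] [Module F W]
    (S : (Fin n × Fin n' → F) →ₗ[F] W) (hS : ∀ g, Kr (ext g) ↔ S g = 0) :
    r = Module.finrank F (LinearMap.range S) := by
  let b : (Fin n × Fin n' → F) →ₗ[F] (Fin r → F) :=
    LinearMap.pi fun a => ∑ q : Fin n × Fin n', B a q.1 q.2 • LinearMap.proj q
  have hb : ∀ g a, b g a = dot n n' (B a) (ext g) := by
    intro g a
    simp [b, dot_ext]
  have hker : LinearMap.ker b = LinearMap.ker S := by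
    ext g
    rw [LinearMap.mem_ker, LinearMap.mem_ker, ← hS, h.ker]
    constructor
    · intro hg a ha
      rw [← hb g ⟨a, ha⟩, hg]
      rfl
    · intro hg
      funext a
      rw [hb]
      exact hg a a.2
  -- The unit matrices at the pivots are dual to the reduced rows, so the rows are independent.
  have hsurj : LinearMap.range b = ⊤ := by
    rw [LinearMap.range_eq_top]
    intro y
    refine ⟨fun q => ∑ c : Fin r, y c * unitAt (pj c) (pk c) q.1 q.2, ?_⟩
    funext a
    rw [hb, dot_ext]
    simp only [Finset.mul_sum]
    rw [Finset.sum_comm, Finset.sum_eq_single a]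
    · have h1 := dot_unitAt (h.hj a a.2) (h.hk a a.2) (B a)
      rw [h.unit a a.2 a a.2, if_pos rfl] at h1
      have h2 : dot n n' (B a) (unitAt (pj a) (pk a)) =
          ∑ q : Fin n × Fin n', B a q.1 q.2 * unitAt (pj a) (pk a) q.1 q.2 := by
        rw [← dot_ext (B a) fun q => unitAt (F := F) (pj a) (pk a) q.1 q.2]
        exact dot_congr (fun _ _ _ _ => rfl) fun j hj k hk => by simp [ext, hj, hk]
      rw [h2] at h1
      calc _ = y a * ∑ q : Fin n × Fin n', B a q.1 q.2 * unitAt (pj a) (pk a) q.1 q.2 := by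
            rw [Finset.mul_sum]; exact Finset.sum_congr rfl fun _ _ => by ring
        _ = y a := by rw [h1, mul_one]
    · intro c _ hca
      have h1 := dot_unitAt (h.hj c c.2) (h.hk c c.2) (B a)
      rw [h.unit a a.2 c c.2, if_neg (fun e => hca (Fin.ext e.symm))] at h1
      have h2 : dot n n' (B a) (unitAt (pj c) (pk c)) =
          ∑ q : Fin n × Fin n', B a q.1 q.2 * unitAt (pj c) (pk c) q.1 q.2 := by
        rw [← dot_ext (B a) fun q => unitAt (F := F) (pj c) (pk c) q.1 q.2]
        exact dot_congr (fun _ _ _ _ => rfl) fun j hj k hk => by simp [ext, hj, hk]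
      rw [h2] at h1
      calc _ = y c * ∑ q : Fin n × Fin n', B a q.1 q.2 * unitAt (pj c) (pk c) q.1 q.2 := by
            rw [Finset.mul_sum]; exact Finset.sum_congr rfl fun _ _ => by ring
        _ = 0 := by rw [h1, mul_zero]
    · simp
  have h1 := LinearMap.finrank_range_add_finrank_ker b
  have h2 := LinearMap.finrank_range_add_finrank_ker S
  rw [hker, hsurj, finrank_top, Module.finrank_fin_fun] at h1
  omega

end Red

/-! ### Trial matrices and the Krylov test. -/

namespace Algo

open Cmd FExpr

theorem den_seq (O : DiagOracle F) (c c' : Cmd) (s : State F) :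
    (seq c c').den O s = c'.den O (c.den O s) := rfl

/-- The `i`-th Krylov vector of the matrix `M` and the vector `x`. -/
def krylov (R : ℕ) (M : ℕ → ℕ → F) (x : ℕ → F) : ℕ → ℕ → F
  | 0, a => x a
  | i + 1, a => ∑ b ∈ Finset.range R, M a b * krylov R M x i b

/-- The trial vector. -/
def powers (R t j k : ℕ) : F := (t : F) ^ j * ((t : F) ^ R) ^ k

theorem krylovStep_spec (O : DiagOracle F) {h : State F} (h3 : h.var 3 = 1) {x : ℕ → F}
    (hx : ∀ a < h.var 6, h.fld 13 0 a 0 = x a) {Kr : (ℕ → ℕ → F) → Prop} {cnt : ℕ}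
    (hR : RedS 33 (h.var 6) 1 (h.var 6) h Kr cnt) (hc : cnt < h.var 6) :
    RedS 33 (h.var 6) 1 (h.var 6) (krylovStep.den O h)
      (fun g => Kr g ∧ dot (h.var 6) 1 (fun a _ => x a) g = 0) (cnt + 1) ∧
    ∀ a < h.var 6, (krylovStep.den O h).fld 13 0 a 0 =
      ∑ b ∈ Finset.range (h.var 6), h.fld 9 0 a b * x b := by
  have hA : Adds O 33 (h.var 6) 1 (h.var 6) (Same [3, 6] [9, 13] [] h)
      (seq (map false 4 3 6 3 (.cell 13 (.const 0) (.var (lv 1)) (.const 0))) (insert 33 6 6 3)) 1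
      (fun g => dot (h.var 6) 1 (fun a _ => x a) g = 0) := by
    refine Adds.row (by norm_num) (by norm_num) (by norm_num) (by norm_num) (by norm_num)
      (by decide) (by decide) (by decide) (by decide) (by decide) (by decide) rfl h3 rfl h3 ?_
    intro h' hh j hj k hk
    have e13 := hh.fld 13 (by decide)
    simp [FExpr.eval, NExpr.eval, State.bind₃, State.setVar, lv, e13, hx j hj]
  obtain ⟨a1, a2⟩ := hA h Kr cnt (Same.refl ..) hR hc
  rw [krylovStep, den]
  set h1 := (seq (map false 4 3 6 3 (.cell 13 (.const 0) (.var (lv 1)) (.const 0)))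
    (insert 33 6 6 3)).den O h with hh1
  have e6 := a1.var 6 (by decide)
  have e3 := a1.var 3 (by decide)
  have e9 := a1.fld 9 (by decide)
  have e13 := a1.fld 13 (by decide)
  constructor
  · exact a2.congr_state (fld_den O _ (by decide) h1) (nat_den O _ (by decide) h1)
      (nat_den O _ (by decide) h1) (var_den O _ (by decide) h1)
  · intro a ha
    simp only [den]
    rw [fill_set (by simp [State.fill, e3, h3]) (by simpa [State.fill, e6] using ha)
      (by simp [State.fill, e3, h3])]
    simp only [FExpr.eval, NExpr.eval, State.bind₃, State.setVar, lv]
    norm_num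
    rw [fill_set (by omega) (by omega) (by omega)]
    rw [e6]
    refine Finset.sum_congr rfl fun b hb => ?_
    simp [FieldOp.apply, e9, e13, hx b (Finset.mem_range.1 hb)]

/-- The matrix of trial `t`. -/
def trialMat (R rm : ℕ) (B : ℕ → ℕ → ℕ → F) (pj pk : ℕ → ℕ) (t : ℕ) : ℕ → ℕ → F :=
  proj R R rm B pj pk (powers R t)

/-- The Krylov vectors of trial `t` are independent. -/
def Good (R rm : ℕ) (B : ℕ → ℕ → ℕ → F) (pj pk : ℕ → ℕ) (t : ℕ) : Prop :=
  ∀ g : ℕ → ℕ → F, (∀ i < R,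
    dot R 1 (fun a _ => krylov R (trialMat R rm B pj pk t) (fun a => (t : F) ^ a) i a) g = 0) →
    ∀ j < R, ∀ k < 1, g j k = 0

/-- The rows `33` are reduced from `R` Krylov vectors of length `R`. By `Red.full_iff` their number
is `R` exactly when the common kernel is trivial, which is `Good`. -/
theorem trial_spec (O : DiagOracle F) {h : State F} (h3 : h.var 3 = 1) :
    (Good (h.var 6) (h.var 8) (h.fld 32) (fun a => h.nat 32 a a a) (fun a => h.nat 42 a a a)
        (h.var 20) → ∀ i < h.var 6, ∀ j < h.var 6, (trial.den O h).fld 10 i j 0 =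
          trialMat (h.var 6) (h.var 8) (h.fld 32) (fun a => h.nat 32 a a a)
            (fun a => h.nat 42 a a a) (h.var 20) i j) ∧
    (¬ Good (h.var 6) (h.var 8) (h.fld 32) (fun a => h.nat 32 a a a) (fun a => h.nat 42 a a a)
        (h.var 20) → (trial.den O h).fld 10 = h.fld 10) := by
  set R := h.var 6 with hRdef
  set t := h.var 20 with ht
  set M : ℕ → ℕ → F := trialMat R (h.var 8) (h.fld 32) (fun a => h.nat 32 a a a)
    (fun a => h.nat 42 a a a) t with hM
  simp only [trial, den_seq]
  set h1 := trialVector.den O h with hh1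
  have z1 : ∀ j < R, ∀ k < R, h1.fld 8 0 j k = powers R t j k := by
    intro j hj k hk
    rw [hh1, trialVector, den, fill_set (by omega) hj hk]
    simp [tauE, FExpr.eval, State.bind₃, State.setVar, lv, FieldOp.apply, powers, ← ht,
      ← hRdef]
  have s1 := Same.of_den O [3, 6, 8, 20] [10, 32] [32, 42] (c := trialVector) (by decide) h
  set h2 := trialMatrix.den O h1 with hh2
  have s2 := Same.of_den O [3, 6, 8, 20] [8, 10, 32] [32, 42] (c := trialMatrix) (by decide) h1
  have z2 : ∀ i < R, ∀ j < R, h2.fld 9 0 i j = M i j := by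
    intro i hi j hj
    have e6 : h1.var 6 = R := s1.var 6 (by decide)
    have e8 := s1.var 8 (by decide)
    have e32 := s1.fld 32 (by decide)
    have n32 := s1.nat 32 (by decide)
    have n42 := s1.nat 42 (by decide)
    have e3 := s1.var 3 (by decide)
    rw [← hh1] at e8 e32 n32 n42 e3
    rw [hh2, trialMatrix, den, fill_set (by omega) (by omega) (by omega)]
    simp only [FExpr.eval, NExpr.eval, State.bind₃, State.setVar, lv, FieldOp.apply]
    norm_num
    simp only [e6, e8, e32, n32, n42, hM, trialMat, proj]
    rw [z1 i hi j hj]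
    congr 1
    refine Finset.sum_congr rfl fun a _ => ?_
    have e : dot R R (h.fld 32 a) (powers R t) = ∑ j1 ∈ Finset.range R, ∑ j2 ∈ Finset.range R,
        h.fld 32 a j1 j2 * h1.fld 8 0 j1 j2 :=
      Finset.sum_congr rfl fun j1 hj1 => Finset.sum_congr rfl fun j2 hj2 => by
        rw [z1 j1 (Finset.mem_range.1 hj1) j2 (Finset.mem_range.1 hj2)]
    rw [e]
    by_cases g1 : i = h.nat 32 a a a <;> by_cases g2 : j = h.nat 42 a a a <;> simp [g1, g2]
  set h3' := krylovStart.den O h2 with hh3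
  have s3 := Same.of_den O [3, 6, 8, 20] [8, 9, 10, 32] [32, 42] (c := krylovStart) (by decide) h2
  have e6 : h3'.var 6 = R := by
    rw [s3.var 6 (by decide), s2.var 6 (by decide), s1.var 6 (by decide)]
  have e3 : h3'.var 3 = 1 := by
    rw [s3.var 3 (by decide), s2.var 3 (by decide), s1.var 3 (by decide), h3]
  have e2_6 : h2.var 6 = R := by rw [s2.var 6 (by decide), s1.var 6 (by decide)]
  have e2_3 : h2.var 3 = 1 := by rw [s2.var 3 (by decide), s1.var 3 (by decide), h3]
  have e9 : ∀ i < R, ∀ j < R, h3'.fld 9 0 i j = M i j := by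
    intro i hi j hj
    rw [s3.fld 9 (by decide)]
    exact z2 i hi j hj
  have e33 : h3'.var 33 = 0 := by
    simp [hh3, krylovStart, den, State.setVar, State.fill, NExpr.eval]
  have f33 : ∀ a < R, ∀ j < R, ∀ k < 1, h3'.fld 33 a j k = 0 := by
    intro a ha j hj k hk
    simp [hh3, krylovStart, den, State.setVar, State.fill, NExpr.eval, FExpr.eval, e2_6, e2_3, ha,
      hj, Nat.lt_one_iff.1 hk]
  have f13 : ∀ a < R, h3'.fld 13 0 a 0 = (t : F) ^ a := by
    intro a ha
    have e8 : h2.fld 8 0 a 0 = powers R t a 0 := by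
      rw [s2.fld 8 (by decide)]
      exact z1 a ha 0 (by omega)
    simp [hh3, krylovStart, den, State.setVar, State.fill, NExpr.eval, FExpr.eval, e2_6, e2_3, ha,
      State.bind₃, lv, e8, powers]
  have main := iterate_induction (f := fun m s' => krylovStep.den O (s'.setVar 19 m))
    (fun m h' => Same [3, 6] [9, 10] [] h3' h' ∧
      (∀ a < R, h'.fld 13 0 a 0 = krylov R M (fun a => (t : F) ^ a) m a) ∧
      RedS 33 R 1 R h' (fun g => ∀ i < m,
        dot R 1 (fun a _ => krylov R M (fun a => (t : F) ^ a) i a) g = 0) m) R (s := h3') ?_ ?_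
  · have e : (loop 19 6 krylovStep).den O h3' =
        iterate (fun m s' => krylovStep.den O (s'.setVar 19 m)) R h3' := by rw [den, e6]
    rw [e]
    set h4 := iterate (fun m s' => krylovStep.den O (s'.setVar 19 m)) R h3' with hh4
    obtain ⟨m1, m2, m3⟩ := main
    have hle := m3.le
    have full := Red.full_iff m3 hle
    have f10 : h4.fld 10 = h.fld 10 := by
      rw [m1.fld 10 (by decide), s3.fld 10 (by decide), s2.fld 10 (by decide),
        s1.fld 10 (by decide)]
    have e6' : h4.var 6 = R := by rw [m1.var 6 (by decide), e6]
    have e3' : h4.var 3 = 1 := by rw [m1.var 3 (by decide), e3]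
    have e20 : (h4.var 33 = R ↔ Good R (h.var 8) (h.fld 32) (fun a => h.nat 32 a a a)
        (fun a => h.nat 42 a a a) t) := by
      rw [mul_one] at full
      exact full
    constructor
    · intro hg i hi j hj
      rw [den, if_neg (by rw [e20.2 hg, e6']; exact lt_irrefl R), den,
        fill_set (by omega) (by omega) (by omega)]
      have : h4.fld 9 0 i j = M i j := by
        rw [m1.fld 9 (by decide)]
        exact e9 i hi j hj
      simpa [FExpr.eval, NExpr.eval, State.bind₃, State.setVar, lv] using this
    · intro hg
      have : h4.var 33 ≠ R := fun e => hg (e20.1 e)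
      rw [den, if_pos (by rw [e6']; omega), den, f10]
  · refine ⟨Same.refl .., fun a ha => f13 a ha, ?_⟩
    unfold RedS
    rw [e33]
    exact (Red.empty R 1 R _ _ f33).congr_ker (by simp) rfl
  · rintro m hm h' ⟨m1, m2, m3⟩
    have s4 : Same [3, 6] [9, 10] [] h3' (h'.setVar 19 m) :=
      (m1.cons_setVar 19 m).of_cons (by decide)
    have e6' : (h'.setVar 19 m).var 6 = R := by rw [s4.var 6 (by decide), e6]
    obtain ⟨a1, a2⟩ := krylovStep_spec O (h := h'.setVar 19 m)
      (by rw [s4.var 3 (by decide), e3]) (x := krylov R M (fun a => (t : F) ^ a) m)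
      (fun a ha => m2 a (by rwa [e6'] at ha)) (Kr := fun g => ∀ i < m,
        dot R 1 (fun a _ => krylov R M (fun a => (t : F) ^ a) i a) g = 0) (cnt := m)
      (by rw [e6']; exact m3.congr_state rfl rfl rfl (by simp [State.setVar])) (by rwa [e6'])
    rw [e6'] at a1 a2
    refine ⟨s4.den O (by decide), fun a ha => ?_, a1.congr_ker (fun g => ?_) rfl⟩
    · rw [a2 a ha, krylov]
      refine Finset.sum_congr rfl fun b hb => ?_
      rw [s4.fld 9 (by decide), e9 a ha b (Finset.mem_range.1 hb)]
    · simp only [Nat.lt_succ_iff_lt_or_eq, or_imp, forall_and, forall_eq]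

/-- If some trial is good, then the search ends with the matrix of a good trial. -/
theorem search_spec (O : DiagOracle F) {h : State F} (h3 : h.var 3 = 1) {t₀ : ℕ}
    (ht₀ : t₀ < h.var 9) (hg : Good (h.var 6) (h.var 8) (h.fld 32) (fun a => h.nat 32 a a a)
      (fun a => h.nat 42 a a a) t₀) :
    ∃ t, Good (h.var 6) (h.var 8) (h.fld 32) (fun a => h.nat 32 a a a)
      (fun a => h.nat 42 a a a) t ∧ ∀ i < h.var 6, ∀ j < h.var 6, (search.den O h).fld 10 i j 0 =
        trialMat (h.var 6) (h.var 8) (h.fld 32) (fun a => h.nat 32 a a a)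
          (fun a => h.nat 42 a a a) t i j := by
  have main := iterate_induction (f := fun m s' => trial.den O (s'.setVar 20 m))
    (fun m h' => Same [3, 6, 8] [32] [32, 42] h h' ∧ (t₀ < m → ∃ t, Good (h.var 6) (h.var 8)
      (h.fld 32) (fun a => h.nat 32 a a a) (fun a => h.nat 42 a a a) t ∧
      ∀ i < h.var 6, ∀ j < h.var 6, h'.fld 10 i j 0 =
        trialMat (h.var 6) (h.var 8) (h.fld 32) (fun a => h.nat 32 a a a)
          (fun a => h.nat 42 a a a) t i j)) (h.var 9) (s := h) ⟨Same.refl .., fun h => by omega⟩ ?_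
  · exact main.2 ht₀
  · rintro m hm h' ⟨m1, m2⟩
    have s1 : Same [3, 6, 8] [32] [32, 42] h (h'.setVar 20 m) :=
      (m1.cons_setVar 20 m).of_cons (by decide)
    obtain ⟨a1, a2⟩ := trial_spec O (h := h'.setVar 20 m) (by rw [s1.var 3 (by decide), h3])
    rw [s1.var 6 (by decide), s1.var 8 (by decide), s1.fld 32 (by decide), s1.nat 32 (by decide),
      s1.nat 42 (by decide), show (h'.setVar 20 m).var 20 = m by simp [State.setVar]] at a1 a2
    refine ⟨s1.den O (by decide), fun ht => ?_⟩
    by_cases hgm : Good (h.var 6) (h.var 8) (h.fld 32) (fun a => h.nat 32 a a a)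
        (fun a => h.nat 42 a a a) m
    · exact ⟨m, hgm, a1 hgm⟩
    · have hne : t₀ ≠ m := fun e => hgm (e ▸ hg)
      obtain ⟨t, t1, t2⟩ := m2 (by omega)
      refine ⟨t, t1, fun i hi j hj => ?_⟩
      rw [a2 hgm]
      exact t2 i hi j hj

end Algo

/-! ### Eigenvectors, the factors of the summands, and the final check. -/

namespace Algo

open Cmd FExpr

/-- The entry `(i, j)` of the matrix `v_c` with the coordinates in column `c` of array `11`. -/
def vVal (h : State F) (c i j : ℕ) : F :=
  ∑ a ∈ Finset.range (h.var 6), h.fld 11 a c 0 * h.fld 0 i j (h.nat 30 a a a)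

theorem vVal_same {h h' : State F} (H : Same [6] [0, 11] [30] h h') (c i j : ℕ) :
    vVal h' c i j = vVal h c i j := by
  simp only [vVal, H.var 6 (by decide), H.fld 0 (by decide), H.fld 11 (by decide),
    H.nat 30 (by decide)]

theorem eval_setVar_of_wf {ℓ m : ℕ} (s : State F) (e : NExpr) (he : e.wf ℓ = true) :
    e.eval (s.setVar (lv ℓ) m) = e.eval s := by
  have hA : Agree ℓ 0 (s.setVar (lv ℓ) m) s := by
    refine ⟨fun x hx => ?_, rfl, fun _ _ => rfl⟩
    have : x ≠ lv ℓ := by simp only [lv]; omega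
    simp [State.setVar, this]
  exact NExpr.eval_congr hA e he

theorem eval_vE {ℓ : ℕ} {c i j : NExpr} (s : State F) (hc : c.wf ℓ = true) (hi : i.wf ℓ = true)
    (hj : j.wf ℓ = true) :
    (vE ℓ c i j).eval ℓ s = vVal s (c.eval s) (i.eval s) (j.eval s) := by
  simp only [vE, uE, FExpr.eval, FieldOp.apply, eval_setVar_of_wf s c hc, eval_setVar_of_wf s i hi,
    eval_setVar_of_wf s j hj, vVal]
  simp [NExpr.eval, State.setVar]

theorem oracle_spec (O : DiagOracle F) (h : State F) :
    ∀ i j : Fin (h.var 6), (oracle.den O h).fld 11 i j 0 =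
      (O (h.var 6) (h.readMatrix 10 (h.var 6))).1 i j := by
  intro i j
  simp [oracle, den, State.callOracle, State.writeVector, State.writeMatrix]

/-- The row of the augmented system that belongs to the entry `(i, j)`. -/
def augRow (n₃ : ℕ) (t v : ℕ → F) (m : ℕ) : F := if m < n₃ then t m else v (m - n₃)

/-- If `T = ∑ v_c ⊗ w_c` with independent `v_c`, then the augmented rows, which list the entries of
`T` before those of the `v_c`, span the same space as the rows `(w_c, e_c)`; reduction will recover
these. -/
theorem solveW_spec (O : DiagOracle F) {h : State F} (h3 : h.var 3 = 1)
    (h4 : h.var 4 = h.var 0 * h.var 1) (h10 : h.var 10 = h.var 2 + h.var 6)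
    (h34 : h.var 34 = 0) (hz : ∀ a j k, h.fld 34 a j k = 0)
    (hT : ∀ i j k, h.var 2 ≤ k → h.fld 0 i j k = 0) :
    RedS 34 (h.var 2 + h.var 6) 1 (h.var 4) (solveW.den O h)
      (fun g => ∀ i < h.var 0, ∀ j < h.var 1, dot (h.var 2 + h.var 6) 1
        (fun m _ => augRow (h.var 2) (h.fld 0 i j) (fun c => vVal h c i j) m) g = 0)
      (h.var 0 * (h.var 1 * 1)) := by
  refine Adds.start (Vs := [0, 1, 2, 3, 4, 6, 10]) (Fs := [0, 11]) (Ns := [30]) ?_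
    (by rw [h4, mul_one]) h34 fun a _ j _ k _ => hz a j k
  refine Adds.same_loop (by norm_num) (by decide) (by decide) fun i _ =>
    Adds.same_loop (y := 1) (by norm_num) (by decide) (by decide) fun j _ => ?_
  refine Adds.row (by norm_num) (by norm_num) (by norm_num) (by norm_num) (by norm_num)
    (by decide) (by decide) (by decide) (by decide) (by decide) (by decide) ?_ ?_ ?_ ?_ ?_
  · exact h10
  · exact h3
  · exact rfl
  · exact h3
  intro h' hh m hm k hk
  have e15 := hh.var 15 (by decide)
  have e16 := hh.var 16 (by decide)
  have e2 := hh.var 2 (by decide)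
  have e6 := hh.var 6 (by decide)
  have e0 := hh.fld 0 (by decide)
  have e11 := hh.fld 11 (by decide)
  have n30 := hh.nat 30 (by decide)
  simp [State.setVar] at e15 e16 e2 e6 e0 e11 n30
  have ev : ∀ s : State F, (vE 4 (.var (lv 3)) (.var 15) (.var 16)).eval 4 s =
      vVal s (s.var 103) (s.var 15) (s.var 16) := fun s =>
    eval_vE s (by decide) (by decide) (by decide)
  simp only [FExpr.eval, FieldOp.apply, ev]
  simp only [NExpr.eval, State.bind₃, State.setVar, lv, vVal]
  norm_num
  simp only [e15, e16, e2, e6, e0, e11, n30, augRow]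
  split_ifs with hlt
  · rw [Finset.sum_eq_zero, add_zero]
    intro c _
    rw [if_neg (by omega)]
  -- The array of `T` is zero beyond `n₃`, so the expression may add it in every column without a
  -- case distinction.
  · rw [hT i j m (by omega), zero_add, Finset.sum_eq_single (m - h.var 2)]
    · rw [if_pos (by omega)]
    · intro c _ hc
      rw [if_neg (by omega)]
    · intro hc
      exact absurd (Finset.mem_range.2 (by omega)) hc

/-- The sum is a lookup of the row with pivot `n₃ + c`; that there is exactly one such row is shown
in `solve_eq`. -/
theorem writeW_spec (O : DiagOracle F) {h : State F} (h3 : h.var 3 = 1) :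
    ∀ c < h.var 6, ∀ k < h.var 2, (writeW.den O h).fld 3 c k 0 =
      ∑ a ∈ Finset.range (h.var 4), (if h.nat 34 a a a = h.var 2 + c then 1 else 0) *
        h.fld 34 a k 0 := by
  intro c hc k hk
  rw [writeW, den, fill_set hc hk (by omega)]
  simp [FExpr.eval, NExpr.eval, State.bind₃, State.setVar, lv, FieldOp.apply]

theorem pivots_spec (O : DiagOracle F) {h : State F} (h3 : h.var 3 = 1) :
    ∀ c < h.var 6, (∃ i < h.var 0, ∃ j < h.var 1, vVal h c i j ≠ 0) →
      (pivots.den O h).nat 50 c c c < h.var 0 ∧ (pivots.den O h).nat 51 c c c < h.var 1 ∧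
      vVal h c ((pivots.den O h).nat 50 c c c) ((pivots.den O h).nat 51 c c c) ≠ 0 := by
  set body : Cmd := seq (map false 5 3 0 1 (vE 3 (.var 19) (.var (lv 1)) (.var (lv 2))))
    (seq (find 5 3 0 1) (seq (nstore 50 (.var 19) (.var 13)) (nstore 51 (.var 19) (.var 14))))
    with hbody
  refine (iterate_induction (f := fun m s' => body.den O (s'.setVar 19 m))
    (fun m h' => Same [0, 1, 3, 6] [0, 11] [30] h h' ∧ ∀ c < m,
      (∃ i < h.var 0, ∃ j < h.var 1, vVal h c i j ≠ 0) →
      h'.nat 50 c c c < h.var 0 ∧ h'.nat 51 c c c < h.var 1 ∧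
      vVal h c (h'.nat 50 c c c) (h'.nat 51 c c c) ≠ 0) (h.var 6) (s := h)
    ⟨Same.refl .., fun c hc => absurd hc (Nat.not_lt_zero c)⟩ ?_).2
  rintro m hm h' ⟨m1, m2⟩
  have s1 : Same [0, 1, 3, 6] [0, 11] [30] h (h'.setVar 19 m) :=
    (m1.cons_setVar 19 m).of_cons (by decide)
  refine ⟨s1.den O (by decide), ?_⟩
  set h1 := h'.setVar 19 m with hh1
  have e19 : h1.var 19 = m := by simp [hh1, State.setVar]
  have n1 : h1.nat = h'.nat := rfl
  rw [hbody, den_seq, den_seq]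
  set h2 := (map false 5 3 0 1 (vE 3 (.var 19) (.var (lv 1)) (.var (lv 2)))).den O h1 with hh2
  have v2 : h2.var = h1.var := rfl
  have n2 : h2.nat = h'.nat := rfl
  have f5 : ∀ i < h.var 0, ∀ j < h.var 1, h2.fld 5 0 i j = vVal h m i j := by
    intro i hi j hj
    rw [hh2, den, fill_set (by rw [s1.var 3 (by decide), h3]; exact Nat.one_pos)
      (by rwa [s1.var 0 (by decide)]) (by rwa [s1.var 1 (by decide)]),
      eval_vE _ (by decide) (by decide) (by decide)]
    simp only [NExpr.eval, State.bind₃, State.setVar, lv, vVal]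
    norm_num
    simp only [e19, s1.var 6 (by decide), s1.fld 0 (by decide), s1.fld 11 (by decide),
      s1.nat 30 (by decide)]
  have hF := find_spec O (a := 5) (y₁ := 3) (y₂ := 0) (y₃ := 1) (by norm_num) (by norm_num)
    (by norm_num) h2
  rw [v2, s1.var 3 (by decide), s1.var 0 (by decide), s1.var 1 (by decide), h3] at hF
  set h3' := (find 5 3 0 1).den O h2 with hh3
  have s3 := Same.of_den O [19] [] [50, 51] (c := find 5 3 0 1) (by decide) h2
  have e19' : h3'.var 19 = m := by rw [s3.var 19 (by decide), v2, e19]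
  have n50 : h3'.nat 50 = h'.nat 50 := by rw [s3.nat 50 (by decide), n2]
  have n51 : h3'.nat 51 = h'.nat 51 := by rw [s3.nat 51 (by decide), n2]
  have k50 : ∀ c, (den O (seq (nstore 50 (.var 19) (.var 13)) (nstore 51 (.var 19) (.var 14)))
      h3').nat 50 c c c = if c = m then h3'.var 13 else h'.nat 50 c c c := by
    intro c
    simp [den, State.setNat₁, NExpr.eval, e19', n50]
  have k51 : ∀ c, (den O (seq (nstore 50 (.var 19) (.var 13)) (nstore 51 (.var 19) (.var 14)))
      h3').nat 51 c c c = if c = m then h3'.var 14 else h'.nat 51 c c c := by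
    intro c
    simp [den, State.setNat₁, NExpr.eval, e19', n51]
  intro c hc hne
  rw [k50, k51]
  rcases Nat.lt_succ_iff_lt_or_eq.1 hc with hc | rfl
  · rw [if_neg (by omega), if_neg (by omega)]
    exact m2 c hc hne
  · rw [if_pos rfl, if_pos rfl]
    obtain ⟨i, hi, j, hj, hij⟩ := hne
    rcases hF with ⟨_, g2⟩ | ⟨_, g2, g3, _⟩
    · rw [← f5 i hi j hj, g2 0 i j ⟨Nat.one_pos, hi, hj⟩] at hij
      exact absurd rfl hij
    · have : h3'.var 12 = 0 := by omega
      rw [this, f5 _ g2.2.1 _ g2.2.2] at g3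
      exact ⟨g2.2.1, g2.2.2, g3⟩

theorem writeX_spec (O : DiagOracle F) {h : State F} (h3 : h.var 3 = 1) :
    ∀ c < h.var 6, ∀ i < h.var 0, (writeX.den O h).fld 1 c i 0 =
      vVal h c i (h.nat 51 c c c) := by
  intro c hc i hi
  rw [writeX, den, fill_set hc hi (by omega), eval_vE _ (by decide) (by decide) (by decide)]
  simp [NExpr.eval, State.bind₃, State.setVar, lv, vVal]

theorem writeY_spec (O : DiagOracle F) {h : State F} (h3 : h.var 3 = 1) :
    ∀ c < h.var 6, ∀ j < h.var 1, (writeY.den O h).fld 2 c j 0 =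
      vVal h c (h.nat 50 c c c) j / vVal h c (h.nat 50 c c c) (h.nat 51 c c c) := by
  intro c hc j hj
  rw [writeY, den, fill_set hc hj (by omega)]
  rw [FExpr.eval, eval_vE _ (by decide) (by decide) (by decide),
    eval_vE _ (by decide) (by decide) (by decide)]
  simp [NExpr.eval, State.bind₃, State.setVar, lv, vVal, FieldOp.apply]

theorem verify_spec (O : DiagOracle F) (h : State F) :
    (verify.den O h).var 41 = 0 ↔ ∀ i < h.var 0, ∀ j < h.var 1, ∀ k < h.var 2,
      h.fld 0 i j k = ∑ c ∈ Finset.range (h.var 6), h.fld 1 c i 0 * h.fld 2 c j 0 * h.fld 3 c k 0 := by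
  set P : ℕ → ℕ → ℕ → Prop := fun i j k => h.fld 0 i j k =
    ∑ c ∈ Finset.range (h.var 6), h.fld 1 c i 0 * h.fld 2 c j 0 * h.fld 3 c k 0 with hP
  set body : Cmd := ifZero (.op .sub (.cell 0 (.var 15) (.var 16) (.var 17))
      (.sum 6 (.op .mul (.op .mul (.cell 1 (.var (lv 0)) (.var 15) (.const 0))
        (.cell 2 (.var (lv 0)) (.var 16) (.const 0)))
        (.cell 3 (.var (lv 0)) (.var 17) (.const 0))))) skip (nset 41 (.const 1)) with hbody
  have step : ∀ s : State F, Same [6] [0, 1, 2, 3] [] h s → ((body.den O s).var 41 = 0 ↔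
      s.var 41 = 0 ∧ P (s.var 15) (s.var 16) (s.var 17)) := by
    intro s hs
    have e6 := hs.var 6 (by decide)
    rw [hbody, den]
    have ev : (FExpr.op .sub (.cell 0 (.var 15) (.var 16) (.var 17))
      (.sum 6 (.op .mul (.op .mul (.cell 1 (.var (lv 0)) (.var 15) (.const 0))
        (.cell 2 (.var (lv 0)) (.var 16) (.const 0)))
        (.cell 3 (.var (lv 0)) (.var 17) (.const 0))))).eval 0 s = 0 ↔
        P (s.var 15) (s.var 16) (s.var 17) := by
      simp only [FExpr.eval, NExpr.eval, FieldOp.apply, State.setVar, lv]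
      norm_num
      rw [sub_eq_zero, e6, hs.fld 0 (by decide), hs.fld 1 (by decide), hs.fld 2 (by decide),
        hs.fld 3 (by decide)]
    by_cases hp : P (s.var 15) (s.var 16) (s.var 17)
    · rw [if_pos (ev.2 hp), den]
      exact ⟨fun h => ⟨h, hp⟩, fun h => h.1⟩
    · rw [if_neg (fun h => hp (ev.1 h)), den]
      simp [State.setVar, NExpr.eval, hp]
  set s0 := (nset 41 (.const 0)).den O h with hs0
  have S0 : Same [0, 1, 2, 6] [0, 1, 2, 3] [] h s0 := Same.of_den O _ _ _ (by decide) h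
  have e41 : s0.var 41 = 0 := by simp [hs0, den, State.setVar, NExpr.eval]
  have vs : ∀ (s : State F) (x m : ℕ), (s.setVar x m).var x = m := by
    intro s x m; simp [State.setVar]
  have vs' : ∀ (s : State F) (x m y : ℕ), y ≠ x → (s.setVar x m).var y = s.var y := by
    intro s x m y hy; simp [State.setVar, hy]
  rw [verify, den_seq, ← hs0, den, S0.var 0 (by decide)]
  refine (iterate_induction (f := fun m s' => (loop 16 1 (loop 17 2 body)).den O (s'.setVar 15 m))
    (fun m s => Same [0, 1, 2, 6] [0, 1, 2, 3] [] h s ∧ (s.var 41 = 0 ↔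
      ∀ i < m, ∀ j < h.var 1, ∀ k < h.var 2, P i j k)) (h.var 0) (s := s0) ?_ ?_).2
  · exact ⟨S0, by simp [e41]⟩
  rintro i hi s ⟨S, hs⟩
  have S1 : Same [0, 1, 2, 6] [0, 1, 2, 3] [] h (s.setVar 15 i) :=
    (S.cons_setVar 15 i).of_cons (by decide)
  refine ⟨S1.den O (by decide), ?_⟩
  rw [den, S1.var 1 (by decide)]
  have := iterate_induction (f := fun m s' => (loop 17 2 body).den O (s'.setVar 16 m))
    (fun m t => Same [0, 1, 2, 6] [0, 1, 2, 3] [] h t ∧ t.var 15 = i ∧ (t.var 41 = 0 ↔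
      s.var 41 = 0 ∧ ∀ j < m, ∀ k < h.var 2, P i j k)) (h.var 1) (s := s.setVar 15 i) ?_ ?_
  · rw [this.2.2, hs]
    simp only [Nat.lt_succ_iff_lt_or_eq, or_imp, forall_and, forall_eq]
  · exact ⟨S1, vs .., by simp [vs' s 15 i 41 (by norm_num)]⟩
  rintro j hj t ⟨S, h15, ht⟩
  have S1 : Same [0, 1, 2, 6] [0, 1, 2, 3] [] h (t.setVar 16 j) :=
    (S.cons_setVar 16 j).of_cons (by decide)
  have h15' : (t.setVar 16 j).var 15 = i := by rw [vs' _ _ _ _ (by norm_num), h15]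
  refine ⟨S1.den O (by decide), by rw [var_den O _ (by decide), h15'], ?_⟩
  rw [den, S1.var 2 (by decide)]
  have := iterate_induction (f := fun m s' => body.den O (s'.setVar 17 m))
    (fun m r => Same [0, 1, 2, 6] [0, 1, 2, 3] [] h r ∧ r.var 15 = i ∧ r.var 16 = j ∧
      (r.var 41 = 0 ↔ t.var 41 = 0 ∧ ∀ k < m, P i j k)) (h.var 2) (s := t.setVar 16 j) ?_ ?_
  · rw [this.2.2.2, ht]
    simp only [Nat.lt_succ_iff_lt_or_eq, or_imp, forall_and, forall_eq, and_assoc]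
  · exact ⟨S1, h15', vs .., by simp [vs' t 16 j 41 (by norm_num)]⟩
  rintro k hk r ⟨S, h15, h16, hr⟩
  have S1 : Same [0, 1, 2, 6] [0, 1, 2, 3] [] h (r.setVar 17 k) :=
    (S.cons_setVar 17 k).of_cons (by decide)
  refine ⟨S1.den O (by decide), ?_, ?_, ?_⟩
  · rw [var_den O _ (by decide), vs' _ _ _ _ (by norm_num), h15]
  · rw [var_den O _ (by decide), vs' _ _ _ _ (by norm_num), h16]
  · rw [step _ ⟨fun x hx => S1.var x (by simp at hx; simp [hx]), S1.fld, fun x hx => by simp at hx⟩,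
      vs, vs' _ _ _ _ (by norm_num), vs' _ _ _ _ (by norm_num), vs' _ _ _ _ (by norm_num), h15, h16,
      hr]
    simp only [Nat.lt_succ_iff_lt_or_eq, or_imp, forall_and, forall_eq, and_assoc]

/-- With `r` reduced minors in the variable `31`, the equation `2 r + R = R²` expresses `r = R (R -
1) / 2` without division. -/
theorem finish_spec (O : DiagOracle F) (h : State F) :
    ((finish.den O h).var 0 ≠ 0 ↔ h.var 41 = 0 ∧ h.var 31 + h.var 31 + h.var 6 = h.var 7) ∧
    ((finish.den O h).var 0 ≠ 0 → (finish.den O h).var 1 = h.var 6) := by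
  simp only [finish, den, State.setVar, NExpr.eval]
  norm_num
  constructor
  · split_ifs <;> simp_all <;> omega
  · split_ifs <;> simp_all

end Algo

end

end TensorDecomp

namespace TensorDecomp

noncomputable section

set_option linter.unusedSectionVars false

variable {F : Type*} [Field F] {n₁ n₂ n₃ : ℕ}

/-! ## The certificate in terms of minors -/

theorem map₂_eq_span_pairs {V W ι : Type*} [AddCommGroup V] [Module F V] [AddCommGroup W]
    [Module F W] (β : V →ₗ[F] V →ₗ[F] W) (v : ι → V) :
    Submodule.map₂ β (Submodule.span F (Set.range v)) (Submodule.span F (Set.range v)) =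
      Submodule.span F (Set.range fun q : ι × ι => β (v q.1) (v q.2)) := by
  rw [Submodule.map₂_span_span]
  congr 1
  ext w
  simp

/-- The pairs `(a, b)` with `a < b`. -/
abbrev Pairs (R : ℕ) := {q : Fin R × Fin R // q.1 < q.2}

/-- Separates mixed products from squares; of `g` only the symmetric part matters. -/
theorem sum_symmetric {R : ℕ} {W : Type*} [AddCommGroup W] [Module F W] (g : Fin R → Fin R → F)
    (f : Fin R → Fin R → W) (hf : ∀ a b, f a b = f b a) :
    ∑ a, ∑ b, g a b • f a b = ∑ q : Pairs R, (g q.1.1 q.1.2 + g q.1.2 q.1.1) • f q.1.1 q.1.2 +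
      ∑ a, g a a • f a a := by
  have hs : ∀ p : Fin R → Fin R → W, ∑ q : Pairs R, p q.1.1 q.1.2 =
      ∑ a, ∑ b, if a < b then p a b else 0 := by
    intro p
    rw [← Fintype.sum_prod_type' fun a b => if a < b then p a b else 0, ← Finset.sum_filter,
      ← Finset.sum_subtype (Finset.univ.filter fun q : Fin R × Fin R => q.1 < q.2) (by simp)
        (fun q : Fin R × Fin R => p q.1 q.2)]
  simp only [add_smul, Finset.sum_add_distrib]
  rw [hs fun a b => g a b • f a b, hs fun a b => g b a • f a b]
  rw [Finset.sum_comm (f := fun a b => if a < b then g b a • f a b else 0)]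
  have hd : ∑ a, g a a • f a a = ∑ a, ∑ b, if a = b then g a b • f a b else 0 := by simp
  rw [hd, ← Finset.sum_add_distrib, ← Finset.sum_add_distrib]
  refine Finset.sum_congr rfl fun a _ => ?_
  rw [← Finset.sum_add_distrib, ← Finset.sum_add_distrib]
  refine Finset.sum_congr rfl fun b _ => ?_
  rcases lt_trichotomy a b with h | h | h
  · simp [h, h.ne, not_lt.2 h.le]
  · simp [h]
  · simp [h, h.ne', not_lt.2 h.le, hf a b]

theorem card_pairs (R : ℕ) : 2 * Fintype.card (Pairs R) + R = R ^ 2 := by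
  have e : Fintype.card (Pairs R) = ∑ a : Fin R, (a : ℕ) := by
    rw [Fintype.card_subtype, Finset.card_filter, Fintype.sum_prod_type_right]
    refine Finset.sum_congr rfl fun b _ => ?_
    rw [← Finset.card_filter]
    rw [← Fin.card_Iio b]
    congr 1
    ext a
    simp
  rw [e, Fin.sum_univ_eq_sum_range (fun i => i) R]
  have := Finset.sum_range_id_mul_two R
  rcases R with _ | R
  · simp
  · rw [Nat.add_sub_cancel] at this
    rw [mul_comm, this]
    ring

/-- The symmetrization `u ⊗ u' + u' ⊗ u`. -/
def symMap (F : Type*) [Field F] (n₁ n₂ : ℕ) :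
    Mat F n₁ n₂ →ₗ[F] Mat F n₁ n₂ →ₗ[F] MatSq F n₁ n₂ :=
  LinearMap.mk₂ F (fun u u' α β => u α * u' β + u' α * u β)
    (by intros; funext α β; simp; ring) (by intros; funext α β; simp; ring)
    (by intros; funext α β; simp; ring) (by intros; funext α β; simp; ring)

/-- The pairing of the minors with symmetric tensors. -/
def minorMap (F : Type*) [Field F] (n₁ n₂ : ℕ) :
    MatSq F n₁ n₂ →ₗ[F] (Fin n₁ × Fin n₁ × Fin n₂ × Fin n₂ → F) where
  toFun M q := M (q.1, q.2.2.1) (q.2.1, q.2.2.2) - M (q.1, q.2.2.2) (q.2.1, q.2.2.1)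
  map_add' M N := by funext q; simp; ring
  map_smul' c M := by funext q; simp; ring

/-- The pairing of the minors with `u ⊗ u' + u' ⊗ u`. -/
def minorPair (F : Type*) [Field F] (n₁ n₂ : ℕ) :
    Mat F n₁ n₂ →ₗ[F] Mat F n₁ n₂ →ₗ[F] (Fin n₁ × Fin n₁ × Fin n₂ × Fin n₂ → F) :=
  (symMap F n₁ n₂).compr₂ (minorMap F n₁ n₂)

theorem symMap_apply (u u' : Mat F n₁ n₂) :
    symMap F n₁ n₂ u u' = fun α β => u α * u' β + u' α * u β := rfl

theorem minorPair_apply (u u' : Mat F n₁ n₂) (i i' : Fin n₁) (j j' : Fin n₂) :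
    minorPair F n₁ n₂ u u' (i, i', j, j') = u (i, j) * u' (i', j') + u' (i, j) * u (i', j') -
      (u (i, j') * u' (i', j) + u' (i, j') * u (i', j)) := rfl

theorem symMap_comm (u u' : Mat F n₁ n₂) : symMap F n₁ n₂ u u' = symMap F n₁ n₂ u' u := by
  funext α β
  simp only [symMap_apply]
  ring

theorem minorPair_comm (u u' : Mat F n₁ n₂) : minorPair F n₁ n₂ u u' = minorPair F n₁ n₂ u' u := by
  simp only [minorPair, LinearMap.compr₂_apply, symMap_comm u u']

theorem minorPair_self (x : Fin n₁ → F) (y : Fin n₂ → F) :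
    minorPair F n₁ n₂ (tmul₂ x y) (tmul₂ x y) = 0 := by
  funext ⟨i, i', j, j'⟩
  simp only [minorPair_apply, tmul₂, Pi.zero_apply]
  ring

/-- The minors separate the products of different matrices `v a`. -/
def MinorIndependent {R : ℕ} (v : Fin R → Mat F n₁ n₂) : Prop :=
  LinearIndependent F fun q : Pairs R => minorPair F n₁ n₂ (v q.1.1) (v q.1.2)

theorem MinorIndependent.eq_zero {R : ℕ} {v : Fin R → Mat F n₁ n₂} (h : MinorIndependent v)
    (hv : ∀ a, v a ∈ rankOneVariety F n₁ n₂) {g : Fin R → Fin R → F}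
    (hg : ∑ a, ∑ b, g a b • minorPair F n₁ n₂ (v a) (v b) = 0) (q : Pairs R) :
    g q.1.1 q.1.2 + g q.1.2 q.1.1 = 0 := by
  rw [sum_symmetric g _ fun a b => minorPair_comm _ _,
    Finset.sum_eq_zero (s := Finset.univ) (f := fun a => g a a • _), add_zero] at hg
  · exact Fintype.linearIndependent_iff.1 h _ hg q
  · intro a _
    obtain ⟨x, y, hxy⟩ := hv a
    rw [hxy, minorPair_self, smul_zero]

/-- Minor independence is a condition on the span of the matrices. -/
theorem minorIndependent_iff {R : ℕ} {v : Fin R → Mat F n₁ n₂}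
    (hv : ∀ a, v a ∈ rankOneVariety F n₁ n₂) :
    MinorIndependent v ↔ 2 * Module.finrank F (Submodule.map₂ (minorPair F n₁ n₂)
      (Submodule.span F (Set.range v)) (Submodule.span F (Set.range v))) + R = R ^ 2 := by
  -- The minors kill the squares and `minorPair` is symmetric, so the pairs `a < b` already
  -- generate. Their number `R (R - 1) / 2` is then the rank exactly in the independent case.
  have e : Submodule.map₂ (minorPair F n₁ n₂)
      (Submodule.span F (Set.range v)) (Submodule.span F (Set.range v)) =
      Submodule.span F (Set.range fun q : Pairs R =>
        minorPair F n₁ n₂ (v q.1.1) (v q.1.2)) := by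
    rw [map₂_eq_span_pairs]
    apply le_antisymm
    · rw [Submodule.span_le]
      rintro _ ⟨⟨a, b⟩, rfl⟩
      rcases lt_trichotomy a b with h | h | h
      · exact Submodule.subset_span ⟨⟨(a, b), h⟩, rfl⟩
      · obtain ⟨x, y, hxy⟩ := hv b
        simp only [h, hxy, minorPair_self]
        exact Submodule.zero_mem _
      · simp only
        rw [minorPair_comm]
        exact Submodule.subset_span ⟨⟨(b, a), h⟩, rfl⟩
    · refine Submodule.span_mono ?_
      rintro _ ⟨q, rfl⟩
      exact ⟨q.1, rfl⟩
  rw [MinorIndependent, linearIndependent_iff_card_eq_finrank_span, e, Set.finrank]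
  have := card_pairs R
  omega

theorem symSq_eq (U : Submodule F (Mat F n₁ n₂)) :
    symSq U = Submodule.map₂ (symMap F n₁ n₂) U U := by
  rw [Submodule.map₂_eq_span_image2, symSq]
  congr 1
  ext M
  simp only [Set.mem_ofPred_eq, Set.mem_image2, SetLike.mem_coe]
  constructor
  · rintro ⟨u, hu, u', hu', rfl⟩
    exact ⟨u, hu, u', hu', rfl⟩
  · rintro ⟨u, hu, u', hu', rfl⟩
    exact ⟨u, hu, u', hu', rfl⟩

theorem sq_mem_minorsAnnihilator {v : Mat F n₁ n₂} (hv : v ∈ rankOneVariety F n₁ n₂) :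
    (fun α β => v α * v β) ∈ minorsAnnihilator F n₁ n₂ := by
  obtain ⟨x, y, rfl⟩ := hv
  refine ⟨fun α β => mul_comm _ _, fun i i' j j' => ?_⟩
  simp only [tmul₂]
  ring

theorem sq_mem_symSq (h2 : (2 : F) ≠ 0) {U : Submodule F (Mat F n₁ n₂)} {v : Mat F n₁ n₂}
    (hv : v ∈ U) : (fun α β => v α * v β) ∈ symSq U := by
  have : (fun α β => v α * v β) = (2⁻¹ : F) • fun α β => v α * v β + v α * v β := by
    funext α β
    simp only [Pi.smul_apply, smul_eq_mul]
    field_simp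
    ring
  rw [this]
  exact Submodule.smul_mem _ _ (Submodule.subset_span ⟨v, hv, v, hv, rfl⟩)

/-- Expand an element of `S²(U)` in products of the `v a`. The minors kill its squares, so if they
kill the element, independence on the mixed products removes these, and only squares remain. -/
theorem symSq_inf_minorsAnnihilator (h2 : (2 : F) ≠ 0) {R : ℕ} {v : Fin R → Mat F n₁ n₂}
    (hv : ∀ a, v a ∈ rankOneVariety F n₁ n₂) (h : MinorIndependent v) :
    symSq (Submodule.span F (Set.range v)) ⊓ minorsAnnihilator F n₁ n₂ =
      Submodule.span F (Set.range fun a : Fin R => fun α β => v a α * v a β) := by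
  apply le_antisymm
  · rintro M ⟨hM, hM'⟩
    rw [SetLike.mem_coe, symSq_eq, map₂_eq_span_pairs, Submodule.mem_span_range_iff_exists_fun] at hM
    obtain ⟨g, rfl⟩ := hM
    rw [Fintype.sum_prod_type] at hM' ⊢
    have h0 : ∑ a, ∑ b, g (a, b) • minorPair F n₁ n₂ (v a) (v b) = 0 := by
      have e : minorMap F n₁ n₂ (∑ a, ∑ b, g (a, b) • symMap F n₁ n₂ (v a) (v b)) = 0 := by
        funext ⟨i, i', j, j'⟩
        exact hM'.2 i i' j j'
      rw [← e]
      simp only [map_sum, map_smul]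
      rfl
    rw [sum_symmetric (fun a b => g (a, b)) _ fun a b => symMap_comm _ _,
      Finset.sum_eq_zero, zero_add]
    · refine Submodule.sum_mem _ fun a _ => Submodule.smul_mem _ _ ?_
      have : symMap F n₁ n₂ (v a) (v a) = (2 : F) • fun α β => v a α * v a β := by
        funext α β
        simp only [symMap_apply, Pi.smul_apply, smul_eq_mul]
        ring
      rw [this]
      exact Submodule.smul_mem _ _ (Submodule.subset_span ⟨a, rfl⟩)
    · intro q _
      rw [h.eq_zero hv h0 q, zero_smul]
  · rw [Submodule.span_le]
    rintro _ ⟨a, rfl⟩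
    exact ⟨sq_mem_symSq h2 (Submodule.subset_span ⟨a, rfl⟩), sq_mem_minorsAnnihilator (hv a)⟩

/-! ## Decompositions and slices -/

/-- The slice `T(·, ·, k)`. -/
def slice (T : Tensor F n₁ n₂ n₃) (k : Fin n₃) : Mat F n₁ n₂ := fun q => T q.1 q.2 k

theorem slice_sum {R : ℕ} (v : Fin R → Mat F n₁ n₂) (w : Fin R → Fin n₃ → F) (k : Fin n₃) :
    slice (∑ a, tmulMat (v a) (w a)) k = ∑ a, w a k • v a := by
  funext q
  simp [slice, tmulMat, Finset.sum_apply, mul_comm]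

theorem sliceSpan_le {R : ℕ} (v : Fin R → Mat F n₁ n₂) (w : Fin R → Fin n₃ → F) :
    sliceSpan (∑ a, tmulMat (v a) (w a)) ≤ Submodule.span F (Set.range v) := by
  rw [sliceSpan, Submodule.span_le]
  rintro _ ⟨k, rfl⟩
  have : (fun q : Fin n₁ × Fin n₂ => (∑ a, tmulMat (v a) (w a)) q.1 q.2 k) = ∑ a, w a k • v a :=
    slice_sum v w k
  change (fun q : Fin n₁ × Fin n₂ => (∑ a, tmulMat (v a) (w a)) q.1 q.2 k) ∈ _
  rw [this]
  exact Submodule.sum_mem _ fun a _ => Submodule.smul_mem _ _ (Submodule.subset_span ⟨a, rfl⟩)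

theorem finrank_sliceSpan_le {R : ℕ} (v : Fin R → Mat F n₁ n₂) (w : Fin R → Fin n₃ → F) :
    Module.finrank F (sliceSpan (∑ a, tmulMat (v a) (w a))) ≤ R :=
  (Submodule.finrank_mono (sliceSpan_le v w)).trans (by
    simpa [Set.finrank] using finrank_range_le_card (R := F) v)

/-- If there are as many summands as the slices have dimensions, then the factors are independent. -/
theorem independent_of_finrank {R : ℕ} {v : Fin R → Mat F n₁ n₂} {w : Fin R → Fin n₃ → F}
    (h : Module.finrank F (sliceSpan (∑ a, tmulMat (v a) (w a))) = R) :
    sliceSpan (∑ a, tmulMat (v a) (w a)) = Submodule.span F (Set.range v) ∧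
      LinearIndependent F v ∧ LinearIndependent F w := by
  have hle : Module.finrank F (Submodule.span F (Set.range v)) ≤ R := by
    simpa [Set.finrank] using finrank_range_le_card (R := F) v
  have hs : sliceSpan (∑ a, tmulMat (v a) (w a)) = Submodule.span F (Set.range v) :=
    Submodule.eq_of_le_of_finrank_le (sliceSpan_le v w) (by rw [h]; exact hle)
  have hv : LinearIndependent F v := by
    rw [linearIndependent_iff_card_eq_finrank_span, Set.finrank, ← hs, h, Fintype.card_fin]
  refine ⟨hs, hv, ?_⟩
  rw [Fintype.linearIndependent_iff] at hv ⊢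
  intro g hg a
  have ha : v a ∈ sliceSpan (∑ a, tmulMat (v a) (w a)) := by
    rw [hs]; exact Submodule.subset_span ⟨a, rfl⟩
  rw [sliceSpan, Submodule.mem_span_range_iff_exists_fun] at ha
  obtain ⟨c, hc⟩ := ha
  have hc' : ∑ b, (∑ k, c k * w b k) • v b = v a := by
    rw [← hc]
    simp only [Finset.sum_smul, mul_smul]
    rw [Finset.sum_comm]
    refine Finset.sum_congr rfl fun k _ => ?_
    rw [← Finset.smul_sum, ← slice_sum v w k]
    rfl
  -- The coefficients `c` that combine the slices to `v a` form a functional with value `1` on `w a`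
  -- and `0` on the other `w b`. Such functionals, one for each `a`, show that the `w b` are
  -- independent.
  have hd : ∀ b, ∑ k, c k * w b k = if b = a then 1 else 0 := by
    intro b
    have := hv (fun b => ∑ k, c k * w b k - if b = a then 1 else 0) (by
      simp only [sub_smul, Finset.sum_sub_distrib, hc', ite_smul, one_smul, zero_smul]
      simp) b
    exact sub_eq_zero.1 this
  have : ∑ b, g b * ∑ k, c k * w b k = 0 := by
    simp only [Finset.mul_sum]
    rw [Finset.sum_comm]
    refine Finset.sum_eq_zero fun k _ => ?_
    have := congrFun hg k
    simp only [Finset.sum_apply, Pi.smul_apply, smul_eq_mul, Pi.zero_apply] at this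
    calc _ = c k * ∑ b, g b * w b k := by
          rw [Finset.mul_sum]; exact Finset.sum_congr rfl fun _ _ => by ring
      _ = 0 := by rw [this, mul_zero]
  simpa [hd] using this

/-- The slices span the span of the `v a` if both factors are independent. -/
theorem finrank_of_independent {R : ℕ} {v : Fin R → Mat F n₁ n₂} {w : Fin R → Fin n₃ → F}
    (hv : LinearIndependent F v) (hw : LinearIndependent F w) :
    Module.finrank F (sliceSpan (∑ a, tmulMat (v a) (w a))) = R := by
  -- Functionals dual to the `w a`: contracting the tensor with `f b` returns `v b`.
  obtain ⟨f, hf⟩ : ∃ f : Fin R → (Fin n₃ → F), ∀ a b, ∑ k, w a k * f b k = if a = b then 1 else 0 := by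
    have h1 : Module.finrank F (Submodule.span F (Set.range w)) = R := by
      have := linearIndependent_iff_card_eq_finrank_span.1 hw
      rw [Set.finrank, Fintype.card_fin] at this
      exact this.symm
    let W : Matrix (Fin R) (Fin n₃) F := Matrix.of w
    have hr : W.rank = R := by
      rw [Matrix.rank_eq_finrank_span_row]
      exact h1
    have hsur : LinearMap.range W.mulVecLin = ⊤ := by
      apply Submodule.eq_top_of_finrank_eq
      rw [Module.finrank_fin_fun]
      exact hr
    have : ∀ b : Fin R, ∃ f : Fin n₃ → F, W.mulVecLin f = Pi.single b 1 := fun b =>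
      LinearMap.range_eq_top.1 hsur _
    choose f hf using this
    refine ⟨f, fun a b => ?_⟩
    have := congrFun (hf b) a
    simp only [Matrix.mulVecLin_apply, Matrix.mulVec, dotProduct, W, Matrix.of_apply] at this
    rw [this, Pi.single_apply]
  have hs : sliceSpan (∑ a, tmulMat (v a) (w a)) = Submodule.span F (Set.range v) := by
    refine le_antisymm (sliceSpan_le v w) ?_
    rw [Submodule.span_le]
    rintro _ ⟨b, rfl⟩
    rw [SetLike.mem_coe, sliceSpan, Submodule.mem_span_range_iff_exists_fun]
    refine ⟨f b, ?_⟩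
    have e : ∀ k, (fun q : Fin n₁ × Fin n₂ => (∑ a, tmulMat (v a) (w a)) q.1 q.2 k) =
      ∑ a, w a k • v a := slice_sum v w
    simp only [e, Finset.smul_sum]
    rw [Finset.sum_comm]
    simp only [smul_smul, ← Finset.sum_smul]
    have : ∀ a, ∑ k, f b k * w a k = if a = b then 1 else 0 := fun a => by
      rw [← hf]; exact Finset.sum_congr rfl fun _ _ => mul_comm _ _
    simp [this]
  rw [hs]
  have := linearIndependent_iff_card_eq_finrank_span.1 hv
  rw [Set.finrank, Fintype.card_fin] at this
  exact this.symm

theorem IsDecomposition.exists_eq {T : Tensor F n₁ n₂ n₃} {R : ℕ} {t : Fin R → Tensor F n₁ n₂ n₃}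
    (h : IsDecomposition T t) : ∃ (v : Fin R → Mat F n₁ n₂) (w : Fin R → Fin n₃ → F),
      (∀ a, v a ∈ rankOneVariety F n₁ n₂) ∧ (∀ a, t a = tmulMat (v a) (w a)) ∧
      T = ∑ a, tmulMat (v a) (w a) := by
  obtain ⟨h1, h2⟩ := h
  choose x y w hxy using h1
  refine ⟨fun a => tmul₂ (x a) (y a), w, fun a => ⟨x a, y a, rfl⟩, hxy, ?_⟩
  rw [h2]
  exact Finset.sum_congr rfl fun a _ => hxy a

/-- The certificate implies that the decomposition is the unique rank decomposition. -/
theorem IsCertified.unique (h2 : (2 : F) ≠ 0) {T : Tensor F n₁ n₂ n₃} {R : ℕ}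
    {v : Fin R → Mat F n₁ n₂} {w : Fin R → Fin n₃ → F} (h : IsCertified T v w)
    (hr : ∀ a, v a ∈ rankOneVariety F n₁ n₂) :
    IsUniqueRankDecomposition T fun a => tmulMat (v a) (w a) := by
  obtain ⟨hT, hv, hw, hc⟩ := h
  have hfin := finrank_of_independent hv hw
  rw [← hT] at hfin
  have hsp : sliceSpan T = Submodule.span F (Set.range v) := by
    have := (independent_of_finrank (v := v) (w := w) (by rw [← hT]; exact hfin)).1
    rwa [← hT] at this
  have hdec : IsDecomposition T fun a => tmulMat (v a) (w a) := by
    refine ⟨fun a => ?_, hT⟩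
    obtain ⟨x, y, hxy⟩ := hr a
    exact ⟨x, y, w a, by simp only [hxy]; rfl⟩
  -- The slices of a sum of `R'` product tensors span at most `R'` dimensions, while here they span
  -- `R`.
  have hrank : R = tensorRank T := by
    refine le_antisymm (le_csInf ⟨R, _, hdec⟩ ?_) (Nat.sInf_le ⟨_, hdec⟩)
    rintro R' ⟨t, ht⟩
    obtain ⟨v', w', -, -, h3⟩ := ht.exists_eq
    rw [← hfin, h3]
    exact finrank_sliceSpan_le v' w'
  refine ⟨⟨hdec, hrank⟩, fun t' ht' => ?_⟩
  obtain ⟨v', w', hr', ht'', hT'⟩ := ht'.1.exists_eq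
  -- A competing decomposition of the same length also consists of a basis of the span of the
  -- slices.
  obtain ⟨hs', hv', hw'⟩ := independent_of_finrank (v := v') (w := w')
    (by rw [← hT']; exact hfin)
  rw [← hT'] at hs'
  have hmem : ∀ a, v' a ∈ sliceSpan T := fun a => by
    rw [hs']; exact Submodule.subset_span ⟨a, rfl⟩
  -- Write `v' a = ∑ c b • v b` and its square as `∑ d b • v b ⊗ v b`. Comparing the coefficients of
  -- the independent `v b` in one tensor factor gives `c b • v' a = d b • v b` for every `b`, and
  -- some `c b` is nonzero.
  have key : ∀ a, ∃ b, ∃ l : F, v' a = l • v b := by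
    intro a
    have h3 : (fun α β => v' a α * v' a β) ∈ symSq (sliceSpan T) ⊓ minorsAnnihilator F n₁ n₂ :=
      ⟨sq_mem_symSq h2 (hmem a), sq_mem_minorsAnnihilator (hr' a)⟩
    rw [hc, Submodule.mem_span_range_iff_exists_fun] at h3
    obtain ⟨d, hd⟩ := h3
    have h4 := hmem a
    rw [hsp, Submodule.mem_span_range_iff_exists_fun] at h4
    obtain ⟨c, hc'⟩ := h4
    have h5 : ∀ β b, c b * v' a β = d b * v b β := by
      intro β b
      refine sub_eq_zero.1 (Fintype.linearIndependent_iff.1 hv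
        (fun b => c b * v' a β - d b * v b β) ?_ b)
      funext α
      have e1 := congrFun (congrFun hd α) β
      have e2 := congrFun hc' α
      simp only [Finset.sum_apply, Pi.smul_apply, smul_eq_mul, Pi.zero_apply] at e1 e2 ⊢
      simp only [sub_mul, Finset.sum_sub_distrib]
      have e3 : ∑ b, d b * v b β * v b α = v' a α * v' a β := by
        rw [← e1]; exact Finset.sum_congr rfl fun _ _ => by ring
      have e4 : ∑ b, c b * v' a β * v b α = v' a α * v' a β := by
        rw [← congrArg (· * v' a β) e2]
        simp only [Finset.sum_mul]
        exact Finset.sum_congr rfl fun _ _ => by ring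
      rw [e3, e4, sub_self]
    obtain ⟨b, hb⟩ : ∃ b, c b ≠ 0 := by
      by_contra hne
      push Not at hne
      refine hv'.ne_zero a ?_
      rw [← hc']
      simp [hne]
    refine ⟨b, d b / c b, ?_⟩
    funext β
    have := h5 β b
    rw [Pi.smul_apply, smul_eq_mul]
    field_simp
    linear_combination this
  choose σ l hl using key
  have hl0 : ∀ a, l a ≠ 0 := fun a ha => hv'.ne_zero a (by rw [hl, ha, zero_smul])
  -- Two of the independent matrices `v' a` cannot be multiples of the same `v b`.
  have hinj : Function.Injective σ := by
    intro a b hab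
    by_contra hne
    have h3 : l b • v' a - l a • v' b = 0 := by
      rw [hl a, hl b, hab, smul_smul, smul_smul, mul_comm, sub_self]
    have h4 := Fintype.linearIndependent_iff.1 hv'
      (fun e => (if e = a then l b else 0) - (if e = b then l a else 0)) (by
        simpa [sub_smul, Finset.sum_sub_distrib] using h3) a
    simp only [if_true, if_neg hne, sub_zero] at h4
    exact hl0 b h4
  let τ : Equiv.Perm (Fin R) := Equiv.ofBijective σ (Finite.injective_iff_bijective.1 hinj)
  refine ⟨τ, fun a => ?_⟩
  -- Both decompositions now express each slice in the basis `v`, so the coefficients agree.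
  have hw2 : ∀ a, l a • w' a = w (τ a) := by
    intro a
    funext k
    have e : ∑ b, (w b k - l (τ.symm b) * w' (τ.symm b) k) • v b = 0 := by
      simp only [sub_smul, Finset.sum_sub_distrib]
      rw [← slice_sum v w k, ← hT, hT', slice_sum v' w' k, sub_eq_zero,
        ← Equiv.sum_comp τ (fun b => (l (τ.symm b) * w' (τ.symm b) k) • v b)]
      refine Finset.sum_congr rfl fun a _ => ?_
      rw [τ.symm_apply_apply, hl a, smul_smul, mul_comm]
      rfl
    have := Fintype.linearIndependent_iff.1 hv _ e (τ a)
    rw [τ.symm_apply_apply] at this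
    simp only [Pi.smul_apply, smul_eq_mul]
    exact (sub_eq_zero.1 this).symm
  simp only
  rw [ht'' a, ← hw2 a, hl a]
  funext i j k
  simp only [tmulMat, Pi.smul_apply, smul_eq_mul, show τ a = σ a from rfl]
  ring

/-- Independence of the factors and of the minors gives the certificate. -/
theorem isCertified_of_independent (h2 : (2 : F) ≠ 0) {T : Tensor F n₁ n₂ n₃} {R : ℕ}
    {v : Fin R → Mat F n₁ n₂} {w : Fin R → Fin n₃ → F} (hT : T = ∑ a, tmulMat (v a) (w a))
    (hr : ∀ a, v a ∈ rankOneVariety F n₁ n₂) (hv : LinearIndependent F v)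
    (hw : LinearIndependent F w) (hm : MinorIndependent v) : IsCertified T v w := by
  refine ⟨hT, hv, hw, ?_⟩
  have := (independent_of_finrank (finrank_of_independent hv hw)).1
  rw [← hT] at this
  rw [this]
  exact symSq_inf_minorsAnnihilator h2 hr hm

/-- A decomposition whose length is the dimension of the span of the slices is certified if the
rank of the minors on this span is the right one. -/
theorem isCertified_of_finrank (h2 : (2 : F) ≠ 0) {T : Tensor F n₁ n₂ n₃} {R : ℕ}
    {v : Fin R → Mat F n₁ n₂} {w : Fin R → Fin n₃ → F} (hT : T = ∑ a, tmulMat (v a) (w a))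
    (hr : ∀ a, v a ∈ rankOneVariety F n₁ n₂) (hfin : Module.finrank F (sliceSpan T) = R)
    (hm : 2 * Module.finrank F (Submodule.map₂ (minorPair F n₁ n₂) (sliceSpan T) (sliceSpan T)) + R
      = R ^ 2) : IsCertified T v w := by
  rw [hT] at hfin
  obtain ⟨h3, h4, h5⟩ := independent_of_finrank hfin
  refine isCertified_of_independent h2 hT hr h4 h5 ((minorIndependent_iff hr).2 ?_)
  rw [← h3, ← hT]
  exact hm

namespace Algo

/-! ## The span of the slices and the rank of the minors -/

theorem dot_fin (n n' : ℕ) (x g : ℕ → ℕ → F) :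
    dot n n' x g = ∑ j : Fin n, ∑ k : Fin n', x j k * g j k := by
  simp only [dot, Finset.sum_range]

theorem dot_fin_one (n : ℕ) (x g : ℕ → ℕ → F) :
    dot n 1 x g = ∑ j : Fin n, x j 0 * g j 0 := by
  simp [dot_fin]

/-- The kernel of the rows is the space of relations between the slices, so the rank is the
dimension of their span, and every slice is a combination of the pivot slices. -/
theorem basis_rank {T : Tensor F n₁ n₂ n₃} {t : ℕ → ℕ → ℕ → F}
    (ht : ∀ (i : Fin n₁) (j : Fin n₂) (k : Fin n₃), t i j k = T i j k)
    {rm r cnt : ℕ} {B : ℕ → ℕ → ℕ → F} {pj pk : ℕ → ℕ}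
    (h : Red n₃ 1 rm B pj pk r (fun g => ∀ i < n₁, ∀ j < n₂, dot n₃ 1 (fun k _ => t i j k) g = 0) cnt)
    (hrm : r ≤ rm) :
    r = Module.finrank F (sliceSpan T) ∧ ∀ u : Fin r → Mat F n₁ n₂,
      (∀ a (i : Fin n₁) (j : Fin n₂), u a (i, j) = t i j (pj a)) →
        Submodule.span F (Set.range u) = sliceSpan T := by
  have hker : ∀ g : ℕ → ℕ → F, (∀ i < n₁, ∀ j < n₂, dot n₃ 1 (fun k _ => t i j k) g = 0) ↔
      ∑ k : Fin n₃, g k 0 • slice T k = 0 := by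
    intro g
    constructor
    · intro hg
      funext ⟨i, j⟩
      have := hg i i.2 j j.2
      rw [dot_fin_one] at this
      simpa [Finset.sum_apply, slice, ht, mul_comm] using this
    · intro hg i hi j hj
      have := congrFun hg (⟨i, hi⟩, ⟨j, hj⟩)
      rw [dot_fin_one]
      have e : ∀ k : Fin n₃, t i j k = T ⟨i, hi⟩ ⟨j, hj⟩ k := fun k => ht ⟨i, hi⟩ ⟨j, hj⟩ k
      simpa [Finset.sum_apply, slice, e, mul_comm] using this
  constructor
  · let S : (Fin n₃ × Fin 1 → F) →ₗ[F] Mat F n₁ n₂ :=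
      Fintype.linearCombination F fun q : Fin n₃ × Fin 1 => slice T q.1
    have hS : ∀ g, S g = ∑ k : Fin n₃, g (k, 0) • slice T k := by
      intro g
      simp only [S, Fintype.linearCombination_apply, Fintype.sum_prod_type]
      simp
    have hr : LinearMap.range S = sliceSpan T := by
      rw [sliceSpan, Fintype.range_linearCombination]
      congr 1
      ext M
      simp only [Set.mem_range, Prod.exists]
      constructor
      · rintro ⟨k, -, rfl⟩
        exact ⟨k, rfl⟩
      · rintro ⟨k, rfl⟩
        exact ⟨k, 0, rfl⟩
    rw [← hr]
    refine h.rank_eq S fun g => ?_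
    rw [hker, hS]
    simp [Red.ext]
  · intro u hu
    have hu' : ∀ a : Fin r, u a = slice T ⟨pj a, h.hj a a.2⟩ := by
      intro a
      funext ⟨i, j⟩
      rw [hu]
      exact ht i j ⟨pj a, h.hj a a.2⟩
    apply le_antisymm
    · rw [Submodule.span_le]
      rintro _ ⟨a, rfl⟩
      rw [hu']
      exact Submodule.subset_span ⟨_, rfl⟩
    · rw [sliceSpan, Submodule.span_le]
      rintro _ ⟨k, rfl⟩
      -- The projection of the `k`-th unit vector is a relation that involves only the slice `k` and
      -- the pivot slices.
      have h1 := (hker _).1 (h.ker_proj hrm (unitAt (k : ℕ) 0))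
      have h2 : slice T k = ∑ a : Fin r, B a k 0 • u a := by
        have e : ∀ k' : Fin n₃, proj n₃ 1 rm B pj pk (unitAt (k : ℕ) 0) k' 0 =
            (if k = k' then 1 else 0) - ∑ a : Fin r, B a k 0 *
              (if k' = ⟨pj a, h.hj a a.2⟩ then 1 else 0) := by
          intro k'
          rw [proj]
          congr 1
          · simp [unitAt, Fin.ext_iff]
          · rw [← Finset.sum_subset (Finset.range_mono hrm), Finset.sum_range]
            · refine Finset.sum_congr rfl fun a _ => ?_
              have := h.hk a a.2
              rw [dot_unitAt k.2 Nat.one_pos]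
              simp [Fin.ext_iff, Nat.lt_one_iff.1 this]
            · intro a ha ha'
              rw [Finset.mem_range] at ha ha'
              rw [dot_zero_left (h.zero a (not_lt.1 ha') ha), zero_mul]
        simp only [e, sub_smul, Finset.sum_sub_distrib, Finset.sum_smul, mul_smul] at h1
        rw [Finset.sum_comm] at h1
        simp only [← Finset.smul_sum, ite_smul, one_smul, zero_smul, Finset.sum_ite_eq,
          Finset.sum_ite_eq', Finset.mem_univ, if_true] at h1
        rw [sub_eq_zero.1 h1]
        exact Finset.sum_congr rfl fun a _ => by rw [hu']
      change slice T k ∈ _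
      rw [h2]
      exact Submodule.sum_mem _ fun a _ => Submodule.smul_mem _ _ (Submodule.subset_span ⟨a, rfl⟩)

theorem minors_ker {r : ℕ} {t : ℕ → ℕ → ℕ → F} {p : ℕ → ℕ} {u : Fin r → Mat F n₁ n₂}
    (hu : ∀ a (i : Fin n₁) (j : Fin n₂), u a (i, j) = t i j (p a)) (g : ℕ → ℕ → F) :
    (∀ i < n₁, ∀ i' < n₁, ∀ j < n₂, ∀ j' < n₂,
      dot r r (phi (fun a i j => t i j (p a)) i i' j j') g = 0) ↔
      ∑ a : Fin r, ∑ b : Fin r, g a b • minorPair F n₁ n₂ (u a) (u b) = 0 := by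
  have e : ∀ (i i' : Fin n₁) (j j' : Fin n₂), dot r r (phi (fun a i j => t i j (p a)) i i' j j') g =
      (∑ a : Fin r, ∑ b : Fin r, g a b • minorPair F n₁ n₂ (u a) (u b)) (i, i', j, j') := by
    intro i i' j j'
    rw [dot_fin]
    simp only [Finset.sum_apply, Pi.smul_apply, smul_eq_mul, minorPair_apply, hu, phi]
    exact Finset.sum_congr rfl fun _ _ => Finset.sum_congr rfl fun _ _ => mul_comm _ _
  constructor
  · intro hg
    funext ⟨i, i', j, j'⟩
    rw [← e]
    exact hg i i.2 i' i'.2 j j.2 j' j'.2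
  · intro hg i hi i' hi' j hj j' hj'
    have := e ⟨i, hi⟩ ⟨i', hi'⟩ ⟨j, hj⟩ ⟨j', hj'⟩
    rw [hg] at this
    exact this

theorem minors_rank {R : ℕ} {t : ℕ → ℕ → ℕ → F} {p : ℕ → ℕ} {u : Fin R → Mat F n₁ n₂}
    (hu : ∀ a (i : Fin n₁) (j : Fin n₂), u a (i, j) = t i j (p a))
    {rm r cnt : ℕ} {B : ℕ → ℕ → ℕ → F} {pj pk : ℕ → ℕ}
    (h : Red R R rm B pj pk r (fun g => ∀ i < n₁, ∀ i' < n₁, ∀ j < n₂, ∀ j' < n₂,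
      dot R R (phi (fun a i j => t i j (p a)) i i' j j') g = 0) cnt) :
    r = Module.finrank F (Submodule.map₂ (minorPair F n₁ n₂) (Submodule.span F (Set.range u))
      (Submodule.span F (Set.range u))) := by
  rw [h.rank_eq (Fintype.linearCombination F fun q : Fin R × Fin R =>
    minorPair F n₁ n₂ (u q.1) (u q.2)), map₂_eq_span_pairs, Fintype.range_linearCombination]
  intro g
  rw [minors_ker hu, Fintype.linearCombination_apply, Fintype.sum_prod_type]
  simp [Red.ext]

/-! ## The algebra -/

open Matrix

/-- The leading part of an infinite matrix. -/
def toMat (R : ℕ) (g : ℕ → ℕ → F) : Matrix (Fin R) (Fin R) F := Matrix.of fun i j => g i j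

/-- Linearity of the projection, used to pass from arbitrary solutions to the projected unit
matrices. -/
theorem proj_sum {R rm : ℕ} {B : ℕ → ℕ → ℕ → F} {pj pk : ℕ → ℕ} (z : ℕ → ℕ → F) :
    toMat R (proj R R rm B pj pk z) = ∑ j : Fin R, ∑ k : Fin R, z j k •
      toMat R (proj R R rm B pj pk (unitAt (j : ℕ) (k : ℕ))) := by
  ext e e'
  simp only [toMat, Matrix.sum_apply, Matrix.smul_apply, Matrix.of_apply, proj, smul_eq_mul, mul_sub,
    Finset.sum_sub_distrib]
  congr 1
  · rw [Finset.sum_eq_single e, Finset.sum_eq_single e']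
    · simp [unitAt]
    · intro b _ hb
      simp [unitAt, Fin.ext_iff.not.1 hb]
    · simp
    · intro b _ hb
      refine Finset.sum_eq_zero fun c _ => ?_
      simp [unitAt, Fin.ext_iff.not.1 hb]
    · simp
  · simp only [Finset.mul_sum]
    have e1 : ∀ j : Fin R, ∑ k : Fin R, ∑ a ∈ Finset.range rm, z j k *
        (dot R R (B a) (unitAt (j : ℕ) (k : ℕ)) *
          ((if (e : ℕ) = pj a then 1 else 0) * if (e' : ℕ) = pk a then 1 else 0)) =
        ∑ a ∈ Finset.range rm, ∑ k : Fin R, z j k * (dot R R (B a) (unitAt (j : ℕ) (k : ℕ)) *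
          ((if (e : ℕ) = pj a then 1 else 0) * if (e' : ℕ) = pk a then 1 else 0)) :=
      fun j => Finset.sum_comm
    simp only [e1]
    rw [Finset.sum_comm]
    refine Finset.sum_congr rfl fun a _ => ?_
    rw [dot_fin, Finset.sum_mul]
    refine Finset.sum_congr rfl fun j _ => ?_
    rw [Finset.sum_mul]
    refine Finset.sum_congr rfl fun k _ => ?_
    rw [dot_unitAt j.2 k.2]
    ring

section Planted

variable {R : ℕ} {v u : Fin R → Mat F n₁ n₂} {A : Matrix (Fin R) (Fin R) F}

/-- The quadratic forms in the kernel of the minors become diagonal in the basis `v`. -/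
theorem minors_ker_iff (hv : ∀ a, v a ∈ rankOneVariety F n₁ n₂) (hm : MinorIndependent v)
    (hA : ∀ a, u a = ∑ c, A a c • v c) (G : Matrix (Fin R) (Fin R) F) :
    ∑ a, ∑ b, G a b • minorPair F n₁ n₂ (u a) (u b) = 0 ↔ (Aᵀ * (G + Gᵀ) * A).IsDiag := by
  have e : ∑ a, ∑ b, G a b • minorPair F n₁ n₂ (u a) (u b) =
      ∑ c, ∑ d, (Aᵀ * G * A) c d • minorPair F n₁ n₂ (v c) (v d) := by
    simp only [hA, map_sum, LinearMap.sum_apply, map_smul, LinearMap.smul_apply, Finset.smul_sum,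
      Matrix.mul_apply, Matrix.transpose_apply, Finset.sum_smul, smul_smul, Finset.sum_mul]
    have step : ∀ f : Fin R → Fin R → Fin R → Fin R → (Fin n₁ × Fin n₁ × Fin n₂ × Fin n₂ → F),
        ∑ a, ∑ b, ∑ c, ∑ d, f a b c d = ∑ c, ∑ d, ∑ b, ∑ a, f a b d c := by
      intro f
      calc _ = ∑ b, ∑ a, ∑ c, ∑ d, f a b c d := Finset.sum_comm
        _ = ∑ b, ∑ c, ∑ d, ∑ a, f a b c d := by
          refine Finset.sum_congr rfl fun b _ => ?_
          rw [Finset.sum_comm]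
          exact Finset.sum_congr rfl fun c _ => Finset.sum_comm
        _ = ∑ d, ∑ c, ∑ b, ∑ a, f a b d c := by
          rw [Finset.sum_comm]
          exact Finset.sum_congr rfl fun c _ => Finset.sum_comm
        _ = _ := Finset.sum_comm
    rw [step]
    exact Finset.sum_congr rfl fun c _ => Finset.sum_congr rfl fun d _ =>
      Finset.sum_congr rfl fun b _ => Finset.sum_congr rfl fun a _ => by congr 1; ring
  have e2 : Aᵀ * (G + Gᵀ) * A = Aᵀ * G * A + (Aᵀ * G * A)ᵀ := by
    simp only [Matrix.mul_add, Matrix.add_mul, Matrix.transpose_mul, Matrix.transpose_transpose,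
      Matrix.mul_assoc]
  rw [e, e2]
  constructor
  · intro h c d hcd
    rw [Matrix.add_apply, Matrix.transpose_apply]
    rcases lt_or_gt_of_ne hcd with h1 | h1
    · exact hm.eq_zero hv h ⟨(c, d), h1⟩
    · rw [add_comm]
      exact hm.eq_zero hv h ⟨(d, c), h1⟩
  · intro h
    rw [sum_symmetric (fun c d => (Aᵀ * G * A) c d)
      (fun c d => minorPair F n₁ n₂ (v c) (v d)) fun a b => minorPair_comm _ _,
      Finset.sum_eq_zero, zero_add,
      Finset.sum_eq_zero]
    · intro a _
      obtain ⟨x, y, hxy⟩ := hv a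
      rw [hxy, minorPair_self, smul_zero]
    · intro q _
      have : (Aᵀ * G * A + (Aᵀ * G * A)ᵀ) q.1.1 q.1.2 = 0 := h (ne_of_lt q.2)
      rw [Matrix.add_apply, Matrix.transpose_apply] at this
      rw [this, zero_smul]

end Planted

theorem isDiag_iff_exists {R : ℕ} (M : Matrix (Fin R) (Fin R) F) :
    M.IsDiag ↔ ∃ d, M = diagonal d :=
  ⟨fun h => ⟨M.diag, h.diagonal_diag.symm⟩, by rintro ⟨d, rfl⟩; exact isDiag_diagonal d⟩

/-- The matrices whose products with the symmetrized solutions are symmetric are those which are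
diagonal in the basis of the planted eigenvectors. -/
theorem algebra_ker (h2 : (2 : F) ≠ 0) {R rm r cnt : ℕ} {B : ℕ → ℕ → ℕ → F} {pj pk : ℕ → ℕ}
    {Kr : (ℕ → ℕ → F) → Prop} (h : Red R R rm B pj pk r Kr cnt) (hrm : r ≤ rm)
    {A P : Matrix (Fin R) (Fin R) F} (hAP : Aᵀ * P = 1)
    (hK : ∀ g, Kr g ↔ (Aᵀ * (toMat R g + (toMat R g)ᵀ) * A).IsDiag) (M : ℕ → ℕ → F) :
    (∀ j < R, ∀ k < R, ∀ a < R, ∀ b < R,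
      dot R R (symRow (symSol R rm B pj pk j k) a b) M = 0) ↔
      (Aᵀ * toMat R M * P).IsDiag := by
  have hPA : P * Aᵀ = 1 := mul_eq_one_comm.1 hAP
  have hAP' : Pᵀ * A = 1 := by rw [← transpose_transpose (Pᵀ * A), transpose_mul,
    transpose_transpose, hAP, transpose_one]
  have hPA' : A * Pᵀ = 1 := mul_eq_one_comm.1 hAP'
  have hS : ∀ j k, toMat R (symSol R rm B pj pk j k) = toMat R (proj R R rm B pj pk (unitAt j k)) +
      (toMat R (proj R R rm B pj pk (unitAt j k)))ᵀ := fun j k => rfl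
  have hrow : ∀ (S : ℕ → ℕ → F) (a b : Fin R), dot R R (symRow S a b) M =
      (toMat R M * toMat R S) a b - (toMat R M * toMat R S) b a := by
    intro S a b
    simp only [dot_fin, symRow, sub_mul, Finset.sum_sub_distrib, Matrix.mul_apply, toMat,
      Matrix.of_apply]
    congr 1
    · rw [Finset.sum_eq_single a]
      · exact Finset.sum_congr rfl fun _ _ => by simp [mul_comm]
      · intro c _ hc
        simp [Fin.ext_iff.not.1 hc]
      · simp
    · rw [Finset.sum_eq_single b]
      · exact Finset.sum_congr rfl fun _ _ => by simp [mul_comm]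
      · intro c _ hc
        simp [Fin.ext_iff.not.1 hc]
      · simp
  have hall : (∀ j < R, ∀ k < R, ∀ a < R, ∀ b < R,
      dot R R (symRow (symSol R rm B pj pk j k) a b) M = 0) ↔
      ∀ j k : Fin R, (toMat R M * toMat R (symSol R rm B pj pk j k)).IsSymm := by
    constructor
    · intro h j k
      ext a b
      have := h j j.2 k k.2 a a.2 b b.2
      rw [hrow] at this
      rw [transpose_apply]
      exact (sub_eq_zero.1 this).symm
    · intro h j hj k hk a ha b hb
      rw [hrow _ ⟨a, ha⟩ ⟨b, hb⟩, sub_eq_zero]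
      exact ((h ⟨j, hj⟩ ⟨k, hk⟩).apply _ _).symm
  rw [hall]
  constructor
  · intro hM
    -- Each `P D Pᵀ` solves the equations, so the projection fixes it. As it is symmetric, its
    -- double is a combination of symmetrized projections of unit matrices.
    have key : ∀ d : Fin R → F, (toMat R M * (P * diagonal d * Pᵀ)).IsSymm := by
      intro d
      set G : Matrix (Fin R) (Fin R) F := P * diagonal d * Pᵀ with hG
      have hGs : Gᵀ = G := by
        rw [hG]; simp [transpose_mul, Matrix.mul_assoc]
      set g : ℕ → ℕ → F := Red.ext fun q : Fin R × Fin R => G q.1 q.2 with hg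
      have htg : toMat R g = G := by
        ext i j; simp [toMat, hg, Red.ext]
      have hk : Kr g := by
        rw [hK, htg, hGs, isDiag_iff_exists]
        refine ⟨d + d, ?_⟩
        have : Aᵀ * (G + G) * A = (Aᵀ * P) * diagonal d * (Pᵀ * A) +
            (Aᵀ * P) * diagonal d * (Pᵀ * A) := by
          simp only [hG, Matrix.mul_add, Matrix.add_mul, Matrix.mul_assoc]
        rw [this, hAP, hAP', Matrix.one_mul, Matrix.mul_one, diagonal_add]
        rfl
      have e1 := proj_sum (R := R) (rm := rm) (B := B) (pj := pj) (pk := pk) g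
      rw [h.proj_of_ker hk, htg] at e1
      have e2 : G + G = ∑ j : Fin R, ∑ k : Fin R, g j k •
          toMat R (symSol R rm B pj pk j k) := by
        simp only [hS, smul_add, Finset.sum_add_distrib]
        rw [← e1]
        congr 1
        conv_lhs => rw [← hGs, e1]
        simp only [transpose_sum, transpose_smul]
      have e3 : (toMat R M * (G + G)).IsSymm := by
        rw [e2]
        simp only [Matrix.mul_sum, Matrix.mul_smul, Matrix.IsSymm, transpose_sum, transpose_smul]
        exact Finset.sum_congr rfl fun j _ => Finset.sum_congr rfl fun k _ => by rw [(hM j k).eq]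
      rw [← two_smul F G, Matrix.mul_smul, Matrix.IsSymm, transpose_smul] at e3
      exact smul_right_injective _ h2 e3
    intro c d hcd
    -- In the basis `P` this says that `N` times the diagonal unit at `d` is symmetric, so column
    -- `d` of `N` vanishes off the diagonal.
    have e4 := key (Pi.single d 1)
    set N := Aᵀ * toMat R M * P with hN
    have e5 : (N * diagonal (Pi.single d 1)).IsSymm := by
      have e6 : N * diagonal (Pi.single d 1) =
          Aᵀ * (toMat R M * (P * diagonal (Pi.single d 1) * Pᵀ)) * A := by
        rw [hN]
        simp only [Matrix.mul_assoc, hAP', Matrix.mul_one]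
      rw [e6, Matrix.IsSymm]
      simp only [transpose_mul, transpose_transpose]
      have := e4.eq
      simp only [transpose_mul, transpose_transpose] at this
      rw [← Matrix.mul_assoc, this]
    have := e5.apply c d
    simpa [Matrix.mul_diagonal, hcd] using this.symm
  -- Conversely, `P μ Aᵀ` times `P D Pᵀ` is `P (μ D) Pᵀ`, which is symmetric.
  · intro hM j k
    obtain ⟨μ, hμ⟩ := (isDiag_iff_exists _).1 hM
    obtain ⟨D, hD⟩ := (isDiag_iff_exists _).1 ((hK _).1 (h.ker_proj hrm (unitAt (j : ℕ) (k : ℕ))))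
    rw [← hS] at hD
    set S := toMat R (symSol R rm B pj pk j k) with hSS
    have e1 : S = P * diagonal D * Pᵀ := by
      rw [← hD]
      calc S = (P * Aᵀ) * S * (A * Pᵀ) := by rw [hPA, hPA', Matrix.one_mul, Matrix.mul_one]
        _ = _ := by simp only [Matrix.mul_assoc]
    have e2 : toMat R M = P * diagonal μ * Aᵀ := by
      rw [← hμ]
      calc toMat R M = (P * Aᵀ) * toMat R M * (P * Aᵀ) := by
            rw [hPA, Matrix.one_mul, Matrix.mul_one]
        _ = _ := by simp only [Matrix.mul_assoc]
    have e3 : toMat R M * S = P * diagonal (μ * D) * Pᵀ := by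
      rw [e1, e2]
      calc _ = P * diagonal μ * (Aᵀ * P) * diagonal D * Pᵀ := by simp only [Matrix.mul_assoc]
        _ = _ := by
          rw [hAP, Matrix.mul_one, Matrix.mul_assoc P, diagonal_mul_diagonal]
          rfl
    rw [e3, Matrix.IsSymm]
    simp [transpose_mul, Matrix.mul_assoc]

end Algo

namespace Algo

open Matrix

/-! ## Good trials -/

section Krylov

variable {R : ℕ} {A P : Matrix (Fin R) (Fin R) F} {M : ℕ → ℕ → F} {μ : Fin R → F}

/-- The columns of `P` are eigenvectors, and `Aᵀ` computes coordinates with respect to them. -/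
theorem krylov_eq (hAP : Aᵀ * P = 1) (hM : toMat R M = P * diagonal μ * Aᵀ) (x : ℕ → F) (i : ℕ) :
    (fun a : Fin R => krylov R M x i a) = P *ᵥ fun c => μ c ^ i * (Aᵀ *ᵥ fun b : Fin R => x b) c := by
  have hPA : P * Aᵀ = 1 := mul_eq_one_comm.1 hAP
  induction i with
  | zero =>
    simp only [pow_zero, one_mul, krylov]
    rw [mulVec_mulVec, hPA, one_mulVec]
  | succ i ih =>
    have e : (fun a : Fin R => krylov R M x (i + 1) a) =
        toMat R M *ᵥ fun a : Fin R => krylov R M x i a := by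
      funext a
      simp only [krylov, Finset.sum_range, mulVec, dotProduct, toMat, Matrix.of_apply]
    rw [e, ih, hM, mulVec_mulVec, Matrix.mul_assoc, hAP, Matrix.mul_one, ← mulVec_mulVec]
    congr 1
    funext c
    rw [mulVec_diagonal]
    ring

/-- Puts the pairings with the Krylov vectors in Vandermonde form, with the eigenvalues as nodes. -/
theorem dot_krylov (hAP : Aᵀ * P = 1) (hM : toMat R M = P * diagonal μ * Aᵀ) (x : ℕ → F) (i : ℕ)
    (g : ℕ → ℕ → F) : dot R 1 (fun a _ => krylov R M x i a) g =
      ∑ c, ((Aᵀ *ᵥ fun b : Fin R => x b) c * (Pᵀ *ᵥ fun a : Fin R => g a 0) c) * μ c ^ i := by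
  have e : dot R 1 (fun a _ => krylov R M x i a) g =
      (fun a : Fin R => krylov R M x i a) ⬝ᵥ fun a : Fin R => g a 0 := by
    rw [dot_fin_one]; rfl
  rw [e, krylov_eq hAP hM, ← vecMul_transpose, ← dotProduct_mulVec]
  exact Finset.sum_congr rfl fun c _ => by ring

end Krylov

section Search

variable {R rm r cnt : ℕ} {B : ℕ → ℕ → ℕ → F} {pj pk : ℕ → ℕ} {Kr : (ℕ → ℕ → F) → Prop}
  {A P : Matrix (Fin R) (Fin R) F}

theorem eq_conj_of_isDiag (hAP : Aᵀ * P = 1) {M : Matrix (Fin R) (Fin R) F}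
    (hM : (Aᵀ * M * P).IsDiag) : M = P * diagonal (fun c => (Aᵀ * M * P) c c) * Aᵀ := by
  have hPA : P * Aᵀ = 1 := mul_eq_one_comm.1 hAP
  have e : diagonal (fun c => (Aᵀ * M * P) c c) = Aᵀ * M * P := hM.diagonal_diag
  rw [e]
  calc M = (P * Aᵀ) * M * (P * Aᵀ) := by rw [hPA, Matrix.one_mul, Matrix.mul_one]
    _ = _ := by simp only [Matrix.mul_assoc]

/-- A good trial has different eigenvalues. -/
theorem injective_of_good (hAP : Aᵀ * P = 1) {t : ℕ} (hg : Good R rm B pj pk t)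
    {μ : Fin R → F} (hM : toMat R (trialMat R rm B pj pk t) = P * diagonal μ * Aᵀ) :
    Function.Injective μ := by
  intro c d hcd
  by_contra hne
  have hAP' : Pᵀ * A = 1 := by
    rw [← transpose_transpose (Pᵀ * A), transpose_mul, transpose_transpose, hAP, transpose_one]
  set ξ := Aᵀ *ᵥ fun b : Fin R => (t : F) ^ (b : ℕ) with hξ
  -- If `μ c = μ d`, a nonzero functional on the coordinates `c` and `d` that kills the starting
  -- vector kills all Krylov vectors.
  obtain ⟨p, q, hpq, h0⟩ : ∃ p q : F, ¬ (p = 0 ∧ q = 0) ∧ ξ c * p + ξ d * q = 0 := by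
    by_cases h : ξ d = 0
    · exact ⟨0, 1, by simp, by simp [h]⟩
    · exact ⟨ξ d, - ξ c, by simp [h], by ring⟩
  let y : Fin R → F := fun e => if e = c then p else if e = d then q else 0
  let z : Fin R → F := A *ᵥ y
  have hz : ∀ g : ℕ → ℕ → F, (∀ a : Fin R, g a 0 = z a) →
      (Pᵀ *ᵥ fun a : Fin R => g a 0) = y := by
    intro g hg'
    have : (fun a : Fin R => g a 0) = z := funext hg'
    rw [this, mulVec_mulVec, hAP', one_mulVec]
  let g : ℕ → ℕ → F := fun a _ => if h : a < R then z ⟨a, h⟩ else 0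
  have hgz : ∀ a : Fin R, g a 0 = z a := fun a => by simp [g]
  have h1 := hg g fun i hi => by
    rw [dot_krylov hAP hM, hz g hgz, ← hξ]
    have e : ∀ e, ξ e * y e * μ e ^ i =
        (if e = c then ξ c * p * μ c ^ i else 0) + (if e = d then ξ d * q * μ d ^ i else 0) := by
      intro e
      simp only [y]
      by_cases h1 : e = c
      · have : e ≠ d := fun h2 => hne (h1.symm.trans h2)
        rw [if_pos h1, if_pos h1, if_neg this, add_zero, h1]
      · by_cases h2 : e = d
        · rw [if_neg h1, if_neg h1, if_pos h2, if_pos h2, zero_add, h2]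
        · simp [h1, h2]
    simp only [e, Finset.sum_add_distrib, Finset.sum_ite_eq', Finset.mem_univ, if_true]
    rw [hcd, ← add_mul, h0, zero_mul]
  have h2 : y = 0 := by
    rw [← hz g hgz]
    have : (fun a : Fin R => g a 0) = 0 := funext fun a => h1 a a.2 0 Nat.one_pos
    rw [this, mulVec_zero]
  refine hpq ⟨?_, ?_⟩
  · have := congrFun h2 c
    simpa [y] using this
  · have := congrFun h2 d
    simpa [y, Ne.symm hne] using this

/-- A Vandermonde system with distinct nodes has only the zero solution; the coordinates of the
starting vector are nonzero and can be cancelled. -/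
theorem good_of_injective (hAP : Aᵀ * P = 1) {t : ℕ}
    {μ : Fin R → F} (hM : toMat R (trialMat R rm B pj pk t) = P * diagonal μ * Aᵀ)
    (hμ : Function.Injective μ)
    (hξ : ∀ c, (Aᵀ *ᵥ fun b : Fin R => (t : F) ^ (b : ℕ)) c ≠ 0) : Good R rm B pj pk t := by
  intro g hg j hj k hk
  have hPA' : A * Pᵀ = 1 := by
    rw [mul_eq_one_comm, ← transpose_transpose (Pᵀ * A), transpose_mul, transpose_transpose, hAP,
      transpose_one]
  have h1 := eq_zero_of_forall_pow_sum_mul_pow_eq_zero hμ fun i : Fin R => by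
    have := hg i i.2
    rwa [dot_krylov hAP hM] at this
  have h2 : (Pᵀ *ᵥ fun a : Fin R => g a 0) = 0 := by
    funext c
    exact (mul_eq_zero.1 (congrFun h1 c)).resolve_left (hξ c)
  have h3 : (fun a : Fin R => g a 0) = 0 := by
    rw [← one_mulVec (fun a : Fin R => g a 0), ← hPA', ← mulVec_mulVec, h2, mulVec_zero]
  rw [Nat.lt_one_iff.1 hk]
  exact congrFun h3 ⟨j, hj⟩

open Polynomial

/-- The polynomial with the given coefficients. -/
def ofCoeffs {m : ℕ} (f : Fin m → F) : F[X] := ∑ i, C (f i) * X ^ (i : ℕ)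

theorem natDegree_ofCoeffs {m : ℕ} (f : Fin m → F) : (ofCoeffs f).natDegree ≤ m :=
  natDegree_sum_le_of_forall_le _ _ fun i _ =>
    (natDegree_C_mul_X_pow_le _ _).trans i.2.le

theorem ofCoeffs_ne_zero {m : ℕ} {f : Fin m → F} (hf : f ≠ 0) : ofCoeffs f ≠ 0 := by
  intro h
  refine hf (funext fun i => ?_)
  have := congrArg (fun p => p.coeff (i : ℕ)) h
  simpa [ofCoeffs, finsetSum_coeff, coeff_C_mul, coeff_X_pow, Fin.val_inj] using this

theorem eval_ofCoeffs {m : ℕ} (f : Fin m → F) (t : F) :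
    (ofCoeffs f).eval t = ∑ i, f i * t ^ (i : ℕ) := by
  simp [ofCoeffs, eval_finsetSum]

theorem exists_nat_eval_ne_zero [CharZero F] {p : F[X]} (hp : p ≠ 0) {N : ℕ}
    (hN : p.natDegree < N) : ∃ t < N, p.eval (t : F) ≠ 0 := by
  by_contra! h
  refine hp (eq_zero_of_natDegree_lt_card_of_eval_eq_zero p (f := fun t : Fin N => ((t : ℕ) : F))
    (fun a b hab => Fin.ext (Nat.cast_injective hab)) (fun t => h t t.2) ?_)
  simpa using hN

/-- If the kernel consists of the matrices that are diagonal in a basis, then there is a good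
trial. -/
theorem exists_good [CharZero F] (h : Red R R rm B pj pk r Kr cnt) (hrm : r ≤ rm)
    (hAP : Aᵀ * P = 1) (hK : ∀ M, Kr M ↔ (Aᵀ * toMat R M * P).IsDiag) :
    ∃ t < R * R * (R * R) + R * R + 1, Good R rm B pj pk t := by
  have hPA : P * Aᵀ = 1 := mul_eq_one_comm.1 hAP
  -- `L c` is the linear form that gives the `c`-th eigenvalue of the projection of a matrix. The
  -- indices are swapped because `finProdFinEquiv` sends `(k, j)` to `j + R k`, the exponent in
  -- `powers`.
  let L : Fin R → Fin R × Fin R → F := fun c q =>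
    (Aᵀ * toMat R (proj R R rm B pj pk (unitAt (q.2 : ℕ) (q.1 : ℕ))) * P) c c
  have hL : ∀ (z : ℕ → ℕ → F) c, (Aᵀ * toMat R (proj R R rm B pj pk z) * P) c c =
      ∑ q, L c q * z q.2 q.1 := by
    intro z c
    rw [proj_sum, Fintype.sum_prod_type_right]
    simp only [Matrix.mul_sum, Matrix.sum_mul, Matrix.sum_apply, Matrix.mul_smul, Matrix.smul_mul,
      Matrix.smul_apply, smul_eq_mul, L]
    exact Finset.sum_congr rfl fun _ _ => Finset.sum_congr rfl fun _ _ => mul_comm _ _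
  -- The projection fixes the member of the algebra with eigenvalue `1` at `c` and `0` elsewhere,
  -- and this separates the two forms.
  have hsep : ∀ c d, c ≠ d → L c - L d ≠ 0 := by
    intro c d hcd h0
    set G : Matrix (Fin R) (Fin R) F := P * diagonal (Pi.single c 1) * Aᵀ with hG
    set g : ℕ → ℕ → F := Red.ext fun q : Fin R × Fin R => G q.1 q.2 with hg
    have htg : toMat R g = G := by
      ext i j; simp [toMat, hg, Red.ext]
    have e : Aᵀ * G * P = diagonal (Pi.single c 1) := by
      calc Aᵀ * G * P = (Aᵀ * P) * diagonal (Pi.single c 1) * (Aᵀ * P) := by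
            simp only [hG, Matrix.mul_assoc]
        _ = _ := by rw [hAP, Matrix.one_mul, Matrix.mul_one]
    have hk : Kr g := by
      rw [hK, htg, e]
      exact isDiag_diagonal _
    have e1 := hL g c
    have e2 := hL g d
    rw [h.proj_of_ker hk, htg, e] at e1 e2
    rw [sub_eq_zero.1 h0, ← e2] at e1
    simp [hcd.symm] at e1
  let p : Fin R × Fin R → F[X] := fun q => if q.1 = q.2 then 1 else
    ofCoeffs fun i : Fin (R * R) => (L q.1 - L q.2) (finProdFinEquiv.symm i)
  have hp : ∀ (c d : Fin R) (t : ℕ), c ≠ d → (p (c, d)).eval (t : F) =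
      (Aᵀ * toMat R (trialMat R rm B pj pk t) * P) c c -
        (Aᵀ * toMat R (trialMat R rm B pj pk t) * P) d d := by
    intro c d t hcd
    simp only [p, if_neg hcd, trialMat, hL, eval_ofCoeffs]
    rw [← Equiv.sum_comp finProdFinEquiv, ← Finset.sum_sub_distrib]
    refine Finset.sum_congr rfl fun q _ => ?_
    rw [Equiv.symm_apply_apply, Pi.sub_apply, sub_mul, powers, ← pow_mul, ← pow_add]
    simp [finProdFinEquiv]
  let x : Fin R → F[X] := fun c => ofCoeffs fun b => A b c
  have hx : ∀ c (t : ℕ), (x c).eval (t : F) = (Aᵀ *ᵥ fun b : Fin R => (t : F) ^ (b : ℕ)) c := by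
    intro c t
    simp only [x, eval_ofCoeffs, mulVec, dotProduct, Matrix.transpose_apply]
  -- At `t`, the factors `p` are the differences of eigenvalues and the factors `x` the coordinates
  -- of the starting vector. Where none vanishes, the trial is good.
  have hne : (∏ q, p q) * ∏ c, x c ≠ 0 := by
    refine mul_ne_zero (Finset.prod_ne_zero_iff.2 fun q _ => ?_)
      (Finset.prod_ne_zero_iff.2 fun c _ => ofCoeffs_ne_zero fun h0 => ?_)
    · simp only [p]
      split_ifs with hq
      · exact one_ne_zero
      · refine ofCoeffs_ne_zero fun h0 => hsep q.1 q.2 hq (funext fun e => ?_)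
        have := congrFun h0 (finProdFinEquiv e)
        simpa using this
    · have := congrFun (congrFun hAP c) c
      rw [Matrix.mul_apply, Matrix.one_apply_eq, Finset.sum_eq_zero] at this
      · exact zero_ne_one this
      · intro b _
        rw [Matrix.transpose_apply, congrFun h0 b, Pi.zero_apply, zero_mul]
  -- There are `R²` factors of degree at most `R²` and `R` factors of degree at most `R`; hence the
  -- number of trials.
  have hdeg : ((∏ q, p q) * ∏ c, x c).natDegree < R * R * (R * R) + R * R + 1 := by
    refine Nat.lt_succ_of_le (natDegree_mul_le.trans (add_le_add ?_ ?_))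
    · refine (natDegree_prod_le _ _).trans ((Finset.sum_le_card_nsmul _ _ (R * R) fun q _ => ?_).trans
        (by simp))
      simp only [p]
      split_ifs
      · simp
      · exact natDegree_ofCoeffs _
    · refine (natDegree_prod_le _ _).trans ((Finset.sum_le_card_nsmul _ _ R fun q _ => ?_).trans
        (by simp))
      exact natDegree_ofCoeffs _
  obtain ⟨t, ht, hev⟩ := exists_nat_eval_ne_zero hne hdeg
  rw [eval_mul, eval_prod, eval_prod] at hev
  have h1 := Finset.prod_ne_zero_iff.1 (left_ne_zero_of_mul hev)
  have h2 := Finset.prod_ne_zero_iff.1 (right_ne_zero_of_mul hev)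
  refine ⟨t, ht, good_of_injective hAP
    (eq_conj_of_isDiag hAP ((hK _).1 (h.ker_proj hrm (powers R t)))) ?_ fun c => ?_⟩
  · intro c d hcd
    by_contra hne
    refine h1 (c, d) (Finset.mem_univ _) ?_
    rw [hp c d t hne]
    exact sub_eq_zero.2 hcd
  · rw [← hx]
    exact h2 c (Finset.mem_univ _)

end Search

/-! ## The eigenvectors -/

/-- In the eigenbasis, `Y = Aᵀ * Q` satisfies `μ c * Y c k = Y c k * δ k`. As the `μ c` are
distinct, each column of `Y` has exactly one nonzero entry, and as `Y` is invertible, no two columns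
have it in the same row. -/
theorem eigenvectors_eq {R : ℕ} {A P Q M : Matrix (Fin R) (Fin R) F} {μ δ : Fin R → F}
    (hAP : Aᵀ * P = 1) (hM : M = P * diagonal μ * Aᵀ) (hμ : Function.Injective μ)
    (hQ : IsUnit Q.det) (hMQ : M * Q = Q * diagonal δ) :
    ∃ (σ : Equiv.Perm (Fin R)) (β : Fin R → F), (∀ k, β k ≠ 0) ∧
      ∀ a k, Q a k = β k * P a (σ k) := by
  have hPA : P * Aᵀ = 1 := mul_eq_one_comm.1 hAP
  set Y := Aᵀ * Q with hY
  have hQY : Q = P * Y := by rw [hY, ← Matrix.mul_assoc, hPA, Matrix.one_mul]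
  have hdet : Y.det ≠ 0 := by
    rw [hY, det_mul]
    refine mul_ne_zero ?_ hQ.ne_zero
    intro h0
    have := congrArg det hAP
    rw [det_mul, h0, zero_mul, det_one] at this
    exact zero_ne_one this
  have hD : diagonal μ * Y = Y * diagonal δ := by
    calc diagonal μ * Y = (Aᵀ * P) * diagonal μ * Aᵀ * Q := by
          rw [hAP, Matrix.one_mul, Matrix.mul_assoc]
      _ = Aᵀ * (M * Q) := by rw [hM]; simp only [Matrix.mul_assoc]
      _ = _ := by rw [hMQ, ← Matrix.mul_assoc]
  have hD' : ∀ c k, Y c k ≠ 0 → μ c = δ k := by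
    intro c k hck
    have := congrFun (congrFun hD c) k
    rw [diagonal_mul, mul_diagonal, mul_comm] at this
    exact mul_left_cancel₀ hck this
  have hex : ∀ k, ∃ c, Y c k ≠ 0 := by
    intro k
    by_contra! h
    exact hdet (det_eq_zero_of_column_eq_zero k h)
  choose σ hσ using hex
  have hzero : ∀ c k, c ≠ σ k → Y c k = 0 := by
    intro c k hck
    by_contra h
    exact hck (hμ ((hD' c k h).trans (hD' _ _ (hσ k)).symm))
  have hinj : Function.Injective σ := by
    intro k k' hkk
    by_contra hne
    have := eq_zero_of_mulVec_eq_zero hdet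
      (v := fun e => if e = k then Y (σ k) k' else if e = k' then - Y (σ k) k else 0) ?_
    · have := congrFun this k
      simp only [if_true, Pi.zero_apply] at this
      rw [hkk] at this
      exact hσ k' this
    · funext c
      have e : ∀ e, Y c e * (if e = k then Y (σ k) k' else if e = k' then - Y (σ k) k else 0) =
          (if e = k then Y c k * Y (σ k) k' else 0) + (if e = k' then - (Y c k' * Y (σ k) k) else 0) := by
        intro e
        by_cases h1 : e = k
        · have : e ≠ k' := fun h2 => hne (h1.symm.trans h2)
          rw [if_pos h1, if_pos h1, if_neg this, add_zero, h1]
        · by_cases h2 : e = k'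
          · rw [if_neg h1, if_neg h1, if_pos h2, if_pos h2, zero_add, h2, mul_neg]
          · simp [h1, h2]
      simp only [mulVec, dotProduct, e, Finset.sum_add_distrib, Finset.sum_ite_eq',
        Finset.mem_univ, if_true, Pi.zero_apply]
      by_cases hc : c = σ k
      · rw [hc]; ring
      · rw [hzero c k hc, hzero c k' (hkk ▸ hc)]; ring
  refine ⟨Equiv.ofBijective σ (Finite.injective_iff_bijective.1 hinj), fun k => Y (σ k) k, hσ,
    fun a k => ?_⟩
  rw [hQY, Matrix.mul_apply, Finset.sum_eq_single (σ k)]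
  · rw [mul_comm]; rfl
  · intro c _ hc
    rw [hzero c k hc, mul_zero]
  · simp

/-! ## The linear system for the vectors `w` -/

theorem dot_augRow {n R : ℕ} (t v : ℕ → F) (g : ℕ → ℕ → F) :
    dot (n + R) 1 (fun m _ => augRow n t v m) g =
      ∑ k : Fin n, t k * g k 0 + ∑ c : Fin R, v c * g (n + c) 0 := by
  rw [dot_fin_one, Fin.sum_univ_add]
  simp [augRow]

/-- The kernel is a graph over the first `n` coordinates, spanned by the vectors `s k`. Choosing
pivots as late as possible puts them exactly at the last `R` positions, and the row with pivot `n +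
c` is then `(w c, e_c)`. -/
theorem solve_eq {n R rm r cnt : ℕ} {B : ℕ → ℕ → ℕ → F} {pj pk : ℕ → ℕ}
    {Kr : (ℕ → ℕ → F) → Prop} (h : Red (n + R) 1 rm B pj pk r Kr cnt) (hrm : r ≤ rm)
    {w : Fin R → Fin n → F}
    (hK : ∀ g, Kr g ↔ ∀ c : Fin R, ∑ k : Fin n, w c k * g k 0 + g (n + c) 0 = 0)
    (c : Fin R) (k : Fin n) :
    ∑ a ∈ Finset.range rm, (if pj a = n + c then 1 else 0) * B a k 0 = w c k := by
  have hpk : ∀ a < r, pk a = 0 := fun a ha => Nat.lt_one_iff.1 (h.hk a ha)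
  let s : Fin n → ℕ → ℕ → F := fun k m _ => if m = k then 1 else
    if hm : n ≤ m ∧ m - n < R then - w ⟨m - n, hm.2⟩ k else 0
  have hs1 : ∀ k k' : Fin n, s k k' 0 = if k' = k then 1 else 0 := by
    intro k k'
    have : ¬ (n ≤ (k' : ℕ) ∧ (k' : ℕ) - n < R) := by have := k'.2; omega
    simp only [s, Fin.ext_iff]
    rw [dif_neg this]
  have hs2 : ∀ (k : Fin n) (c : Fin R), s k (n + c) 0 = - w c k := by
    intro k c
    have : ¬ (n + (c : ℕ) = k) := by have := k.2; omega
    simp [s]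
    omega
  have hs : ∀ k, Kr (s k) := by
    intro k
    rw [hK]
    intro c
    rw [hs2]
    simp [hs1]
  -- A pivot at `k < n` would give, by `Red.last`, a vector that vanishes after `k`, is nonzero at
  -- `k` and annihilates the kernel; pairing it with `s k` leaves only its entry at `k`.
  have hge : ∀ a < r, n ≤ pj a := by
    intro a ha
    by_contra hlt
    push Not at hlt
    obtain ⟨y, y1, y2, y3⟩ := h.last a ha
    have := y3 _ (hs ⟨pj a, hlt⟩)
    rw [dot_fin_one, Fin.sum_univ_add] at this
    simp only [Fin.val_castAdd, Fin.val_natAdd, hs1, hs2] at this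
    rw [Finset.sum_eq_zero (s := Finset.univ) (f := fun c : Fin R => y (n + c) 0 * _), add_zero] at this
    · simp at this
      rw [hpk a ha] at y1
      exact y1 this
    · intro c _
      have : y (n + c) 0 = 0 := by
        by_contra hne
        have := y2 (n + c) (by have := c.2; omega) 0 Nat.one_pos hne
        omega
      rw [this, zero_mul]
  have hpiv : ∀ c : Fin R, ∃ a < r, pj a = n + c := by
    intro c
    by_contra hne
    push Not at hne
    have h1 := h.proj_unitAt_self (j := n + c) (k := 0) fun a ha hh => hne a ha hh.1
    have h2 := (hK _).1 (h.ker_proj hrm (unitAt (n + (c : ℕ)) 0)) c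
    rw [h1, Finset.sum_eq_zero, zero_add] at h2
    · exact one_ne_zero h2
    · intro k _
      have e : proj (n + R) 1 rm B pj pk (unitAt (n + (c : ℕ)) 0) k 0 = 0 := by
        rw [proj, Finset.sum_eq_zero, sub_zero]
        · have : ¬ (n + (c : ℕ) = k) := by have := k.2; omega
          simp [unitAt, this]
        · intro a ha
          by_cases har : a < r
          · have : ¬ ((k : ℕ) = pj a) := by have := k.2; have := hge a har; omega
            simp [this]
          · rw [dot_zero_left (h.zero a (not_lt.1 har) (Finset.mem_range.1 ha)), zero_mul]
      rw [e, mul_zero]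
  obtain ⟨a, ha, hac⟩ := hpiv c
  have hrow : B a k 0 = w c k := by
    have h1 := (h.ker _).1 (hs k) a ha
    rw [dot_fin_one, Fin.sum_univ_add] at h1
    simp only [Fin.val_castAdd, Fin.val_natAdd, hs1, hs2] at h1
    have e : ∀ c' : Fin R, B a (n + c') 0 = if c' = c then 1 else 0 := by
      intro c'
      obtain ⟨a', ha', hac'⟩ := hpiv c'
      have := h.unit a ha a' ha'
      rw [hpk a' ha', hac'] at this
      rw [this]
      congr 1
      rw [eq_iff_iff]
      constructor
      · rintro rfl
        exact Fin.ext (by omega)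
      · rintro rfl
        exact h.pivot_injective ha ha' (by omega) (by rw [hpk a ha, hpk a' ha'])
    simp only [e] at h1
    simp at h1
    linear_combination h1
  rw [Finset.sum_eq_single a]
  · rw [if_pos hac, one_mul, hrow]
  · intro b hb hba
    rw [Finset.mem_range] at hb
    by_cases hbr : b < r
    · have : pj b ≠ n + c := fun hh => hba
        (h.pivot_injective hbr ha (by omega) (by rw [hpk a ha, hpk b hbr]))
      rw [if_neg this, zero_mul]
    · rw [h.zero b (not_lt.1 hbr) hb k (by have := k.2; omega) 0 Nat.one_pos, mul_zero]
  · intro hh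
    exact absurd (Finset.mem_range.2 (ha.trans_le hrm)) hh

end Algo

/-! ## Genericity -/

/-- The rows of a matrix are independent if and only if some maximal minor is nonzero. -/
theorem linearIndependent_iff_exists_det {ι κ : Type*} [Fintype ι] [DecidableEq ι] [Fintype κ]
    (N : Matrix ι κ F) :
    LinearIndependent F (fun i => N i) ↔ ∃ f : ι → κ, (N.submatrix id f).det ≠ 0 := by
  constructor
  · intro h
    have hr : N.rank = Fintype.card ι := LinearIndependent.rank_matrix h
    rw [Matrix.rank_eq_finrank_span_cols] at hr
    obtain ⟨f, hf, -, hli⟩ := Submodule.exists_fun_fin_finrank_span_eq F (Set.range N.col)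
    choose g hg using hf
    let e : ι ≃ Fin (Module.finrank F (Submodule.span F (Set.range N.col))) :=
      Fintype.equivOfCardEq (by rw [Fintype.card_fin, hr])
    refine ⟨fun i => g (e i), ?_⟩
    have h2 : LinearIndependent F (N.submatrix id fun i => g (e i)).col := by
      have : (N.submatrix id fun i => g (e i)).col = f ∘ e := by
        funext i
        exact hg (e i)
      rw [this]
      exact hli.comp _ e.injective
    rw [Matrix.linearIndependent_cols_iff_isUnit, Matrix.isUnit_iff_isUnit_det] at h2
    exact h2.ne_zero
  · rintro ⟨f, hf⟩
    rw [Fintype.linearIndependent_iff]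
    intro g hg
    have := Matrix.eq_zero_of_vecMul_eq_zero hf (v := g) (by
      funext i
      have := congrFun hg (f i)
      simpa [Matrix.vecMul, dotProduct, Finset.sum_apply] using this)
    exact congrFun this

open MvPolynomial

/-- A nonempty set defined by the nonvanishing of one of several polynomials is open and dense in
the image of a polynomial map. -/
theorem isZariskiOpenDenseIn_of_range [Infinite F] {ι τ κ : Type*} {Y A : Set (ι → F)}
    (Ψ : ι → MvPolynomial τ F) (hY : ∀ p, p ∈ Y ↔ ∃ q : τ → F, p = fun i => eval q (Ψ i))
    (D : κ → MvPolynomial ι F) (hA : ∀ p, p ∈ A ↔ p ∈ Y ∧ ∃ s, eval p (D s) ≠ 0)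
    (hne : A.Nonempty) : IsZariskiOpenDenseIn Y A := by
  constructor
  · refine ⟨{p | ∀ f ∈ Set.range D, eval p f = 0}, ⟨Set.range D, rfl⟩, ?_⟩
    ext p
    rw [hA]
    simp
  · rintro Z ⟨S, rfl⟩ hAZ p hp f hf
    obtain ⟨q, rfl⟩ := (hY p).1 hp
    have ev : ∀ (g : MvPolynomial ι F) (q : τ → F),
        eval q (bind₁ Ψ g) = eval (fun i => eval q (Ψ i)) g := by
      intro g q
      simp only [← MvPolynomial.coe_aeval_eq_eval, RingHom.coe_coe, aeval_bind₁]
    obtain ⟨p₀, hp₀⟩ := hne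
    obtain ⟨hp₀Y, s, hs⟩ := (hA p₀).1 hp₀
    obtain ⟨q₀, rfl⟩ := (hY p₀).1 hp₀Y
    -- On the parameter space either `D s` vanishes or the image lies in `A`, where `f` vanishes.
    -- Polynomials over the infinite field `F` form a domain of functions, and `D s` is nonzero at
    -- `p₀`, so `f` vanishes on the whole image.
    have h0 : bind₁ Ψ f * bind₁ Ψ (D s) = 0 := by
      apply MvPolynomial.funext
      intro q'
      rw [map_mul, map_zero, ev, ev]
      by_cases hd : eval (fun i => eval q' (Ψ i)) (D s) = 0
      · rw [hd, mul_zero]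
      · rw [hAZ ((hA _).2 ⟨(hY _).2 ⟨q', rfl⟩, s, hd⟩) f hf, zero_mul]
    rw [← ev]
    rcases mul_eq_zero.1 h0 with h | h
    · rw [h, map_zero]
    · rw [← ev, h, map_zero] at hs
      exact absurd rfl hs

/-- The parameters with independent factors and independent minors. -/
def independentParams (F : Type*) [Field F] (n₁ n₂ n₃ R : ℕ) : Set (Params F n₁ n₂ n₃ R) :=
  {p | p ∈ paramVariety F n₁ n₂ n₃ R ∧ LinearIndependent F p.v ∧ LinearIndependent F p.w ∧
    MinorIndependent p.v}

/-! ### Independent parameters exist -/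

section Witness

variable {R m : ℕ}

/-- The vector `e_{2i} + j e_{2i+1}`. -/
def gridVec (F : Type*) [Field F] (n i j : ℕ) (I : Fin n) : F :=
  if (I : ℕ) / 2 = i then (if (I : ℕ) % 2 = 0 then 1 else (j : F)) else 0

/-- The matrix of rank one at the grid point `(a / m, a % m)`. -/
def gridMat (F : Type*) [Field F] (n₁ n₂ m : ℕ) (a : ℕ) : Mat F n₁ n₂ :=
  tmul₂ (gridVec F n₁ (a / m) (a % m)) (gridVec F n₂ (a % m) (a / m))

/-- The indicator of the grid point `(i, j)`. -/
def gridAt (F : Type*) [Field F] (m i j a : ℕ) : F := if a / m = i ∧ a % m = j then 1 else 0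

/-- The matrix of the grid point `(i, j)` occupies a single `2 × 2` block, where it is the product
of `(1, j)` and `(1, i)`. Different grid points have disjoint blocks. -/
theorem gridMat_apply {i j s t a : ℕ} (hs : s < 2) (ht : t < 2) {hI : 2 * i + s < n₁}
    {hJ : 2 * j + t < n₂} : gridMat F n₁ n₂ m a (⟨2 * i + s, hI⟩, ⟨2 * j + t, hJ⟩) =
      gridAt F m i j a * ((j : F) ^ s * (i : F) ^ t) := by
  have e1 : (2 * i + s) / 2 = i := by omega
  have e2 : (2 * j + t) / 2 = j := by omega
  have e3 : (2 * i + s) % 2 = s := by omega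
  have e4 : (2 * j + t) % 2 = t := by omega
  simp only [gridMat, tmul₂, gridVec, gridAt, e1, e2, e3, e4]
  by_cases h1 : a / m = i
  · by_cases h2 : a % m = j
    · interval_cases s <;> interval_cases t <;> simp [h1, h2]
    · simp [h1, h2, Ne.symm h2]
  · simp [h1, Ne.symm h1]

theorem grid_bounds (hR : R ≤ n₁ / 2 * (n₂ / 2)) {a : ℕ} (ha : a < R) :
    2 * (a / (n₂ / 2)) + 1 < n₁ ∧ 2 * (a % (n₂ / 2)) + 1 < n₂ := by
  have h1 : a < n₁ / 2 * (n₂ / 2) := by omega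
  have hm : 0 < n₂ / 2 := Nat.pos_of_ne_zero fun h => by rw [h] at h1; omega
  have h2 : a / (n₂ / 2) < n₁ / 2 := (Nat.div_lt_iff_lt_mul hm).2 h1
  have h3 := Nat.mod_lt a hm
  omega

theorem grid_inj {a b : ℕ} (h1 : a / m = b / m) (h2 : a % m = b % m) : a = b := by
  rw [← Nat.div_add_mod a m, ← Nat.div_add_mod b m, h1, h2]

theorem linearIndependent_gridMat (hR : R ≤ n₁ / 2 * (n₂ / 2)) :
    LinearIndependent F fun a : Fin R => gridMat F n₁ n₂ (n₂ / 2) a := by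
  rw [Fintype.linearIndependent_iff]
  intro g hg a
  obtain ⟨h1, h2⟩ := grid_bounds hR a.2
  have := congrFun hg (⟨2 * (a / (n₂ / 2)), by omega⟩, ⟨2 * (a % (n₂ / 2)), by omega⟩)
  simp only [Finset.sum_apply, Pi.smul_apply, smul_eq_mul, Pi.zero_apply] at this
  rw [Finset.sum_eq_single a] at this
  · simpa [gridMat, tmul₂, gridVec] using this
  · intro b _ hb
    have hne : ¬ ((a : ℕ) / (n₂ / 2) = b / (n₂ / 2) ∧ (a : ℕ) % (n₂ / 2) = b % (n₂ / 2)) :=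
      fun h => hb (Fin.ext (grid_inj h.1 h.2).symm)
    rw [not_and_or] at hne
    rcases hne with h | h <;> simp [gridMat, tmul₂, gridVec, h]
  · simp

theorem sum_minorPair (g : Fin R → Fin R → F) (v : Fin R → Mat F n₁ n₂) (I I' : Fin n₁)
    (J J' : Fin n₂) : (∑ a, ∑ b, g a b • minorPair F n₁ n₂ (v a) (v b)) (I, I', J, J') =
      ∑ a, ∑ b, (g a b + g b a) * (v a (I, J) * v b (I', J')) -
      ∑ a, ∑ b, (g a b + g b a) * (v a (I, J') * v b (I', J)) := by
  simp only [add_mul, Finset.sum_add_distrib]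
  rw [Finset.sum_comm (f := fun a b => g b a * (v a (I, J) * v b (I', J'))),
    Finset.sum_comm (f := fun a b => g b a * (v a (I, J') * v b (I', J)))]
  simp only [← Finset.sum_add_distrib, ← Finset.sum_sub_distrib, Finset.sum_apply, Pi.smul_apply,
    smul_eq_mul, minorPair_apply]
  exact Finset.sum_congr rfl fun _ _ => Finset.sum_congr rfl fun _ _ => by ring

/-- For grid points `(i, j)` and `(i', j')`, the minor on rows `2i + s`, `2i'` and columns `2j + t`,
`2j'` involves only the coefficient `W` of this pair and the coefficient `W'` of the pair `(i, j')`,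
`(i', j)`. It gives `W jˢ iᵗ = W' j'ˢ i'ᵗ`. The exponents `(0, 0)`, `(1, 0)`, `(0, 1)` yield `W =
W'`, `W j = W j'` and `W i = W i'`, so `W = 0` unless the points coincide. -/
theorem minorIndependent_gridMat [CharZero F] (hR : R ≤ n₁ / 2 * (n₂ / 2)) :
    MinorIndependent fun a : Fin R => gridMat F n₁ n₂ (n₂ / 2) a := by
  rw [MinorIndependent, Fintype.linearIndependent_iff]
  intro g hg q
  set m := n₂ / 2 with hm
  let c : Fin R → Fin R → F := fun a b => if h : a < b then g ⟨(a, b), h⟩ else 0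
  have hc : ∑ a, ∑ b, c a b • minorPair F n₁ n₂ (gridMat F n₁ n₂ m a) (gridMat F n₁ n₂ m b) = 0 := by
    rw [sum_symmetric c (fun a b : Fin R => minorPair F n₁ n₂ (gridMat F n₁ n₂ m a)
      (gridMat F n₁ n₂ m b)) fun a b => minorPair_comm _ _]
    rw [Finset.sum_eq_zero (s := Finset.univ) (f := fun a => c a a • _) fun a _ => by simp [c],
      add_zero, ← hg]
    refine Finset.sum_congr rfl fun q _ => ?_
    simp [c, q.2, not_lt.2 q.2.le]
  obtain ⟨⟨a, b⟩, hab⟩ := q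
  simp only at hab
  obtain ⟨a1, a2⟩ := grid_bounds hR a.2
  obtain ⟨b1, b2⟩ := grid_bounds hR b.2
  rw [← hm] at a1 a2 b1 b2
  let W : ℕ → ℕ → ℕ → ℕ → F := fun i j i' j' => ∑ a : Fin R, ∑ b : Fin R,
    (c a b + c b a) * (gridAt F m i j a * gridAt F m i' j' b)
  have key : ∀ s < 2, ∀ t < 2,
      W (a / m) (a % m) (b / m) (b % m) * (((a % m : ℕ) : F) ^ s * ((a / m : ℕ) : F) ^ t) =
      W (a / m) (b % m) (b / m) (a % m) * (((b % m : ℕ) : F) ^ s * ((b / m : ℕ) : F) ^ t) := by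
    intro s hs t ht
    have := (sum_minorPair c (fun a : Fin R => gridMat F n₁ n₂ m a) ⟨2 * (a / m) + s, by omega⟩
      ⟨2 * (b / m) + 0, by omega⟩ ⟨2 * (a % m) + t, by omega⟩
      ⟨2 * (b % m) + 0, by omega⟩).symm.trans (congrFun hc _)
    simp only [gridMat_apply hs ht, gridMat_apply hs two_pos, gridMat_apply two_pos ht,
      gridMat_apply two_pos two_pos, Pi.zero_apply] at this
    rw [sub_eq_zero] at this
    simp only [W, Finset.sum_mul]
    refine Eq.trans ?_ (this.trans ?_)
    · exact Finset.sum_congr rfl fun _ _ => Finset.sum_congr rfl fun _ _ => by ring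
    · exact Finset.sum_congr rfl fun _ _ => Finset.sum_congr rfl fun _ _ => by ring
  have hW : W (a / m) (a % m) (b / m) (b % m) = g ⟨(a, b), hab⟩ := by
    have e : ∀ d a' : Fin R, gridAt F m (d / m) (d % m) a' = if a' = d then 1 else 0 := by
      intro d a'
      rw [gridAt]
      congr 1
      rw [eq_iff_iff]
      exact ⟨fun h => Fin.ext (grid_inj h.1 h.2), by rintro rfl; exact ⟨rfl, rfl⟩⟩
    simp only [W, e]
    rw [Finset.sum_eq_single a, Finset.sum_eq_single b]
    · simp [c, hab, not_lt.2 hab.le]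
    · intro b' _ hb'
      simp [hb']
    · simp
    · intro a' _ ha'
      simp [ha']
    · simp
  rw [hW] at key
  have k0 := key 0 two_pos 0 two_pos
  have k1 := key 1 one_lt_two 0 two_pos
  have k2 := key 0 two_pos 1 one_lt_two
  simp only [pow_zero, pow_one, mul_one, one_mul] at k0 k1 k2
  rw [← k0] at k1 k2
  by_contra hne
  have e1 := Nat.cast_injective (mul_left_cancel₀ hne k1)
  have e2 := Nat.cast_injective (mul_left_cancel₀ hne k2)
  exact hab.ne (Fin.ext (grid_inj e2 e1))

theorem linearIndependent_unitVec (hR : R ≤ n₃) :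
    LinearIndependent F fun a : Fin R => fun k : Fin n₃ => if (k : ℕ) = a then (1 : F) else 0 := by
  rw [Fintype.linearIndependent_iff]
  intro g hg a
  have := congrFun hg ⟨a, a.2.trans_le hR⟩
  simpa [Finset.sum_apply, Fin.val_inj] using this

end Witness

/-- The polynomials in the parameters that give the entries of the matrices `v a`. -/
def genericV (F : Type*) [Field F] (n₁ n₂ n₃ R : ℕ) : Matrix (Fin R) (Fin n₁ × Fin n₂)
    (MvPolynomial (Fin R × (Fin n₁ × Fin n₂ ⊕ Fin n₃)) F) := Matrix.of fun a q => X (a, Sum.inl q)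

def genericW (F : Type*) [Field F] (n₁ n₂ n₃ R : ℕ) : Matrix (Fin R) (Fin n₃)
    (MvPolynomial (Fin R × (Fin n₁ × Fin n₂ ⊕ Fin n₃)) F) := Matrix.of fun a k => X (a, Sum.inr k)

def genericMinor (F : Type*) [Field F] (n₁ n₂ n₃ R : ℕ) :
    Matrix (Pairs R) (Fin n₁ × Fin n₁ × Fin n₂ × Fin n₂)
      (MvPolynomial (Fin R × (Fin n₁ × Fin n₂ ⊕ Fin n₃)) F) := Matrix.of fun s q =>
  genericV F n₁ n₂ n₃ R s.1.1 (q.1, q.2.2.1) * genericV F n₁ n₂ n₃ R s.1.2 (q.2.1, q.2.2.2) +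
  genericV F n₁ n₂ n₃ R s.1.2 (q.1, q.2.2.1) * genericV F n₁ n₂ n₃ R s.1.1 (q.2.1, q.2.2.2) -
  (genericV F n₁ n₂ n₃ R s.1.1 (q.1, q.2.2.2) * genericV F n₁ n₂ n₃ R s.1.2 (q.2.1, q.2.2.1) +
  genericV F n₁ n₂ n₃ R s.1.2 (q.1, q.2.2.2) * genericV F n₁ n₂ n₃ R s.1.1 (q.2.1, q.2.2.1))

/-- Independence of the values of a matrix of polynomials. -/
theorem linearIndependent_eval_iff {σ ι κ : Type*} [Fintype ι] [DecidableEq ι] [Fintype κ]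
    (N : Matrix ι κ (MvPolynomial σ F)) (p : σ → F) {v : ι → κ → F}
    (hv : ∀ i k, v i k = eval p (N i k)) :
    LinearIndependent F v ↔ ∃ f : ι → κ, eval p (N.submatrix id f).det ≠ 0 := by
  have e : v = fun i => N.map (eval p) i := by
    funext i k
    exact hv i k
  rw [e, linearIndependent_iff_exists_det]
  refine exists_congr fun f => ?_
  rw [RingHom.map_det]
  rfl

/-- Independent parameters are generic. -/
theorem isZariskiOpenDenseIn_independentParams [CharZero F] {R : ℕ}
    (hR : R ≤ n₁ / 2 * (n₂ / 2)) (hR' : R ≤ n₃) :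
    IsZariskiOpenDenseIn (paramVariety F n₁ n₂ n₃ R) (independentParams F n₁ n₂ n₃ R) := by
  let Ψ : Fin R × (Fin n₁ × Fin n₂ ⊕ Fin n₃) →
      MvPolynomial (Fin R × (Fin n₁ ⊕ Fin n₂ ⊕ Fin n₃)) F := fun s =>
    Sum.elim (fun q => X (s.1, Sum.inl q.1) * X (s.1, Sum.inr (Sum.inl q.2)))
      (fun k => X (s.1, Sum.inr (Sum.inr k))) s.2
  let D : (Fin R → Fin n₁ × Fin n₂) × (Fin R → Fin n₃) ×
      (Pairs R → Fin n₁ × Fin n₁ × Fin n₂ × Fin n₂) →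
      MvPolynomial (Fin R × (Fin n₁ × Fin n₂ ⊕ Fin n₃)) F := fun s =>
    ((genericV F n₁ n₂ n₃ R).submatrix id s.1).det *
      (((genericW F n₁ n₂ n₃ R).submatrix id s.2.1).det *
      ((genericMinor F n₁ n₂ n₃ R).submatrix id s.2.2).det)
  refine isZariskiOpenDenseIn_of_range Ψ (fun p => ?_) D (fun p => ?_) ?_
  · constructor
    · intro hp
      choose x y hxy using hp
      refine ⟨fun s => Sum.elim (x s.1) (Sum.elim (y s.1) (Params.w p s.1)) s.2, ?_⟩
      funext ⟨a, s⟩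
      rcases s with q | k
      · have : p (a, Sum.inl q) = tmul₂ (x a) (y a) q := congrFun (hxy a) q
        simpa [Ψ, tmul₂] using this
      · simp [Ψ, Params.w]
    · rintro ⟨q, rfl⟩ a
      refine ⟨fun i => q (a, Sum.inl i), fun j => q (a, Sum.inr (Sum.inl j)), ?_⟩
      funext s
      simp [Params.v, Ψ, tmul₂]
  · rw [independentParams, Set.mem_ofPred_eq]
    refine and_congr_right fun _ => ?_
    rw [linearIndependent_eval_iff (genericV F n₁ n₂ n₃ R) p
        (fun a q => by simp [genericV, Params.v]),
      linearIndependent_eval_iff (genericW F n₁ n₂ n₃ R) p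
        (fun a k => by simp [genericW, Params.w]),
      MinorIndependent, linearIndependent_eval_iff (genericMinor F n₁ n₂ n₃ R) p
        (fun s q => by
          obtain ⟨i, i', j, j'⟩ := q
          simp [genericMinor, genericV, Params.v, minorPair_apply])]
    simp only [D, map_mul, mul_ne_zero_iff, Prod.exists]
    constructor
    · rintro ⟨⟨f, hf⟩, ⟨g, hg⟩, ⟨e, he⟩⟩
      exact ⟨f, g, e, hf, hg, he⟩
    · rintro ⟨f, g, e, hf, hg, he⟩
      exact ⟨⟨f, hf⟩, ⟨g, hg⟩, ⟨e, he⟩⟩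
  · refine ⟨fun s => Sum.elim (gridMat F n₁ n₂ (n₂ / 2) s.1)
      (fun k : Fin n₃ => if (k : ℕ) = s.1 then 1 else 0) s.2,
      fun a => ⟨gridVec F n₁ (a / (n₂ / 2)) (a % (n₂ / 2)),
        gridVec F n₂ (a % (n₂ / 2)) (a / (n₂ / 2)), rfl⟩,
      linearIndependent_gridMat hR, linearIndependent_unitVec hR', minorIndependent_gridMat hR⟩

/-- The inequality `(n - 1) / 2 ≤ ⌊n / 2⌋` compares the bound on `R` with the number of grid points.
-/
theorem le_of_real_le {R : ℕ} (h1 : 0 < n₁) (h2 : 0 < n₂)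
    (h : (R : ℝ) ≤ min (1 / 4 * ((n₁ : ℝ) - 1) * ((n₂ : ℝ) - 1)) (n₃ : ℝ)) :
    R ≤ n₁ / 2 * (n₂ / 2) ∧ R ≤ n₃ := by
  obtain ⟨h3, h4⟩ := le_min_iff.1 h
  refine ⟨?_, by exact_mod_cast h4⟩
  have e : ∀ n : ℕ, (n : ℝ) - 1 ≤ 2 * ((n / 2 : ℕ) : ℝ) := by
    intro n
    have : n ≤ 2 * (n / 2) + 1 := by omega
    have : (n : ℝ) ≤ 2 * ((n / 2 : ℕ) : ℝ) + 1 := by exact_mod_cast this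
    linarith
  have g1 : (0 : ℝ) ≤ (n₁ : ℝ) - 1 := by
    have : (1 : ℝ) ≤ n₁ := by exact_mod_cast h1
    linarith
  have g2 : (0 : ℝ) ≤ (n₂ : ℝ) - 1 := by
    have : (1 : ℝ) ≤ n₂ := by exact_mod_cast h2
    linarith
  have := mul_le_mul (e n₁) (e n₂) g2 (by positivity)
  have h5 : (R : ℝ) ≤ ((n₁ / 2 * (n₂ / 2) : ℕ) : ℝ) := by
    push_cast
    nlinarith
  exact_mod_cast h5

namespace Algo

open Cmd

/-! ## The preparation: a basis of the span of the slices and the minors -/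

/-- Everything up to the reduction of the minors. -/
def prepare : Cmd :=
  seq sizes (seq sizesSq (seq basis (seq rankSize (seq rankSq (seq rankSizes minors)))))

/-- What holds after the preparation, for a span of the slices of dimension `R`. -/
structure Prepared (T : Tensor F n₁ n₂ n₃) (R : ℕ) (u : Fin R → Mat F n₁ n₂) (h : State F) :
    Prop where
  v0 : h.var 0 = n₁
  v1 : h.var 1 = n₂
  v2 : h.var 2 = n₃
  v3 : h.var 3 = 1
  v4 : h.var 4 = n₁ * n₂
  v5 : h.var 5 = n₁ * n₂ * (n₁ * n₂)
  v6 : h.var 6 = R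
  v7 : h.var 7 = R * R
  v8 : h.var 8 = R * R * (R * R)
  v9 : h.var 9 = R * R * (R * R) + R * R + 1
  v10 : h.var 10 = n₃ + R
  v32 : h.var 32 = 0
  v34 : h.var 34 = 0
  f0 : ∀ (i : Fin n₁) (j : Fin n₂) (k : Fin n₃), h.fld 0 i j k = T i j k
  f0' : ∀ i j k, n₃ ≤ k → h.fld 0 i j k = 0
  f32 : ∀ a j k, h.fld 32 a j k = 0
  f34 : ∀ a j k, h.fld 34 a j k = 0
  rank : Module.finrank F (sliceSpan T) = R
  hu : ∀ (a : Fin R) (i : Fin n₁) (j : Fin n₂), u a (i, j) = h.fld 0 i j (h.nat 30 a a a)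
  span : Submodule.span F (Set.range u) = sliceSpan T
  red : RedS 31 R R (n₁ * n₂ * (n₁ * n₂)) h (fun g =>
    ∑ a : Fin R, ∑ b : Fin R, g a b • minorPair F n₁ n₂ (u a) (u b) = 0) (n₁ * n₂ * (n₁ * n₂))
  minors : h.var 31 = Module.finrank F
    (Submodule.map₂ (minorPair F n₁ n₂) (sliceSpan T) (sliceSpan T))

theorem sizes_spec (O : DiagOracle F) (h : State F) :
    (sizes.den O h).var 3 = 1 ∧ (sizes.den O h).var 4 = h.var 0 * h.var 1 := by
  rw [sizes, den_seq]
  refine ⟨?_, ?_⟩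
  · rw [var_den O _ (by decide)]
    simp [den, State.setVar, NExpr.eval]
  · rw [mul_spec O (by norm_num) (by norm_num) (by norm_num) (by norm_num)]
    simp [den, State.setVar]

theorem rankSizes_spec (O : DiagOracle F) (h : State F) :
    (rankSizes.den O h).var 8 = h.var 7 * h.var 7 ∧
    (rankSizes.den O h).var 9 = h.var 7 * h.var 7 + h.var 7 + 1 ∧
    (rankSizes.den O h).var 10 = h.var 2 + h.var 6 := by
  rw [rankSizes, den_seq]
  have e8 : ((mul 8 7 7).den O h).var 8 = h.var 7 * h.var 7 :=
    mul_spec O (by norm_num) (by norm_num) (by norm_num) (by norm_num) h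
  have s := Same.of_den O [2, 6, 7] [] [] (c := mul 8 7 7) (by decide) h
  have e2 := s.var 2 (by decide)
  have e6 := s.var 6 (by decide)
  have e7 := s.var 7 (by decide)
  simp [den, State.setVar, NExpr.eval, e8, e2, e6, e7]

/-- The preparation finds a basis of the span of the slices and the rank of the minors on it. -/
theorem prepare_spec (O : DiagOracle F) (T : Tensor F n₁ n₂ n₃) :
    ∃ (R : ℕ) (u : Fin R → Mat F n₁ n₂), Prepared T R u (prepare.den O (inputState T)) := by
  set h0 : State F := inputState T with hh0
  have i0 : h0.var 0 = n₁ := rfl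
  have i1 : h0.var 1 = n₂ := rfl
  have i2 : h0.var 2 = n₃ := rfl
  have iz : ∀ a, a ≠ 0 → h0.fld a = fun _ _ _ => 0 := by
    intro a ha
    funext i j k
    simp [hh0, inputState, ha]
  have iT : ∀ (i : Fin n₁) (j : Fin n₂) (k : Fin n₃), h0.fld 0 i j k = T i j k := by
    intro i j k
    simp [hh0, inputState]
  have iT' : ∀ i j k, n₃ ≤ k → h0.fld 0 i j k = 0 := by
    intro i j k hk
    have : ¬ (i < n₁ ∧ j < n₂ ∧ k < n₃) := fun h => by omega
    simp [hh0, inputState, this]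
  simp only [prepare, den_seq]
  set h1 := sizes.den O h0 with hh1
  have s1 := Same.of_den O [0, 1, 2, 30, 31, 32, 34] [0, 30, 31, 32, 34] [] (c := sizes)
    (by decide) h0
  rw [← hh1] at s1
  obtain ⟨p3, p4⟩ := sizes_spec O h0
  rw [← hh1] at p3 p4
  set h2 := sizesSq.den O h1 with hh2
  have s2 := Same.of_den O [0, 1, 2, 3, 4, 30, 31, 32, 34] [0, 30, 31, 32, 34] [] (c := sizesSq)
    (by decide) h1
  rw [← hh2] at s2
  have p5 : h2.var 5 = h1.var 4 * h1.var 4 :=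
    mul_spec O (by norm_num) (by norm_num) (by norm_num) (by norm_num) h1
  have q0 : h2.var 0 = n₁ := by rw [s2.var 0 (by decide), s1.var 0 (by decide), i0]
  have q1 : h2.var 1 = n₂ := by rw [s2.var 1 (by decide), s1.var 1 (by decide), i1]
  have q2 : h2.var 2 = n₃ := by rw [s2.var 2 (by decide), s1.var 2 (by decide), i2]
  have q3 : h2.var 3 = 1 := by rw [s2.var 3 (by decide), p3]
  have q4 : h2.var 4 = n₁ * n₂ := by rw [s2.var 4 (by decide), p4, i0, i1]
  have q5 : h2.var 5 = n₁ * n₂ * (n₁ * n₂) := by rw [p5, p4, i0, i1]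
  have q30 : h2.var 30 = 0 := by rw [s2.var 30 (by decide), s1.var 30 (by decide)]; rfl
  have q31 : h2.var 31 = 0 := by rw [s2.var 31 (by decide), s1.var 31 (by decide)]; rfl
  have q32 : h2.var 32 = 0 := by rw [s2.var 32 (by decide), s1.var 32 (by decide)]; rfl
  have q34 : h2.var 34 = 0 := by rw [s2.var 34 (by decide), s1.var 34 (by decide)]; rfl
  have qT : h2.fld 0 = h0.fld 0 := by rw [s2.fld 0 (by decide), s1.fld 0 (by decide)]
  have qf30 : h2.fld 30 = fun _ _ _ => 0 := by
    rw [s2.fld 30 (by decide), s1.fld 30 (by decide), iz 30 (by decide)]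
  have qf31 : h2.fld 31 = fun _ _ _ => 0 := by
    rw [s2.fld 31 (by decide), s1.fld 31 (by decide), iz 31 (by decide)]
  have qf32 : h2.fld 32 = fun _ _ _ => 0 := by
    rw [s2.fld 32 (by decide), s1.fld 32 (by decide), iz 32 (by decide)]
  have qf34 : h2.fld 34 = fun _ _ _ => 0 := by
    rw [s2.fld 34 (by decide), s1.fld 34 (by decide), iz 34 (by decide)]
  have hb := basis_spec O (h := h2) q3 (by rw [q4, q0, q1]) q30 fun a j k => by rw [qf30]
  set h3 := basis.den O h2 with hh3
  have s3 := Same.of_den O [0, 1, 2, 3, 4, 5, 31, 32, 34] [0, 31, 32, 34] [] (c := basis)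
    (by decide) h2
  rw [← hh3] at s3
  rw [q0, q1, q2, q4, qT] at hb
  obtain ⟨hrank, hspan⟩ := basis_rank iT hb (hb.le.trans (le_of_eq (by ring)))
  set R := h3.var 30 with hR
  set h4 := rankSize.den O h3 with hh4
  have s4 := Same.of_den O [0, 1, 2, 3, 4, 5, 31, 32, 34] [0, 31, 32, 34] [30] (c := rankSize)
    (by decide) h3
  rw [← hh4] at s4
  have p6 : h4.var 6 = R := by simp [hh4, rankSize, den, State.setVar, NExpr.eval, hR]
  set h5 := rankSq.den O h4 with hh5
  have s5 := Same.of_den O [0, 1, 2, 3, 4, 5, 6, 31, 32, 34] [0, 31, 32, 34] [30] (c := rankSq)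
    (by decide) h4
  rw [← hh5] at s5
  have p7 : h5.var 7 = h4.var 6 * h4.var 6 :=
    mul_spec O (by norm_num) (by norm_num) (by norm_num) (by norm_num) h4
  set h6 := rankSizes.den O h5 with hh6
  have s6 := Same.of_den O [0, 1, 2, 3, 4, 5, 6, 7, 31, 32, 34] [0, 31, 32, 34] [30]
    (c := rankSizes) (by decide) h5
  rw [← hh6] at s6
  obtain ⟨p8, p9, p10⟩ := rankSizes_spec O h5
  rw [← hh6] at p8 p9 p10
  have v36 : ∀ x ∈ [0, 1, 2, 3, 4, 5, 31, 32, 34], h6.var x = h2.var x := by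
    intro x hx
    rw [s6.var x (by simp at hx ⊢; omega), s5.var x (by simp at hx ⊢; omega), s4.var x hx,
      s3.var x hx]
  have f36 : ∀ x ∈ [0, 31, 32, 34], h6.fld x = h2.fld x := by
    intro x hx
    rw [s6.fld x hx, s5.fld x hx, s4.fld x hx, s3.fld x hx]
  have n36 : h6.nat 30 = h3.nat 30 := by
    rw [s6.nat 30 (by decide), s5.nat 30 (by decide), s4.nat 30 (by decide)]
  have r6 : h6.var 6 = R := by rw [s6.var 6 (by decide), s5.var 6 (by decide), p6]
  have r7 : h5.var 7 = R * R := by rw [p7, p6]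
  have hm := minors_spec O (h := h6) (by rw [v36 3 (by decide), q3])
    (by rw [v36 5 (by decide), v36 0 (by decide), v36 1 (by decide), q5, q0, q1])
    (by rw [v36 31 (by decide), q31]) (fun a j k => by rw [f36 31 (by decide), qf31])
  set h7 := minors.den O h6 with hh7
  have s7 := Same.of_den O [0, 1, 2, 3, 4, 5, 6, 7, 8, 9, 10, 32, 34] [0, 32, 34] [30]
    (c := Algo.minors) (by decide) h6
  rw [← hh7] at s7
  rw [v36 0 (by decide), v36 1 (by decide), v36 5 (by decide), r6, q0, q1, q5,
    f36 0 (by decide), qT, n36] at hm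
  let u : Fin R → Mat F n₁ n₂ := fun a q => h0.fld 0 q.1 q.2 (h3.nat 30 a a a)
  have hu : ∀ (a : Fin R) (i : Fin n₁) (j : Fin n₂), u a (i, j) = h0.fld 0 i j (h3.nat 30 a a a) :=
    fun a i j => rfl
  have hsp : Submodule.span F (Set.range u) = sliceSpan T := hspan u hu
  have f7 : h7.fld 0 = h0.fld 0 := by rw [s7.fld 0 (by decide), f36 0 (by decide), qT]
  have n7 : h7.nat 30 = h3.nat 30 := by rw [s7.nat 30 (by decide), n36]
  refine ⟨R, u, ?_⟩
  constructor
  · rw [s7.var 0 (by decide), v36 0 (by decide), q0]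
  · rw [s7.var 1 (by decide), v36 1 (by decide), q1]
  · rw [s7.var 2 (by decide), v36 2 (by decide), q2]
  · rw [s7.var 3 (by decide), v36 3 (by decide), q3]
  · rw [s7.var 4 (by decide), v36 4 (by decide), q4]
  · rw [s7.var 5 (by decide), v36 5 (by decide), q5]
  · rw [s7.var 6 (by decide), r6]
  · rw [s7.var 7 (by decide), s6.var 7 (by decide), r7]
  · rw [s7.var 8 (by decide), p8, r7]
  · rw [s7.var 9 (by decide), p9, r7]
  · rw [s7.var 10 (by decide), p10, s5.var 2 (by decide), s4.var 2 (by decide),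
      s3.var 2 (by decide), q2, s5.var 6 (by decide), p6]
  · rw [s7.var 32 (by decide), v36 32 (by decide), q32]
  · rw [s7.var 34 (by decide), v36 34 (by decide), q34]
  · rw [f7]; exact iT
  · rw [f7]; exact iT'
  · intro a j k
    rw [s7.fld 32 (by decide), f36 32 (by decide), qf32]
  · intro a j k
    rw [s7.fld 34 (by decide), f36 34 (by decide), qf34]
  · exact hrank.symm
  · rw [f7, n7]; exact hu
  · exact hsp
  · exact Red.congr_ker hm (fun g => minors_ker (t := h0.fld 0) (p := fun a => h3.nat 30 a a a) hu g) (by ring)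
  · have := minors_rank hu hm
    rw [hsp] at this
    exact this

/-! ## Soundness -/

/-- The output has been compared with `T` entry by entry, its length is the dimension of the span of
the slices, and the rank of the minors has been tested; `isCertified_of_finrank` needs nothing else.
-/
theorem sound (h2 : (2 : F) ≠ 0) (O : DiagOracle F) {T : Tensor F n₁ n₂ n₃} {R : ℕ}
    {u : Fin R → Mat F n₁ n₂} {h : State F} (hp : Prepared T R u h)
    (hf : (finish.den O (decompose.den O h)).var 0 ≠ 0) :
    (finish.den O (decompose.den O h)).var 1 = R ∧
    IsCertified T (fun a : Fin R =>
      tmul₂ (fun i : Fin n₁ => (finish.den O (decompose.den O h)).fld 1 a i 0)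
        (fun j : Fin n₂ => (finish.den O (decompose.den O h)).fld 2 a j 0))
      (fun (a : Fin R) (k : Fin n₃) => (finish.den O (decompose.den O h)).fld 3 a k 0) := by
  set g := decompose.den O h with hg
  have s := Same.of_den O [0, 1, 2, 6, 7, 31] [0] [] (c := decompose) (by decide) h
  rw [← hg] at s
  have sf := Same.of_den O [] [1, 2, 3] [] (c := finish) (by decide) g
  obtain ⟨f1, f2⟩ := finish_spec O g
  obtain ⟨g1, g2⟩ := f1.1 hf
  rw [f2 hf, s.var 6 (by decide), hp.v6, sf.fld 1 (by decide), sf.fld 2 (by decide),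
    sf.fld 3 (by decide)]
  refine ⟨rfl, isCertified_of_finrank h2 ?_ (fun a => ⟨_, _, rfl⟩) hp.rank ?_⟩
  · simp only [decompose, den_seq] at hg
    -- How the output was found is irrelevant: only `verify`, the last command, is examined.
    generalize writeY.den O (writeX.den O (pivots.den O (writeW.den O (solveW.den O
      (oracle.den O (search.den O (algebra.den O h))))))) = g' at hg
    have s' := Same.of_den O [0, 1, 2, 6] [0, 1, 2, 3] [] (c := verify) (by decide) g'
    rw [← hg] at s'
    have hv := (verify_spec O g').1 (by rw [← hg]; exact g1)
    rw [← s'.var 0 (by decide), ← s'.var 1 (by decide), ← s'.var 2 (by decide),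
      ← s'.var 6 (by decide), ← s'.fld 0 (by decide), ← s'.fld 1 (by decide),
      ← s'.fld 2 (by decide), ← s'.fld 3 (by decide), s.var 0 (by decide), s.var 1 (by decide),
      s.var 2 (by decide), s.var 6 (by decide), s.fld 0 (by decide), hp.v0, hp.v1, hp.v2,
      hp.v6] at hv
    funext i j k
    rw [← hp.f0, hv i i.2 j j.2 k k.2, Finset.sum_range]
    simp [Finset.sum_apply, tmulMat, tmul₂]
  · rw [s.var 31 (by decide), s.var 6 (by decide), s.var 7 (by decide), hp.v6, hp.v7] at g2
    rw [← hp.minors]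
    linarith [sq R]

/-! ## Completeness -/

open Matrix in
theorem exists_dual_bases {R : ℕ} {v u : Fin R → Mat F n₁ n₂} (hv : LinearIndependent F v)
    (h : Submodule.span F (Set.range u) = Submodule.span F (Set.range v)) :
    ∃ A P : Matrix (Fin R) (Fin R) F, Aᵀ * P = 1 ∧ (∀ a, u a = ∑ c, A a c • v c) ∧
      ∀ c, ∑ a, P a c • u a = v c := by
  have h1 : ∀ a, ∃ c : Fin R → F, ∑ b, c b • v b = u a := fun a =>
    Submodule.mem_span_range_iff_exists_fun F |>.1 (h ▸ Submodule.subset_span ⟨a, rfl⟩)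
  have h2 : ∀ a, ∃ c : Fin R → F, ∑ b, c b • u b = v a := fun a =>
    Submodule.mem_span_range_iff_exists_fun F |>.1 (h ▸ Submodule.subset_span ⟨a, rfl⟩)
  choose A hA using h1
  choose P hP using h2
  refine ⟨Matrix.of A, (Matrix.of P)ᵀ, ?_, fun a => (hA a).symm, hP⟩
  have key : Matrix.of P * Matrix.of A = 1 := by
    ext c d
    rw [← sub_eq_zero]
    refine Fintype.linearIndependent_iff.1 hv
      (fun d => (Matrix.of P * Matrix.of A) c d - (1 : Matrix (Fin R) (Fin R) F) c d) ?_ d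
    simp only [sub_smul, Finset.sum_sub_distrib, Matrix.mul_apply, Matrix.of_apply,
      Finset.sum_smul, mul_smul, Matrix.one_apply, ite_smul, one_smul, zero_smul,
      Finset.sum_ite_eq, Finset.mem_univ, if_true]
    rw [Finset.sum_comm]
    simp only [← Finset.smul_sum, hA, hP, sub_self]
  rw [← transpose_mul, key, transpose_one]

open Matrix in
theorem oracle_valid {O : DiagOracle F} (hO : O.IsValid) {h : State F} {R : ℕ} (h6 : h.var 6 = R)
    (hd : ∃ (P : Matrix (Fin R) (Fin R) F) (d : Fin R → F), IsUnit P.det ∧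
      toMat R (fun i j => h.fld 10 i j 0) * P = P * diagonal d) :
    ∃ (Q : Matrix (Fin R) (Fin R) F) (δ : Fin R → F), IsUnit Q.det ∧
      toMat R (fun i j => h.fld 10 i j 0) * Q = Q * diagonal δ ∧
      ∀ i j : Fin R, (oracle.den O h).fld 11 i j 0 = Q i j := by
  subst h6
  obtain ⟨h1, h2⟩ := hO _ (h.readMatrix 10 (h.var 6)) hd
  exact ⟨_, _, h1, h2, oracle_spec O h⟩

open Matrix in
-- With a planted decomposition the algebra is diagonal in the basis `P`, some trial is good, and
-- the eigenvectors returned by the oracle describe the `v a` up to order and scale. It remains to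
-- see that the factors read off from them pass the check.
theorem complete [CharZero F] {O : DiagOracle F} (hO : O.IsValid) {T : Tensor F n₁ n₂ n₃} {R : ℕ}
    {u : Fin R → Mat F n₁ n₂} {h : State F} (hp : Prepared T R u h)
    {v : Fin R → Mat F n₁ n₂} {w : Fin R → Fin n₃ → F} (hT : T = ∑ a, tmulMat (v a) (w a))
    (hv : LinearIndependent F v) (hr : ∀ a, v a ∈ rankOneVariety F n₁ n₂)
    (hm : MinorIndependent v) :
    (finish.den O (decompose.den O h)).var 0 ≠ 0 := by
  have hs : sliceSpan T = Submodule.span F (Set.range v) := by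
    have := (independent_of_finrank (v := v) (w := w) (by rw [← hT]; exact hp.rank)).1
    rwa [← hT] at this
  obtain ⟨A, P, hAP, hA, hP⟩ := exists_dual_bases hv (hp.span.trans hs)
  set g := decompose.den O h with hg
  have s := Same.of_den O [6, 7, 31] [] [] (c := decompose) (by decide) h
  rw [← hg] at s
  refine (finish_spec O g).1.2 ⟨?_, ?_⟩
  swap
  · rw [s.var 31 (by decide), s.var 6 (by decide), s.var 7 (by decide), hp.v6, hp.v7, hp.minors, hs]
    have := (minorIndependent_iff hr).1 hm
    linarith [sq R]
  -- the algebra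
  have hK31 : ∀ g : ℕ → ℕ → F, ∑ a : Fin R, ∑ b : Fin R, g a b • minorPair F n₁ n₂ (u a) (u b) = 0 ↔
      (Aᵀ * (toMat R g + (toMat R g)ᵀ) * A).IsDiag := fun g =>
    minors_ker_iff hr hm hA (toMat R g)
  have ha := algebra_spec O (h := h) hp.v3 (by rw [hp.v7, hp.v6]) (by rw [hp.v8, hp.v7]) hp.v32 hp.f32
  simp only [decompose, den_seq] at hg
  set g1 := algebra.den O h with hg1
  have s1 := Same.of_den O [0, 1, 2, 3, 4, 6, 8, 9, 10, 34] [0, 34] [30] (c := algebra) (by decide) h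
  rw [← hg1] at s1
  rw [hp.v6, hp.v5, hp.v8] at ha
  have ha' := Red.congr_ker ha (fun M => algebra_ker two_ne_zero hp.red hp.red.le hAP hK31 M)
    (show _ = R * R * (R * R) by ring)
  obtain ⟨t₀, ht₀, hgood⟩ := exists_good ha' ha'.le hAP fun M => Iff.rfl
  -- the search
  have e16 : g1.var 6 = R := by rw [s1.var 6 (by decide), hp.v6]
  have e18 : g1.var 8 = R * R * (R * R) := by rw [s1.var 8 (by decide), hp.v8]
  obtain ⟨t, ht, hMt⟩ := search_spec O (h := g1) (by rw [s1.var 3 (by decide), hp.v3]) (t₀ := t₀)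
    (by rw [s1.var 9 (by decide), hp.v9]; exact ht₀) (by rw [e16, e18]; exact hgood)
  rw [e16, e18] at ht hMt
  set g2 := search.den O g1 with hg2
  have s2 := Same.of_den O [0, 1, 2, 3, 4, 6, 10, 34] [0, 34] [30] (c := search) (by decide) g1
  rw [← hg2] at s2
  have hM := eq_conj_of_isDiag hAP (ha'.ker_proj ha'.le (powers R t))
  have hμ := injective_of_good hAP ht hM
  generalize (fun c => (Aᵀ * toMat R (proj R R (R * R * (R * R)) (g1.fld 32)
    (fun a => g1.nat 32 a a a) (fun a => g1.nat 42 a a a) (powers R t)) * P) c c) = μ at hM hμ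
  have hM2 : toMat R (fun i j => g2.fld 10 i j 0) = P * diagonal μ * Aᵀ := by
    rw [← hM]
    ext i j
    exact hMt i i.2 j j.2
  -- the oracle
  have hPdet : IsUnit P.det := by
    rw [← Matrix.isUnit_iff_isUnit_det]
    exact IsUnit.of_mul_eq_one_right _ hAP
  obtain ⟨Q, δ, hQ, hMQ, hQ11⟩ := oracle_valid hO (h := g2) (R := R)
    (by rw [s2.var 6 (by decide), e16])
    ⟨P, μ, hPdet, by rw [hM2, Matrix.mul_assoc, hAP, Matrix.mul_one]⟩
  obtain ⟨σ, β, hβ, hσ⟩ := eigenvectors_eq hAP hM2 hμ hQ hMQ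
  set g3 := oracle.den O g2 with hg3
  have s3 := Same.of_den O [0, 1, 2, 3, 4, 6, 10, 34] [0, 34] [30] (c := oracle) (by decide) g2
  rw [← hg3] at s3
  have k3 : Same [0, 1, 2, 3, 4, 6, 10, 34] [0, 34] [30] h g3 :=
    ⟨fun x hx => by
      rw [s3.var x hx, s2.var x hx, s1.var x (by simp at hx ⊢; omega)],
     fun x hx => by rw [s3.fld x hx, s2.fld x hx, s1.fld x hx],
     fun x hx => by rw [s3.nat x hx, s2.nat x hx, s1.nat x hx]⟩
  -- The matrices that the eigenvectors describe; the order `σ` and the scalars `β` are the oracle's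
  -- choice. The scalars are compensated in `w'`.
  let V : Fin R → Mat F n₁ n₂ := fun c => β c • v (σ c)
  have hV : ∀ (c : Fin R) (i : Fin n₁) (j : Fin n₂), vVal g3 c i j = V c (i, j) := by
    intro c i j
    rw [vVal, k3.var 6 (by decide), hp.v6, k3.fld 0 (by decide), k3.nat 30 (by decide),
      Finset.sum_range]
    have : ∀ a : Fin R, g3.fld 11 a c 0 * h.fld 0 i j (h.nat 30 a a a) =
        β c * (P a (σ c) * u a (i, j)) := fun a => by rw [hQ11, hσ, hp.hu, mul_assoc]
    simp only [this, ← Finset.mul_sum]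
    simp only [V, Pi.smul_apply, smul_eq_mul, ← hP (σ c), Finset.sum_apply]
  have hVli : LinearIndependent F V := by
    have := (hv.comp σ σ.injective).units_smul fun c => Units.mk0 (β c) (hβ c)
    exact this
  let w' : Fin R → Fin n₃ → F := fun c => (β c)⁻¹ • w (σ c)
  have hTV : ∀ i j k, T i j k = ∑ c, V c (i, j) * w' c k := by
    intro i j k
    rw [hT, ← Equiv.sum_comp σ]
    simp only [Finset.sum_apply, tmulMat, V, w', Pi.smul_apply, smul_eq_mul]
    refine Finset.sum_congr rfl fun c _ => ?_
    have := hβ c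
    field_simp
  -- the linear system
  have f3 : ∀ (i : Fin n₁) (j : Fin n₂) (k : Fin n₃), g3.fld 0 i j k = T i j k := by
    rw [k3.fld 0 (by decide)]; exact hp.f0
  have hw := solveW_spec O (h := g3) (by rw [k3.var 3 (by decide), hp.v3])
    (by rw [k3.var 4 (by decide), k3.var 0 (by decide), k3.var 1 (by decide), hp.v4, hp.v0, hp.v1])
    (by rw [k3.var 10 (by decide), k3.var 2 (by decide), k3.var 6 (by decide), hp.v10, hp.v2, hp.v6])
    (by rw [k3.var 34 (by decide), hp.v34])
    (fun a j k => by rw [k3.fld 34 (by decide), hp.f34])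
    (fun i j k hk => by
      rw [k3.fld 0 (by decide)]
      exact hp.f0' i j k (by rwa [k3.var 2 (by decide), hp.v2] at hk))
  set g4 := solveW.den O g3 with hg4
  have s4 := Same.of_den O [0, 1, 2, 3, 4, 6] [0, 11] [30] (c := solveW) (by decide) g3
  rw [← hg4] at s4
  rw [k3.var 0 (by decide), k3.var 1 (by decide), k3.var 2 (by decide), k3.var 4 (by decide),
    k3.var 6 (by decide), hp.v0, hp.v1, hp.v2, hp.v4, hp.v6] at hw
  have hK34 : ∀ g : ℕ → ℕ → F, (∀ i < n₁, ∀ j < n₂, dot (n₃ + R) 1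
      (fun m _ => augRow n₃ (g3.fld 0 i j) (fun c => vVal g3 c i j) m) g = 0) ↔
      ∀ c : Fin R, ∑ k : Fin n₃, w' c k * g k 0 + g (n₃ + c) 0 = 0 := by
    intro g
    have e : ∀ (i : Fin n₁) (j : Fin n₂), dot (n₃ + R) 1
        (fun m _ => augRow n₃ (g3.fld 0 i j) (fun c => vVal g3 c i j) m) g =
        (∑ c, (∑ k : Fin n₃, w' c k * g k 0 + g (n₃ + c) 0) • V c) (i, j) := by
      intro i j
      rw [dot_augRow]
      simp only [f3, hV, hTV, Finset.sum_apply, Pi.smul_apply, smul_eq_mul, add_mul,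
        Finset.sum_add_distrib, Finset.sum_mul]
      congr 1
      · rw [Finset.sum_comm]
        exact Finset.sum_congr rfl fun _ _ => Finset.sum_congr rfl fun _ _ => by ring
      · exact Finset.sum_congr rfl fun _ _ => by ring
    constructor
    · intro hg
      refine Fintype.linearIndependent_iff.1 hVli _ ?_
      funext ⟨i, j⟩
      rw [← e]
      exact hg i i.2 j j.2
    · intro hg i hi j hj
      have := e ⟨i, hi⟩ ⟨j, hj⟩
      simp only [hg, zero_smul, Finset.sum_const_zero, Pi.zero_apply] at this
      exact this
  have hW := solve_eq hw (hw.le.trans (le_of_eq (by ring))) hK34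
  have k4 : Same [0, 1, 2, 3, 4, 6] [0] [30] h g4 :=
    ⟨fun x hx => by rw [s4.var x hx, k3.var x (by simp at hx ⊢; omega)],
     fun x hx => by rw [s4.fld x (by simp at hx ⊢; omega), k3.fld x (by simp at hx ⊢; omega)],
     fun x hx => by rw [s4.nat x hx, k3.nat x hx]⟩
  have hW5 := writeW_spec O (h := g4) (by rw [k4.var 3 (by decide), hp.v3])
  set g5 := writeW.den O g4 with hg5
  have s5 := Same.of_den O [0, 1, 2, 3, 6] [0, 11] [30] (c := writeW) (by decide) g4
  rw [← hg5] at s5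
  have w5 : ∀ (c : Fin R) (k : Fin n₃), g5.fld 3 c k 0 = w' c k := by
    intro c k
    rw [hW5 c (by rw [k4.var 6 (by decide), hp.v6]; exact c.2) k
      (by rw [k4.var 2 (by decide), hp.v2]; exact k.2), k4.var 4 (by decide), k4.var 2 (by decide),
      hp.v4, hp.v2]
    exact hW c k
  -- the pivots
  have sub : ∀ {a b : State F}, Same [0, 1, 2, 3, 6] [0, 11] [30] a b → Same [6] [0, 11] [30] a b :=
    fun H => ⟨fun x hx => H.var x (by simp at hx; simp [hx]), H.fld, H.nat⟩
  have s4' : Same [0, 1, 2, 3, 6] [0, 11] [30] g3 g4 :=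
    ⟨fun x hx => s4.var x (by simp at hx ⊢; omega), s4.fld, s4.nat⟩
  have k4' : ∀ x ∈ [0, 1, 2, 3, 6], g4.var x = h.var x := fun x hx =>
    k4.var x (by simp at hx ⊢; omega)
  have hV5 : ∀ (c : Fin R) (i : Fin n₁) (j : Fin n₂), vVal g5 c i j = V c (i, j) := by
    intro c i j
    rw [vVal_same (sub s5), vVal_same (sub s4'), hV]
  have hpv := pivots_spec O (h := g5) (by rw [s5.var 3 (by decide), k4' 3 (by decide), hp.v3])
  set g6 := pivots.den O g5 with hg6
  have s6 := Same.of_den O [0, 1, 2, 3, 6] [0, 11] [30] (c := pivots) (by decide) g5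
  rw [← hg6] at s6
  have s6' := Same.of_den O [] [3] [] (c := pivots) (by decide) g5
  rw [← hg6] at s6'
  have b5 : ∀ x ∈ [0, 1, 2, 3, 6], g5.var x = h.var x := fun x hx => by
    rw [s5.var x hx, k4' x hx]
  rw [b5 0 (by decide), b5 1 (by decide), b5 6 (by decide), hp.v0, hp.v1, hp.v6] at hpv
  have hpv' : ∀ c : Fin R, ∃ (i : Fin n₁) (j : Fin n₂), g6.nat 50 c c c = i ∧ g6.nat 51 c c c = j ∧
      V c (i, j) ≠ 0 := by
    intro c
    have hne : ∃ i < n₁, ∃ j < n₂, vVal g5 c i j ≠ 0 := by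
      by_contra! h0
      refine hVli.ne_zero c ?_
      funext ⟨i, j⟩
      rw [← hV5]
      exact h0 i i.2 j j.2
    obtain ⟨c1, c2, c3⟩ := hpv c c.2 hne
    exact ⟨⟨_, c1⟩, ⟨_, c2⟩, rfl, rfl, by rw [← hV5]; exact c3⟩
  -- the factors
  have hX := writeX_spec O (h := g6) (by rw [s6.var 3 (by decide), b5 3 (by decide), hp.v3])
  set g7 := writeX.den O g6 with hg7
  have s7 := Same.of_den O [0, 1, 2, 3, 6] [0, 11] [30] (c := writeX) (by decide) g6
  rw [← hg7] at s7
  have s7' := Same.of_den O [] [3] [50, 51] (c := writeX) (by decide) g6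
  rw [← hg7] at s7'
  have b6 : ∀ x ∈ [0, 1, 2, 3, 6], g6.var x = h.var x := fun x hx => by
    rw [s6.var x hx, b5 x hx]
  have b7 : ∀ x ∈ [0, 1, 2, 3, 6], g7.var x = h.var x := fun x hx => by
    rw [s7.var x hx, b6 x hx]
  have hY := writeY_spec O (h := g7) (by rw [b7 3 (by decide), hp.v3])
  set g8 := writeY.den O g7 with hg8
  have s8 := Same.of_den O [0, 1, 2, 3, 6] [0, 11] [30] (c := writeY) (by decide) g7
  rw [← hg8] at s8
  have s8' := Same.of_den O [] [1, 3] [] (c := writeY) (by decide) g7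
  rw [← hg8] at s8'
  have b8 : ∀ x ∈ [0, 1, 2, 3, 6], g8.var x = h.var x := fun x hx => by
    rw [s8.var x hx, b7 x hx]
  have hV6 : ∀ (c : Fin R) (i : Fin n₁) (j : Fin n₂), vVal g6 c i j = V c (i, j) := by
    intro c i j
    rw [vVal_same (sub s6), hV5]
  have hV7 : ∀ (c : Fin R) (i : Fin n₁) (j : Fin n₂), vVal g7 c i j = V c (i, j) := by
    intro c i j
    rw [vVal_same (sub s7), hV6]
  rw [hg]
  refine (verify_spec O g8).2 ?_
  rw [b8 0 (by decide), b8 1 (by decide), b8 2 (by decide), b8 6 (by decide), hp.v0, hp.v1, hp.v2,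
    hp.v6]
  have f8 : g8.fld 0 = h.fld 0 := by
    rw [s8.fld 0 (by decide), s7.fld 0 (by decide), s6.fld 0 (by decide), s5.fld 0 (by decide),
      k4.fld 0 (by decide)]
  intro i hi j hj k hk
  rw [f8, hp.f0 ⟨i, hi⟩ ⟨j, hj⟩ ⟨k, hk⟩, hTV, Finset.sum_range]
  refine Finset.sum_congr rfl fun c _ => ?_
  obtain ⟨i', j', c1, c2, c3⟩ := hpv' c
  have hx : g8.fld 1 c i 0 = V c (⟨i, hi⟩, j') := by
    rw [s8'.fld 1 (by decide), hX c (by rw [b6 6 (by decide), hp.v6]; exact c.2) i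
      (by rwa [b6 0 (by decide), hp.v0]), c2]
    exact hV6 c ⟨i, hi⟩ j'
  have hy : g8.fld 2 c j 0 = V c (i', ⟨j, hj⟩) / V c (i', j') := by
    rw [hY c (by rw [b7 6 (by decide), hp.v6]; exact c.2) j
      (by rwa [b7 1 (by decide), hp.v1]), s7'.nat 50 (by decide), s7'.nat 51 (by decide), c1, c2,
      hV7, ← hV7 c i' ⟨j, hj⟩]
  have hz : g8.fld 3 c k 0 = w' c ⟨k, hk⟩ := by
    rw [s8'.fld 3 (by decide), s7'.fld 3 (by decide), s6'.fld 3 (by decide)]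
    exact w5 c ⟨k, hk⟩
  rw [hx, hy, hz]
  congr 1
  -- `V c` has rank one, so with a nonzero entry at `(i', j')` it is the product of its column `j'`
  -- and its row `i'` divided by that entry.
  obtain ⟨x, y, hxy⟩ := hr (σ c)
  simp only [V, hxy, Pi.smul_apply, smul_eq_mul, tmul₂] at c3 ⊢
  have hβc := hβ c
  have hxi : x i' ≠ 0 := fun h0 => c3 (by rw [h0]; ring)
  have hyj : y j' ≠ 0 := fun h0 => c3 (by rw [h0]; ring)
  field_simp

end Algo

/-! ## The number of steps -/

/-- The cost of getting from the state `s` to the state `s'`. -/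
def Cost (K d B H : ℕ) (s s' : State F) : Prop :=
  s'.time ≤ s.time + K * B ^ d * H ∧ s'.calls ≤ s.calls + K

theorem Cost.trans {K d K' d' B H : ℕ} (hB : 1 ≤ B) {s s' s'' : State F}
    (h : Cost K d B H s s') (h' : Cost K' d' B H s' s'') : Cost (K + K') (d + d') B H s s'' := by
  refine ⟨h'.1.trans ((Nat.add_le_add_right h.1 _).trans ?_), h'.2.trans ?_⟩
  · rw [add_assoc, add_mul, add_mul]
    gcongr <;> omega
  · have := h.2
    omega

namespace Algo

open Cmd

/-- Run one part of the algorithm. -/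
theorem exists_cost (F : Type*) [Field F] {c : Cmd} (hw : c.wf = true) {S L : List ℕ}
    (hc : c.compile.tame S L true true = true) (hS : ∀ x ∈ S, x < 100) (hL : ∀ x ∈ L, x < 100) :
    ∃ K d : ℕ, ∀ (O : DiagOracle F) (s h : State F) (B H : ℕ), Agree 0 0 s h → 1 ≤ B → 1 ≤ H →
      (∀ x ∈ S, h.var x ≤ B) → (∀ x ∈ L, h.var x ≤ H) →
      Agree 0 0 (c.compile.run O s) (c.den O h) ∧ Cost K d B H s (c.compile.run O s) := by
  obtain ⟨K, d, hK⟩ := Program.tame_time (F := F) _ hc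
  refine ⟨K, d, fun O s h B H hA hB hH h1 h2 => ⟨Cmd.compile_spec O c hw hA, ?_⟩⟩
  exact hK O s B H hB hH (fun x hx => by rw [hA.var x (by have := hS x hx; omega)]; exact h1 x hx)
    (fun x hx => by rw [hA.var x (by have := hL x hx; omega)]; exact h2 x hx)

theorem run_seq (O : DiagOracle F) (c c' : Cmd) (s : State F) :
    (seq c c').compile.run O s = c'.compile.run O (c.compile.run O s) := rfl

/-- The algorithm. -/
def main : Cmd := seq sizes (seq sizesSq (seq basis (seq rankSize (seq rankSq (seq rankSizes
  (seq Algo.minors (seq decompose finish)))))))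

/-- The bounds on the sizes in the variables. -/
theorem Prepared.bounds {T : Tensor F n₁ n₂ n₃} {R : ℕ} {u : Fin R → Mat F n₁ n₂} {h : State F}
    (hp : Prepared T R u h) (h1 : 0 < n₁) (h2 : 0 < n₂) (h3 : 0 < n₃) :
    (∀ x ∈ [0, 1, 3, 4, 5, 6, 7, 8, 9], h.var x ≤ 3 * (n₁ * n₂) ^ 4) ∧
    ∀ x ∈ [2, 10], h.var x ≤ 2 * (n₁ * n₂) * n₃ := by
  have hR : R ≤ n₁ * n₂ := by
    rw [← hp.rank]
    refine (Submodule.finrank_le _).trans (le_of_eq ?_)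
    simp
  have hN : 1 ≤ n₁ * n₂ := Nat.mul_pos h1 h2
  have hn1 : n₁ ≤ n₁ * n₂ := Nat.le_mul_of_pos_right _ h2
  have hn2 : n₂ ≤ n₁ * n₂ := Nat.le_mul_of_pos_left _ h1
  set N := n₁ * n₂ with hNdef
  have hRR : R * R ≤ N * N := Nat.mul_le_mul hR hR
  have hR4 : R * R * (R * R) ≤ N * N * (N * N) := Nat.mul_le_mul hRR hRR
  have e4 : N ^ 4 = N * N * (N * N) := by ring
  have hN2 : N ≤ N * N := Nat.le_mul_of_pos_left _ hN
  have hN4 : N * N ≤ N * N * (N * N) := Nat.le_mul_of_pos_left _ (Nat.mul_pos hN hN)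
  have g1 : N ≤ N * n₃ := Nat.le_mul_of_pos_right _ h3
  have g2 : n₃ ≤ N * n₃ := Nat.le_mul_of_pos_left _ hN
  have g3 : 2 * N * n₃ = 2 * (N * n₃) := mul_assoc _ _ _
  -- The largest sizes are the number of trials, `R⁴ + R² + 1 ≤ 3 N⁴`, and `n₃ + R ≤ 2 N n₃`.
  constructor
  · intro x hx
    rw [e4]
    fin_cases hx <;> simp only [hp.v0, hp.v1, hp.v3, hp.v4, hp.v5, hp.v6, hp.v7, hp.v8, hp.v9,
      ← hNdef] <;> omega
  · intro x hx
    rw [g3]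
    fin_cases hx <;> simp only [hp.v2, hp.v10] <;> omega


theorem main_spec (F : Type*) [Field F] : ∃ K d : ℕ, ∀ (n₁ n₂ n₃ : ℕ), 0 < n₁ → 0 < n₂ → 0 < n₃ →
    ∀ (O : DiagOracle F) (T : Tensor F n₁ n₂ n₃),
      Cost K d (3 * (n₁ * n₂) ^ 4) (2 * (n₁ * n₂) * n₃) (inputState T)
        (main.compile.result O T) ∧
      Agree 0 0 (main.compile.result O T)
        (finish.den O (decompose.den O (prepare.den O (inputState T)))) := by
  have hw := wf_all
  simp only [Bool.and_eq_true] at hw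
  obtain ⟨⟨⟨⟨⟨⟨⟨⟨w1, w2⟩, w3⟩, w4⟩, w5⟩, w6⟩, w7⟩, w8⟩, w9⟩ := hw
  obtain ⟨K1, d1, c1⟩ := exists_cost F w1 tame_sizes (by decide) (by decide)
  obtain ⟨K2, d2, c2⟩ := exists_cost F w2 tame_sizesSq (by decide) (by decide)
  obtain ⟨K3, d3, c3⟩ := exists_cost F w3 tame_basis (by decide) (by decide)
  obtain ⟨K4, d4, c4⟩ := exists_cost F w4 tame_rankSize (by decide) (by decide)
  obtain ⟨K5, d5, c5⟩ := exists_cost F w5 tame_rankSq (by decide) (by decide)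
  obtain ⟨K6, d6, c6⟩ := exists_cost F w6 tame_rankSizes (by decide) (by decide)
  obtain ⟨K7, d7, c7⟩ := exists_cost F w7 tame_minors (by decide) (by decide)
  obtain ⟨K8, d8, c8⟩ := exists_cost F w8 tame_decompose (by decide) (by decide)
  obtain ⟨K9, d9, c9⟩ := exists_cost F w9 tame_finish (by decide) (by decide)
  refine ⟨K1 + (K2 + (K3 + (K4 + (K5 + (K6 + (K7 + (K8 + K9))))))),
    d1 + (d2 + (d3 + (d4 + (d5 + (d6 + (d7 + (d8 + d9))))))), fun n₁ n₂ n₃ h1 h2 h3 O T => ?_⟩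
  obtain ⟨R, u, hp⟩ := prepare_spec O T
  obtain ⟨bS, bL⟩ := hp.bounds h1 h2 h3
  have hN : 1 ≤ n₁ * n₂ := Nat.mul_pos h1 h2
  have hB : 1 ≤ 3 * (n₁ * n₂) ^ 4 := Nat.mul_pos (by norm_num) (Nat.pow_pos hN)
  have hH : 1 ≤ 2 * (n₁ * n₂) * n₃ := Nat.mul_pos (Nat.mul_pos (by norm_num) hN) h3
  set B := 3 * (n₁ * n₂) ^ 4
  set H := 2 * (n₁ * n₂) * n₃
  simp only [prepare, den_seq] at hp bS bL ⊢
  set h0 : State F := inputState T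
  set g1 := sizes.den O h0 with hg1
  set g2 := sizesSq.den O g1 with hg2
  set g3 := basis.den O g2 with hg3
  set g4 := rankSize.den O g3 with hg4
  set g5 := rankSq.den O g4 with hg5
  set g6 := rankSizes.den O g5 with hg6
  set g7 := Algo.minors.den O g6 with hg7
  -- A size does not change once it has been computed, so the bounds known after the preparation
  -- also hold at the start of each earlier part that relies on them.
  have k6 : Same [0, 1, 3, 4, 5, 6, 7, 8, 9, 2, 10] [] [] g6 g7 := Same.of_den O _ _ _ (by decide) _
  have k5 : Same [7] [] [] g5 g6 := Same.of_den O _ _ _ (by decide) _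
  have k4 : Same [6] [] [] g4 g5 := Same.of_den O _ _ _ (by decide) _
  have k4' : Same [6] [] [] g5 g6 := Same.of_den O _ _ _ (by decide) _
  have k2 : Same [0, 1, 2, 3, 4] [] [] g2 g6 :=
    (((Same.of_den O _ _ _ (by decide) _ : Same [0, 1, 2, 3, 4] [] [] g2 g3).den O
      (c := rankSize) (by decide)).den O (c := rankSq) (by decide)).den O (c := rankSizes) (by decide)
  have k1 : Same [0, 1, 2, 3, 4] [] [] g1 g2 := Same.of_den O _ _ _ (by decide) _
  have k0 : Same [0, 1, 2] [] [] h0 g1 := Same.of_den O _ _ _ (by decide) _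
  have e2 : ∀ x ∈ [0, 1, 2, 3, 4], g2.var x = g7.var x := fun x hx => by
    rw [k6.var x (by simp at hx ⊢; omega), k2.var x hx]
  have e1 : ∀ x ∈ [0, 1, 2, 3, 4], g1.var x = g7.var x := fun x hx => by
    rw [← e2 x hx, k1.var x hx]
  have e0 : ∀ x ∈ [0, 1, 2], h0.var x = g7.var x := fun x hx => by
    rw [← e1 x (by simp at hx ⊢; omega), k0.var x hx]
  have e6 : ∀ x ∈ [0, 1, 3, 4, 5, 6, 7, 8, 9, 2, 10], g6.var x = g7.var x := fun x hx =>
    (k6.var x hx).symm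
  obtain ⟨a1, t1⟩ := c1 O h0 h0 B H (Agree.refl ..) hB hH
    (fun x hx => by rw [e0 x (by simp at hx ⊢; omega)]; exact bS x (by simp at hx ⊢; omega))
    (fun x hx => by rw [e0 x (by simp at hx ⊢; omega)]; exact bL x (by simp at hx ⊢; omega))
  obtain ⟨a2, t2⟩ := c2 O _ g1 B H a1 hB hH
    (fun x hx => by rw [e1 x (by simp at hx ⊢; omega)]; exact bS x (by simp at hx ⊢; omega))
    (fun x hx => by rw [e1 x (by simp at hx ⊢; omega)]; exact bL x (by simp at hx ⊢; omega))
  obtain ⟨a3, t3⟩ := c3 O _ g2 B H a2 hB hH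
    (fun x hx => by rw [e2 x (by simp at hx ⊢; omega)]; exact bS x (by simp at hx ⊢; omega))
    (fun x hx => by rw [e2 x (by simp at hx ⊢; omega)]; exact bL x (by simp at hx ⊢; omega))
  obtain ⟨a4, t4⟩ := c4 O _ g3 B H a3 hB hH (by simp) (by simp)
  obtain ⟨a5, t5⟩ := c5 O _ g4 B H a4 hB hH
    (fun x hx => by
      have : x = 6 := by simpa using hx
      subst this
      rw [← k4.var 6 (by decide), ← k4'.var 6 (by decide), e6 6 (by decide)]
      exact bS 6 (by decide)) (by simp)
  obtain ⟨a6, t6⟩ := c6 O _ g5 B H a5 hB hH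
    (fun x hx => by
      have : x = 7 := by simpa using hx
      subst this
      rw [← k5.var 7 (by decide), e6 7 (by decide)]
      exact bS 7 (by decide)) (by simp)
  obtain ⟨a7, t7⟩ := c7 O _ g6 B H a6 hB hH
    (fun x hx => by rw [e6 x (by simp at hx ⊢; omega)]; exact bS x hx)
    (fun x hx => by rw [e6 x (by simp at hx ⊢; omega)]; exact bL x hx)
  obtain ⟨a8, t8⟩ := c8 O _ g7 B H a7 hB hH bS bL
  obtain ⟨a9, t9⟩ := c9 O _ (decompose.den O g7) B H a8 hB hH (by simp) (by simp)
  rw [Program.result, main]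
  simp only [run_seq]
  exact ⟨t1.trans hB (t2.trans hB (t3.trans hB (t4.trans hB (t5.trans hB (t6.trans hB (t7.trans hB
    (t8.trans hB t9))))))), a9⟩

/-- The output of the machine in terms of the arrays. -/
theorem isCertified_output {T : Tensor F n₁ n₂ n₃} {R : ℕ} {s h : State F} (hA : Agree 0 0 s h)
    (hR : h.var 1 = R) (hc : IsCertified T
      (fun a : Fin R => tmul₂ (fun i : Fin n₁ => h.fld 1 a i 0) (fun j : Fin n₂ => h.fld 2 a j 0))
      (fun (a : Fin R) (k : Fin n₃) => h.fld 3 a k 0)) :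
    IsCertified T (fun a => tmul₂ (s.outX n₁ a) (s.outY n₂ a)) (fun a => s.outW n₃ a) := by
  have h1 : s.outLength = R := by rw [State.outLength, hA.var 1 (by norm_num), hR]
  subst h1
  rw [← hA.fld 1 (by norm_num), ← hA.fld 2 (by norm_num), ← hA.fld 3 (by norm_num)] at hc
  exact hc

end Algo

end

end TensorDecomp

/-! ### The main theorem. -/

namespace TensorDecomp

/-- Two unique rank decompositions agree up to a bijection of the summands. -/
theorem exists_equiv_of_unique {F : Type*} [Field F] {n₁ n₂ n₃ R R' : ℕ} {T : Tensor F n₁ n₂ n₃}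
    (hR : R = R') {t : Fin R → Tensor F n₁ n₂ n₃} {t' : Fin R' → Tensor F n₁ n₂ n₃}
    (h : IsUniqueRankDecomposition T t) (h' : IsUniqueRankDecomposition T t') :
    ∃ σ : Fin R ≃ Fin R', ∀ a, t' (σ a) = t a := by
  subst hR
  obtain ⟨σ, hσ⟩ := h'.2 t h.1
  exact ⟨σ, fun a => (hσ a).symm⟩

end TensorDecomp

/-- There are one program and one constant `C` such that, for all dimensions: on every tensor the
program stays within the bounds on steps and oracle calls, and outputs either "Fail" or the unique
tensor rank decomposition, with its certificate; and on generic tensors of rank `R` in the given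
range it recovers the planted decomposition, which is the unique one. -/
theorem corollary1p5 (F : Type*) [RCLike F] :
    ∃ (c : Program) (C : ℕ), ∀ n₁ n₂ n₃ : ℕ, 0 < n₁ → 0 < n₂ → 0 < n₃ →
      (∀ O : DiagOracle F, O.IsValid → ∀ T : Tensor F n₁ n₂ n₃,
        (c.result O T).time ≤ C * (n₁ * n₂) ^ C * n₃ ∧
        (c.result O T).calls ≤ C ∧
        (¬ (c.result O T).IsFail →
          IsUniqueRankDecomposition T ((c.result O T).outSummand n₁ n₂ n₃) ∧
          IsCertified T
            (fun a => tmul₂ ((c.result O T).outX n₁ a) ((c.result O T).outY n₂ a))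
            (fun a => (c.result O T).outW n₃ a))) ∧
      ∀ R : ℕ, (R : ℝ) ≤ min (1 / 4 * ((n₁ : ℝ) - 1) * ((n₂ : ℝ) - 1)) (n₃ : ℝ) →
        ∃ A : Set (Params F n₁ n₂ n₃ R),
          IsZariskiOpenDenseIn (paramVariety F n₁ n₂ n₃ R) A ∧
          ∀ p ∈ A,
            IsUniqueRankDecomposition p.tensor (fun a => tmulMat (p.v a) (p.w a)) ∧
            ∀ O : DiagOracle F, O.IsValid →
              ¬ (c.result O p.tensor).IsFail ∧
              ∃ σ : Fin R ≃ Fin (c.result O p.tensor).outLength,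
                ∀ a, (c.result O p.tensor).outSummand n₁ n₂ n₃ (σ a) =
                  tmulMat (p.v a) (p.w a) := by
  obtain ⟨K, d, hmain⟩ := Algo.main_spec F
  have sound : ∀ n₁ n₂ n₃ : ℕ, 0 < n₁ → 0 < n₂ → 0 < n₃ → ∀ (O : DiagOracle F)
      (T : Tensor F n₁ n₂ n₃), ¬ (Algo.main.compile.result O T).IsFail →
        IsUniqueRankDecomposition T ((Algo.main.compile.result O T).outSummand n₁ n₂ n₃) ∧
        IsCertified T (fun a => tmul₂ ((Algo.main.compile.result O T).outX n₁ a)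
          ((Algo.main.compile.result O T).outY n₂ a))
          (fun a => (Algo.main.compile.result O T).outW n₃ a) := by
    intro n₁ n₂ n₃ h₁ h₂ h₃ O T hf
    obtain ⟨R, u, hp⟩ := Algo.prepare_spec O T
    obtain ⟨-, hA⟩ := hmain n₁ n₂ n₃ h₁ h₂ h₃ O T
    rw [State.IsFail, hA.var 0 (by norm_num)] at hf
    obtain ⟨hR, hc⟩ := Algo.sound two_ne_zero O hp hf
    have hc' := Algo.isCertified_output hA hR hc
    exact ⟨hc'.unique two_ne_zero fun a => ⟨_, _, rfl⟩, hc'⟩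
  -- With `N = n₁ n₂` the cost is `K (3 N⁴)ᵈ (2 N n₃) = 2 K 3ᵈ N^(4d + 1) n₃`. A single constant has
  -- to bound this coefficient, the exponent and the number `K` of calls.
  refine ⟨Algo.main.compile, K * 3 ^ d * 2 + K + (4 * d + 1), fun n₁ n₂ n₃ h₁ h₂ h₃ =>
    ⟨fun O _ T => ⟨?_, ?_, sound n₁ n₂ n₃ h₁ h₂ h₃ O T⟩, fun R hR => ?_⟩⟩
  · refine (hmain n₁ n₂ n₃ h₁ h₂ h₃ O T).1.1.trans ?_
    have hN : 1 ≤ n₁ * n₂ := Nat.mul_pos h₁ h₂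
    set N := n₁ * n₂
    calc (inputState T).time + K * (3 * N ^ 4) ^ d * (2 * N * n₃) =
          K * 3 ^ d * 2 * N ^ (4 * d + 1) * n₃ := by
            simp only [inputState]
            ring
      _ ≤ _ := by
        refine Nat.mul_le_mul_right _ (Nat.mul_le_mul (by omega) ?_)
        exact Nat.pow_le_pow_right hN (by omega)
  · refine (hmain n₁ n₂ n₃ h₁ h₂ h₃ O T).1.2.trans ?_
    simp only [inputState]
    omega
  · obtain ⟨hR₁, hR₂⟩ := le_of_real_le h₁ h₂ hR
    refine ⟨independentParams F n₁ n₂ n₃ R, isZariskiOpenDenseIn_independentParams hR₁ hR₂,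
      fun p hp => ?_⟩
    obtain ⟨hY, hv, hw, hm⟩ := hp
    have hu : IsUniqueRankDecomposition p.tensor (fun a => tmulMat (p.v a) (p.w a)) :=
      (isCertified_of_independent two_ne_zero rfl hY hv hw hm).unique two_ne_zero hY
    refine ⟨hu, fun O hO => ?_⟩
    have hf : ¬ (Algo.main.compile.result O p.tensor).IsFail := by
      obtain ⟨R', u, hp'⟩ := Algo.prepare_spec O p.tensor
      obtain ⟨-, hA⟩ := hmain n₁ n₂ n₃ h₁ h₂ h₃ O p.tensor
      rw [State.IsFail, hA.var 0 (by norm_num)]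
      -- The dimension found by the preparation is the planted number of summands, since the factors
      -- are independent.
      obtain rfl : R = R' := (finrank_of_independent hv hw).symm.trans hp'.rank
      exact Algo.complete hO hp' rfl hv hY hm
    refine ⟨hf, ?_⟩
    -- The output need not be traced back to the planted summands: both are unique rank
    -- decompositions of the same tensor, so they agree up to order.
    have hout := (sound n₁ n₂ n₃ h₁ h₂ h₃ O p.tensor hf).1
    generalize (Algo.main.compile.result O p.tensor) = s at hout
    have hlen : R = s.outLength := hu.1.2.trans hout.1.2.symm
    exact exists_equiv_of_unique hlen hu hout
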